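/- Let $n,l\in\mathbb{N}=\{1,2,\dots\}$, $p,q,r\in(0,\infty]$, $\alpha_1,\alpha_2\in\mathbb{R}$, $\alpha_3\ge 0$, $\sigma_1,\sigma_2\in(0,\infty]$, $c>1$. All integral means and sums below are replaced in the usual way by (essential) suprema when an exponent is $\infty$, with $\frac{1}{\infty}=0$. All cubes are open with sides parallel to the axes, $r(Q)$ is the side length of $Q$, $cQ$ is the concentric cube with $r(cQ)=c\,r(Q)$, $I^n=(-1,1)^n$, and $Q_{k,m}=\prod_{i=1}^n(\frac{m_i}{2^k},\frac{m_i+1}{2^k})$ for $k\in\mathbb{N}_0$, $m\in\mathbb{Z}^n$. **Weights.** Let $t_k:\mathbb{R}^n\to(0,\infty)$, $k\in\mathbb{N}_0$, be measurable with $t_k\in L_p^{\rm loc}(\mathbb{R}^n)$, and put $t_{k,m}=\|t_k|L_p(Q_{k,m})\|$ and $\overline t_k=2^{kn/p}\sum_{m}t_{k,m}\chi_{\widetilde Q_{k,m}}$, where $\widetilde Q_{k,m}=\prod_{i}[\frac{m_i}{2^k},\frac{m_i+1}{2^k})$. The sequence $\{t_k\}$ belongs to $X^{\alpha_3}_{\alpha,\sigma,p}$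 if there are $C_1,C_2>0$ such that for all $0\le k\le j$ and $m\in\mathbb{Z}^n$ $$\Bigl(2^{kn}\!\int_{Q_{k,m}}\overline t_k^{\,p}\Bigr)^{\frac1p}\Bigl(2^{kn}\!\int_{Q_{k,m}}\overline t_j^{\,-\sigma_1}\Bigr)^{\frac1{\sigma_1}}\le C_12^{\alpha_1(k-j)},\qquad \Bigl(2^{kn}\!\int_{Q_{k,m}}\overline t_k^{\,p}\Bigr)^{-\frac1p}\Bigl(2^{kn}\!\int_{Q_{k,m}}\overline t_j^{\,\sigma_2}\Bigr)^{\frac1{\sigma_2}}\le C_22^{\alpha_2(j-k)},$$ and if $0<t_{k,m}\le 2^{\alpha_3}t_{k,\widetilde m}$ for all $k\in\mathbb{N}_0$ and all $m,\widetilde m\in\mathbb{Z}^n$ with $|m_i-\widetilde m_i|\le 1$ for every $i$. **Local quantities.** For $\Omega\subset\mathbb{R}^n$ let $\Delta^l(h,\Omega)\varphi(x)=\sum_{j=0}^l\binom lj(-1)^{l+j}\varphi(x+jh)$ if $[x,x+lh]\subset\Omega$, and $0$ otherwise. For a cube $Q$ put $$\delta^l_r(Q,\Omega)\varphi=\Bigl(\frac1{r(Q)^{2n}}\int_{r(Q)I^n}\int_Q|\Delta^l(h,\Omega)\varphi(x)|^r\,dx\,dh\Bigr)^{\frac1r},\qquad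 \delta^l_r(Q)\varphi=\delta^l_r(Q,\mathbb{R}^n)\varphi,$$ $$E_l(\varphi,Q)_r=\inf_{\deg P<l}\|\varphi-P|L_r(Q)\|,\qquad \omega_l(\varphi,Q)_r=\sup_{|h|>0}\|\Delta^l(h,Q)\varphi|L_r(\mathbb{R}^n)\|,$$ where the infimum is over polynomials $P$ of total degree $<l$. **Quasi-norms.** The space $\widetilde B^l_{p,q,r}(\mathbb{R}^n,\{t_k\})$ consists of all real-valued $\varphi\in L_r^{\rm loc}(\mathbb{R}^n)$ with $$\|\varphi|\widetilde B^l_{p,q,r}(\mathbb{R}^n,\{t_k\})\|=\Bigl(\sum_{k=1}^\infty\bigl\|t_k\,\delta^l_r(\cdot+2^{-k}I^n)\varphi|L_p(\mathbb{R}^n)\bigr\|^q\Bigr)^{\frac1q}+\Bigl(\int_{\mathbb{R}^n}t_0^p(x)\|\varphi|L_r(x+I^n)\|^p\,dx\Bigr)^{\frac1p}<\infty .$$ Fix $k_0\in\{0,1\}$. For $i=1,2,3,4$ set $$\|\varphi\|^{(i)}=\Bigl(\sum_{k\ge k_0}\Bigl(\sum_{m\in\mathbb{Z}^n}t_{k,m}^p\,\bigl[A^{(i)}_{k,m}(\varphi)\bigr]^p\Bigr)^{\frac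 qp}\Bigr)^{\frac1q}+\Bigl(\sum_{m\in\mathbb{Z}^n}t_{0,m}^p\|\varphi|L_r(Q_{0,m})\|^p\Bigr)^{\frac1p},$$ where $A^{(1)}_{k,m}(\varphi)=\delta^l_r(Q_{k,m})\varphi$, $A^{(2)}_{k,m}(\varphi)=\delta^l_r(cQ_{k,m},cQ_{k,m})\varphi$, $A^{(3)}_{k,m}(\varphi)=2^{kn/r}E_l(\varphi,cQ_{k,m})_r$, and $A^{(4)}_{k,m}(\varphi)=2^{kn/r}\omega_l(\varphi,cQ_{k,m})_r$. **Theorem.** Let $\{t_k\}\in X^{\alpha_3}_{\alpha,\sigma,p}$. Then each of $\|\cdot\|^{(1)},\|\cdot\|^{(2)},\|\cdot\|^{(3)},\|\cdot\|^{(4)}$ is an equivalent quasi-norm on $\widetilde B^l_{p,q,r}(\mathbb{R}^n,\{t_k\})$. That is, for each $i$, a function $\varphi\in L_r^{\rm loc}(\mathbb{R}^n)$ belongs to $\widetilde B^l_{p,q,r}(\mathbb{R}^n,\{t_k\})$ if and only if $\|\varphi\|^{(i)}<\infty$, and there is a constant $C>0$ such that for all $\varphi\in\widetilde B^l_{p,q,r}(\mathbb{R}^n,\{t_k\})$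 $$C^{-1}\|\varphi|\widetilde B^l_{p,q,r}(\mathbb{R}^n,\{t_k\})\|\le\|\varphi\|^{(i)}\le C\,\|\varphi|\widetilde B^l_{p,q,r}(\mathbb{R}^n,\{t_k\})\| .$$ -/

import Mathlib

open MeasureTheory
open scoped ENNReal NNReal

namespace VarBesov

noncomputable section

/-! Cubes -/

/-- Data of a cube in `ℝⁿ` with sides parallel to the coordinate axes: its center and its side
length (every cube occurring below has positive side length). -/
structure Cube (n : ℕ) where
  center : Fin n → ℝ
  side : ℝ

/-- The open cube itself. -/
def Cube.toSet {n : ℕ} (Q : Cube n) : Set (Fin n → ℝ) :=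
  Set.univ.pi fun i => Set.Ioo (Q.center i - Q.side / 2) (Q.center i + Q.side / 2)

/-- The cube `c Q`, concentric with `Q`, with side length `c * r(Q)`. -/
def Cube.dilate {n : ℕ} (c : ℝ) (Q : Cube n) : Cube n := ⟨Q.center, c * Q.side⟩

/-- The open dyadic cube `Q_{k,m}` of side length `2^{-k}`. -/
def dyadicCube {n : ℕ} (k : ℕ) (m : Fin n → ℤ) : Cube n :=
  ⟨fun i => ((m i : ℝ) + 1 / 2) / 2 ^ k, 1 / 2 ^ k⟩

theorem dyadicCube_toSet {n : ℕ} (k : ℕ) (m : Fin n → ℤ) :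
    (dyadicCube k m).toSet =
      Set.univ.pi fun i => Set.Ioo ((m i : ℝ) / 2 ^ k) (((m i : ℝ) + 1) / 2 ^ k) := by
  unfold dyadicCube Cube.toSet
  congr 1
  funext i
  congr 1 <;> ring

/-- The half-open dyadic cube. -/
def halfOpenDyadicCube {n : ℕ} (k : ℕ) (m : Fin n → ℤ) : Set (Fin n → ℝ) :=
  Set.univ.pi fun i => Set.Ico ((m i : ℝ) / 2 ^ k) (((m i : ℝ) + 1) / 2 ^ k)

/-- `x + s Iⁿ`, where `Iⁿ = (-1,1)ⁿ`. -/
def boxAt {n : ℕ} (x : Fin n → ℝ) (s : ℝ) : Cube n := ⟨x, 2 * s⟩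

theorem boxAt_toSet {n : ℕ} (x : Fin n → ℝ) (s : ℝ) :
    (boxAt x s).toSet = Set.univ.pi fun i => Set.Ioo (x i - s) (x i + s) := by
  unfold boxAt Cube.toSet
  congr 1
  funext i
  congr 1 <;> ring

/-! Local integrability; differences, moduli of continuity and best approximation -/

/-- `f ∈ L_r^loc(ℝⁿ)`. -/
def LocMemLp {n : ℕ} (f : (Fin n → ℝ) → ℝ) (r : ℝ≥0∞) : Prop :=
  ∀ K : Set (Fin n → ℝ), IsCompact K → MemLp f r (volume.restrict K)

open Classical in
/-- The difference `Δ^l(h, Ω) g (x)`. -/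
def diff {n : ℕ} (l : ℕ) (h : Fin n → ℝ) (Ω : Set (Fin n → ℝ)) (g : (Fin n → ℝ) → ℝ)
    (x : Fin n → ℝ) : ℝ :=
  if segment ℝ x (x + (l : ℝ) • h) ⊆ Ω then
    ∑ j ∈ Finset.range (l + 1), (l.choose j : ℝ) * (-1) ^ (l + j) * g (x + (j : ℝ) • h)
  else 0

/-- `δ^l_r(Q, Ω) g`: the `L_r`-norm of `(h, x) ↦ Δ^l(h, Ω) g (x)` on `(r(Q) Iⁿ) × Q`, times
`r(Q)^{-2n/r}`; for `r = ∞` the factor is `1` and the norm is an essential supremum. -/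
def delta {n : ℕ} (l : ℕ) (r : ℝ≥0∞) (Q : Cube n) (Ω : Set (Fin n → ℝ))
    (g : (Fin n → ℝ) → ℝ) : ℝ≥0∞ :=
  (ENNReal.ofReal Q.side ^ (2 * n)) ^ (-(1 / r.toReal)) *
    eLpNorm (fun z : (Fin n → ℝ) × (Fin n → ℝ) => diff l z.1 Ω g z.2) r
      ((volume.restrict (boxAt 0 Q.side).toSet).prod (volume.restrict Q.toSet))

/-- The modulus of continuity `ω_l(φ, Q)_r`. -/
def modulus {n : ℕ} (l : ℕ) (r : ℝ≥0∞) (φ : (Fin n → ℝ) → ℝ) (Q : Cube n) : ℝ≥0∞ :=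
  ⨆ (h : Fin n → ℝ) (_ : h ≠ 0), eLpNorm (diff l h Q.toSet φ) r volume

/-- The local best approximation `E_l(φ, Q)_r` by polynomials of total degree `< l`. -/
def bestApprox {n : ℕ} (l : ℕ) (r : ℝ≥0∞) (φ : (Fin n → ℝ) → ℝ) (Q : Cube n) : ℝ≥0∞ :=
  ⨅ (P : MvPolynomial (Fin n) ℝ) (_ : P.totalDegree < l),
    eLpNorm (fun x => φ x - MvPolynomial.eval x P) r (volume.restrict Q.toSet)

/-! Weight sequences -/

/-- A weight: a (Lebesgue) measurable function with values in `(0, ∞)`. -/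
def IsWeight {n : ℕ} (γ : (Fin n → ℝ) → ℝ) : Prop :=
  AEMeasurable γ volume ∧ ∀ x, 0 < γ x

/-- A `p`-admissible weight sequence `{t_k}`, `k = 0, 1, 2, …`. -/
def IsAdmissible {n : ℕ} (p : ℝ≥0∞) (t : ℕ → (Fin n → ℝ) → ℝ) : Prop :=
  ∀ k, IsWeight (t k) ∧ LocMemLp (t k) p

/-- The `p`-associated multiple sequence `t_{k,m} = ‖t_k | L_p(Q_{k,m})‖`. -/
def assoc {n : ℕ} (p : ℝ≥0∞) (t : ℕ → (Fin n → ℝ) → ℝ) (k : ℕ) (m : Fin n → ℤ) : ℝ≥0∞ :=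
  eLpNorm (t k) p (volume.restrict (dyadicCube k m).toSet)

/-- `2^{kn/s}`, with the value `1` for `s = ∞`. -/
def scale (n : ℕ) (k : ℕ) (s : ℝ≥0∞) : ℝ≥0∞ := (2 : ℝ≥0∞) ^ ((k * n : ℝ) * (1 / s.toReal))

/-- The `p`-associated weight sequence `\overline{t}_k`. -/
def assocWeight {n : ℕ} (p : ℝ≥0∞) (t : ℕ → (Fin n → ℝ) → ℝ) (k : ℕ) (x : Fin n → ℝ) : ℝ≥0∞ :=
  scale n k p * ∑' m : Fin n → ℤ,
    (halfOpenDyadicCube k m).indicator (fun _ => assoc p t k m) x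

/-- `(2^{kn} ∫_{Q_{k,m}} f^s)^{1/s}`, and `ess sup_{Q_{k,m}} f` for `s = ∞`. -/
def cubeMean {n : ℕ} (s : ℝ≥0∞) (f : (Fin n → ℝ) → ℝ≥0∞) (k : ℕ) (m : Fin n → ℤ) : ℝ≥0∞ :=
  scale n k s * eLpNorm f s (volume.restrict (dyadicCube k m).toSet)

/-- The class `X^{α₃}_{α,σ,p}(ℝⁿ)`, `α = (α₁, α₂)`, `σ = (σ₁, σ₂)`. -/
structure InClassX {n : ℕ} (α₁ α₂ α₃ : ℝ) (σ₁ σ₂ p : ℝ≥0∞) (t : ℕ → (Fin n → ℝ) → ℝ) : Prop where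
  admissible : IsAdmissible p t
  lower : ∃ C₁ : ℝ, 0 < C₁ ∧ ∀ (k j : ℕ) (m : Fin n → ℤ), k ≤ j →
    cubeMean p (assocWeight p t k) k m *
      cubeMean σ₁ (fun x => (assocWeight p t j x)⁻¹) k m ≤
        ENNReal.ofReal (C₁ * (2 : ℝ) ^ (α₁ * ((k : ℝ) - (j : ℝ))))
  upper : ∃ C₂ : ℝ, 0 < C₂ ∧ ∀ (k j : ℕ) (m : Fin n → ℤ), k ≤ j →
    (cubeMean p (assocWeight p t k) k m)⁻¹ * cubeMean σ₂ (assocWeight p t j) k m ≤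
        ENNReal.ofReal (C₂ * (2 : ℝ) ^ (α₂ * ((j : ℝ) - (k : ℝ))))
  doubling : ∀ (k : ℕ) (m m' : Fin n → ℤ), (∀ i, |m i - m' i| ≤ 1) →
    0 < assoc p t k m ∧ assoc p t k m ≤ ENNReal.ofReal ((2 : ℝ) ^ α₃) * assoc p t k m'

/-! The Besov space of variable smoothness and the discrete quasi-norms -/

/-- The `ℓ_q` quasi-norm, `q ∈ (0, ∞]`, of a family in `[0, ∞]`. -/
def seqNorm {ι : Type} (q : ℝ≥0∞) (a : ι → ℝ≥0∞) : ℝ≥0∞ :=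
  if q = ∞ then ⨆ i, a i else (∑' i, a i ^ q.toReal) ^ (1 / q.toReal)

/-- `‖φ | \widetilde{B}^l_{p,q,r}(ℝⁿ, {t_k})‖` (the `ℓ_q`-sum is over `k = 1, 2, …`). -/
def besovNorm {n : ℕ} (l : ℕ) (p q r : ℝ≥0∞) (t : ℕ → (Fin n → ℝ) → ℝ)
    (φ : (Fin n → ℝ) → ℝ) : ℝ≥0∞ :=
  seqNorm q (fun k : ℕ => eLpNorm (fun x => ENNReal.ofReal (t (k + 1) x) *
      delta l r (boxAt x (1 / 2 ^ (k + 1))) Set.univ φ) p volume) +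
    eLpNorm (fun x => ENNReal.ofReal (t 0 x) *
      eLpNorm φ r (volume.restrict (boxAt x 1).toSet)) p volume

/-- The space `\widetilde{B}^l_{p,q,r}(ℝⁿ, {t_k})`. -/
def besovSpace {n : ℕ} (l : ℕ) (p q r : ℝ≥0∞) (t : ℕ → (Fin n → ℝ) → ℝ) :
    Set ((Fin n → ℝ) → ℝ) :=
  {φ | LocMemLp φ r ∧ besovNorm l p q r t φ < ∞}

/-- The common form of the discrete quasi-norms: `A k m` is the local quantity on level `k`, and
the levels in the `ℓ_q`-norm are `k = k₀, k₀ + 1, …`. -/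
def discreteNorm {n : ℕ} (k₀ : ℕ) (p q r : ℝ≥0∞) (t : ℕ → (Fin n → ℝ) → ℝ)
    (φ : (Fin n → ℝ) → ℝ) (A : ℕ → (Fin n → ℤ) → ℝ≥0∞) : ℝ≥0∞ :=
  seqNorm q (fun k : ℕ =>
      seqNorm p (fun m : Fin n → ℤ => assoc p t (k₀ + k) m * A (k₀ + k) m)) +
    seqNorm p (fun m : Fin n → ℤ =>
      assoc p t 0 m * eLpNorm φ r (volume.restrict (dyadicCube 0 m).toSet))

/-- The quasi-norm `‖·‖^{(1)}`, built from `δ^l_r(Q_{k,m})`. -/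
def norm1 {n : ℕ} (k₀ l : ℕ) (p q r : ℝ≥0∞) (t : ℕ → (Fin n → ℝ) → ℝ)
    (φ : (Fin n → ℝ) → ℝ) : ℝ≥0∞ :=
  discreteNorm k₀ p q r t φ fun k m => delta l r (dyadicCube k m) Set.univ φ

/-- The quasi-norm `‖·‖^{(2)}`, built from `δ^l_r(c Q_{k,m}, c Q_{k,m})`. -/
def norm2 {n : ℕ} (k₀ l : ℕ) (p q r : ℝ≥0∞) (t : ℕ → (Fin n → ℝ) → ℝ) (c : ℝ)
    (φ : (Fin n → ℝ) → ℝ) : ℝ≥0∞ :=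
  discreteNorm k₀ p q r t φ fun k m =>
    delta l r ((dyadicCube k m).dilate c) ((dyadicCube k m).dilate c).toSet φ

/-- The quasi-norm `‖·‖^{(3)}`, built from `2^{kn/r} E_l(φ, c Q_{k,m})_r`. -/
def norm3 {n : ℕ} (k₀ l : ℕ) (p q r : ℝ≥0∞) (t : ℕ → (Fin n → ℝ) → ℝ) (c : ℝ)
    (φ : (Fin n → ℝ) → ℝ) : ℝ≥0∞ :=
  discreteNorm k₀ p q r t φ fun k m =>
    scale n k r * bestApprox l r φ ((dyadicCube k m).dilate c)

/-- The quasi-norm `‖·‖^{(4)}`, built from `2^{kn/r} ω_l(φ, c Q_{k,m})_r`. -/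
def norm4 {n : ℕ} (k₀ l : ℕ) (p q r : ℝ≥0∞) (t : ℕ → (Fin n → ℝ) → ℝ) (c : ℝ)
    (φ : (Fin n → ℝ) → ℝ) : ℝ≥0∞ :=
  discreteNorm k₀ p q r t φ fun k m =>
    scale n k r * modulus l r φ ((dyadicCube k m).dilate c)

/-- `N'` is a quasi-norm equivalent to the quasi-norm of `\widetilde{B}^l_{p,q,r}(ℝⁿ, {t_k})`:
among the functions in `L_r^loc`, it is finite exactly on that space, and on the space the two are
estimated by each other with constants independent of the function. -/
def EquivToBesovNorm {n : ℕ} (l : ℕ) (p q r : ℝ≥0∞) (t : ℕ → (Fin n → ℝ) → ℝ)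
    (N' : ((Fin n → ℝ) → ℝ) → ℝ≥0∞) : Prop :=
  (∀ φ, LocMemLp φ r → (φ ∈ besovSpace l p q r t ↔ N' φ < ∞)) ∧
  ∃ C : ℝ≥0, ∀ φ ∈ besovSpace l p q r t,
    N' φ ≤ C * besovNorm l p q r t φ ∧ besovNorm l p q r t φ ≤ C * N' φ

end

end VarBesov

/-! Each quasi-norm is a weighted ℓ_q(ℓ_p) sum of local quantities. The weights `assoc p t k m` of
neighbouring cubes of one level are comparable, with constants independent of the level, so an
inequality between local quantities may lose a sum over boundedly many neighbours Q_{k,m+e}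
(`InClassX.discreteNorm_le_of_le_sum`). Let E(κ) be the quasi-norm built from best approximation on
κQ_{k,m}, with κ = max(4l+3, c). Up to constants, two chains give everything: besov ≤ E(κ) ≤ norm1 ≤
besov, and E(κ) ≤ norm2 ≤ norm4 ≤ E(c) ≤ E(κ). Differences of order l annihilate polynomials of
degree < l, so they are bounded by best approximation (`eLpNorm_fdiff_le_bestApprox`). Averaging the
modulus over h gives norm2 ≤ norm4. For x in Q_{k,m} the cube is contained in x + 2^{-k}Iⁿ, which
gives norm1 ≤ besov on levels k ≥ 1; level 0 is absorbed by the L_r term.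

The substantial point is E(κ) ≤ norm1 and E(κ) ≤ norm2. It is Whitney's inequality with small steps,
`bestApprox_le_eLpNorm_fdiff`: for every r in (0,∞] and every ρ > 0, E_l(φ,Q)_r is bounded by a mean
of Δ^l_h φ(x) over pairs with x and x + lh in Q and |h| < ρ r(Q). Because ρ is free, differences
based in Q_{k,m+e} stay inside cQ_{k,m+e} for any c > 1, and yet they control best approximation on
the large cube κQ_{k,m}.

Since r may be less than 1, Whitney's inequality is proved pointwise, through exceptional sets.
Rescale so that |Δ^l_h f(x)| ≤ 1 for all pairs in the unit cube outside a set of small measure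
(`badSet`). Most points x have few bad steps; they form a good set G (`GoodSet`). Interchanging two
differences shows that on G all differences with moderate steps are bounded (`GoodSet.fdiff_bound`).
Suppose |f - P| ≤ M on G. Averaging the prediction of a value of f - P from the other nodes of a
difference gives a smoother function on the whole cube, with bounded differences and a quantitative
modulus of continuity. Newton interpolation on a fine grid, with mixed differences controlled by
pure ones (`abs_evalAt_prod_le`), approximates it by a polynomial up to a constant plus a small
multiple of M (`exists_poly_near_of_fdiff_le`). So the error M improves to K + M/2
(`GoodSet.improve`), and iteration leaves a bound depending only on K. Finally every point of the
cube is connected to G by one generic difference (`exists_poly_pointwise_unit`), and the resulting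
pointwise estimate is integrated. -/

open MeasureTheory
open scoped ENNReal NNReal

namespace VarBesov

/-! Finite differences -/

section GroupAlgebra

variable {E : Type*} [AddCommGroup E]

/-- The evaluation functional on the group algebra sending the translation by `v` to `u (x + v)`. -/
noncomputable def evalAt (u : E → ℝ) (x : E) : AddMonoidAlgebra ℝ E →ₗ[ℝ] ℝ :=
  (Finsupp.linearCombination ℝ (fun v => u (x + v))) ∘ₗ
    (AddMonoidAlgebra.coeffLinearEquiv ℝ : AddMonoidAlgebra ℝ E ≃ₗ[ℝ] (E →₀ ℝ)).toLinearMap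

/-- Translation by `v`, as an element of the group algebra. -/
noncomputable def shift (v : E) : AddMonoidAlgebra ℝ E := AddMonoidAlgebra.single v 1

theorem evalAt_shift (u : E → ℝ) (x v : E) : evalAt u x (shift v) = u (x + v) := by
  simp [evalAt, shift]

theorem shift_add (v w : E) : shift (v + w) = shift v * shift w := by
  simp [shift, AddMonoidAlgebra.single_mul_single]

theorem shift_sum {ι : Type*} (s : Finset ι) (v : ι → E) :
    shift (∑ i ∈ s, v i) = ∏ i ∈ s, shift (v i) := by
  classical
  induction s using Finset.induction_on with
  | empty => simp [shift, AddMonoidAlgebra.one_def]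
  | insert a s ha ih => rw [Finset.sum_insert ha, Finset.prod_insert ha, shift_add, ih]

theorem prod_one_sub_shift {ι : Type*} (s : Finset ι) (v : ι → E) :
    ∏ i ∈ s, (1 - shift (v i)) =
      ∑ S ∈ s.powerset, ((-1 : ℝ) ^ S.card) • shift (∑ i ∈ S, v i) := by
  simp only [sub_eq_add_neg]
  rw [Finset.prod_one_add]
  refine Finset.sum_congr rfl fun S _ => ?_
  rw [shift_sum, Finset.prod_neg]
  rcases neg_one_pow_eq_or ℝ S.card with h | h <;>
  rcases Nat.even_or_odd S.card with h' | h' <;> simp [h'.neg_one_pow]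

end GroupAlgebra

section Algebra

variable {E : Type*} [AddCommGroup E] [Module ℝ E]

/-- The difference `Δ^l_h f (x)`. -/
noncomputable def fdiff (l : ℕ) (f : E → ℝ) (x h : E) : ℝ :=
  ∑ j ∈ Finset.range (l + 1), (l.choose j : ℝ) * (-1) ^ (l + j) * f (x + (j : ℝ) • h)

theorem fdiff_sub (l : ℕ) (f g : E → ℝ) (x h : E) :
    fdiff l (fun y => f y - g y) x h = fdiff l f x h - fdiff l g x h := by
  simp only [fdiff, mul_sub, Finset.sum_sub_distrib]

theorem sum_choose_real (l : ℕ) : ∑ j ∈ Finset.range (l + 1), (l.choose j : ℝ) = 2 ^ l := by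
  exact_mod_cast Nat.sum_range_choose l

theorem abs_sum_choose_le (l : ℕ) (a : ℕ → ℝ) (M : ℝ) (h : ∀ j ≤ l, |a j| ≤ M) :
    |∑ j ∈ Finset.range (l + 1), (l.choose j : ℝ) * (-1) ^ (l + j) * a j| ≤ 2 ^ l * M := by
  refine (Finset.abs_sum_le_sum_abs _ _).trans ?_
  rw [← sum_choose_real, Finset.sum_mul]
  refine Finset.sum_le_sum fun j hj => ?_
  rw [abs_mul, abs_mul, abs_pow, abs_neg, abs_one, one_pow, mul_one, Nat.abs_cast]
  exact mul_le_mul_of_nonneg_left (h j (by simpa [Nat.lt_succ_iff] using hj)) (by positivity)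

theorem abs_fdiff_le (l : ℕ) (f : E → ℝ) (x h : E) (M : ℝ)
    (H : ∀ j ≤ l, |f (x + (j : ℝ) • h)| ≤ M) : |fdiff l f x h| ≤ 2 ^ l * M :=
  abs_sum_choose_le l _ M H

/-- Interchange of two differences along a bilinear array of points. -/
theorem sum_fdiff_comm (l : ℕ) (f : E → ℝ) (p : ℕ → E) (q : ℕ → E) (x k w w' : E) (τ : ℝ)
    (hp : ∀ i, p i = x + (i : ℝ) • k)
    (hq : ∀ i, q i = w + (i : ℝ) • w' - τ • (x + (i : ℝ) • k)) :
    ∑ i ∈ Finset.range (l + 1), (l.choose i : ℝ) * (-1) ^ (l + i) * fdiff l f (p i) (q i) =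
      ∑ j ∈ Finset.range (l + 1), (l.choose j : ℝ) * (-1) ^ (l + j) *
        fdiff l f ((1 - j * τ) • x + (j : ℝ) • w) ((1 - j * τ) • k + (j : ℝ) • w') := by
  simp only [fdiff, Finset.mul_sum]
  rw [Finset.sum_comm]
  refine Finset.sum_congr rfl fun j _ => Finset.sum_congr rfl fun i _ => ?_
  have : p i + (j : ℝ) • q i = (1 - j * τ) • x + (j : ℝ) • w +
      (i : ℝ) • ((1 - j * τ) • k + (j : ℝ) • w') := by
    rw [hp, hq]; module
  rw [this]; ring

theorem shift_nsmul (m : ℕ) (v : E) : shift ((m : ℝ) • v) = shift v ^ m := by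
  induction m with
  | zero => simp [shift, AddMonoidAlgebra.one_def]
  | succ m ih => rw [pow_succ, ← ih, ← shift_add]; congr 1; push_cast; module

/-- Mixed differences of order at least `l` are controlled by differences `Δ^l`. -/
theorem abs_evalAt_prod_le {ι : Type*} (l : ℕ) (u : E → ℝ) (x : E) (s : Finset ι) (v : ι → E)
    (c : ι → ℝ) (hc : ∀ j : ℕ, 1 ≤ j → j ≤ l → ∃ i ∈ s, (j : ℝ) * c i = 1) (κ : ℝ)
    (H : ∀ S ⊆ s, |fdiff l u (x + ∑ i ∈ S, v i) (-∑ i ∈ S, c i • v i)| ≤ κ) :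
    |evalAt u x (∏ i ∈ s, (1 - shift (v i)))| ≤ 2 ^ s.card * κ := by
  -- For j ≥ 1 the factor with j c_i = 1 is `1 - shift 0 = 0`, so only j = 0 survives. Expanding the
  -- same products over subsets S makes the sum over j an l-th difference with step -∑_{i ∈ S} c_i
  -- v_i.
  have key : ∑ j ∈ Finset.range (l + 1), ((l.choose j : ℝ) * (-1) ^ (l + j)) •
      ∏ i ∈ s, (1 - shift ((1 - (j : ℝ) * c i) • v i)) =
      ((-1 : ℝ) ^ l) • ∏ i ∈ s, (1 - shift (v i)) := by
    rw [Finset.sum_eq_single_of_mem 0 (by simp)]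
    · simp
    · intro j hj hj0
      obtain ⟨i, hi, hi'⟩ := hc j (Nat.one_le_iff_ne_zero.2 hj0) (by simpa [Nat.lt_succ_iff] using hj)
      rw [Finset.prod_eq_zero hi, smul_zero]
      simp [hi', shift, AddMonoidAlgebra.one_def]
  have key2 := congrArg (evalAt u x) key
  rw [map_smul, map_sum] at key2
  have e1 : |evalAt u x (∏ i ∈ s, (1 - shift (v i)))| =
      |((-1 : ℝ) ^ l) • evalAt u x (∏ i ∈ s, (1 - shift (v i)))| := by
    simp [abs_mul]
  rw [e1, ← key2]
  have e2 : ∑ j ∈ Finset.range (l + 1), evalAt u x (((l.choose j : ℝ) * (-1) ^ (l + j)) •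
      ∏ i ∈ s, (1 - shift ((1 - (j : ℝ) * c i) • v i))) =
      ∑ S ∈ s.powerset, (-1 : ℝ) ^ S.card *
        fdiff l u (x + ∑ i ∈ S, v i) (-∑ i ∈ S, c i • v i) := by
    simp only [prod_one_sub_shift, map_smul, map_sum, evalAt_shift, smul_eq_mul, fdiff,
      Finset.mul_sum]
    rw [Finset.sum_comm]
    refine Finset.sum_congr rfl fun S _ => Finset.sum_congr rfl fun j _ => ?_
    have : x + ∑ i ∈ S, (1 - (j : ℝ) * c i) • v i =
        x + ∑ i ∈ S, v i + (j : ℝ) • -∑ i ∈ S, c i • v i := by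
      simp only [sub_smul, one_smul, Finset.sum_sub_distrib, mul_smul, ← Finset.smul_sum]
      module
    rw [this]; ring
  rw [e2]
  refine (Finset.abs_sum_le_sum_abs _ _).trans ?_
  refine (Finset.sum_le_card_nsmul _ _ κ fun S hS => ?_).trans ?_
  · rw [abs_mul, abs_pow, abs_neg, abs_one, one_pow, one_mul]
    exact H S (Finset.mem_powerset.1 hS)
  · simp

/-- The numbers 1, 1/2, …, 1/l are placed on l of the indices and 0 on the rest. The bound on the
sum keeps the steps ∑ c_i v_i within l times the length of the v_i. -/
theorem exists_reciprocals {ι : Type*} (s : Finset ι) (l : ℕ) (hl : l ≤ s.card) :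
    ∃ c : ι → ℝ, (∀ i, 0 ≤ c i) ∧ (∑ i ∈ s, c i ≤ l) ∧
      ∀ j : ℕ, 1 ≤ j → j ≤ l → ∃ i ∈ s, (j : ℝ) * c i = 1 := by
  classical
  obtain ⟨s', hs', rfl⟩ := Finset.exists_subset_card_eq hl
  refine ⟨fun i => if h : i ∈ s' then 1 / ((s'.equivFin ⟨i, h⟩ : ℕ) + 1 : ℝ) else 0, ?_, ?_, ?_⟩
  · intro i; dsimp only; split_ifs <;> positivity
  · rw [← Finset.sum_subset hs' (fun i _ hi => by simp [hi])]
    refine (Finset.sum_le_card_nsmul _ _ 1 fun i hi => ?_).trans (by simp)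
    rw [dif_pos hi, div_le_one (by positivity)]
    simp
  · intro j hj1 hj2
    let y := s'.equivFin.symm ⟨j - 1, by omega⟩
    refine ⟨y, hs' y.2, ?_⟩
    have : j = (j - 1) + 1 := by omega
    dsimp only
    rw [dif_pos y.2]
    simp only [Subtype.coe_eta, y, Equiv.apply_symm_apply]
    rw [Nat.cast_sub hj1]; push_cast
    have : (j : ℝ) ≠ 0 := by positivity
    simp [this]

end Algebra

/-! Polynomials -/

/-- On the line t ↦ x + t h the polynomial is univariate of degree < l, and its l-th forward
difference vanishes. -/
theorem fdiff_eval_eq_zero {n l : ℕ} (P : MvPolynomial (Fin n) ℝ) (hP : P.totalDegree < l)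
    (x h : Fin n → ℝ) : fdiff l (fun y => MvPolynomial.eval y P) x h = 0 := by
  let F : Polynomial ℝ := MvPolynomial.aeval
    (fun i => Polynomial.C (x i) + Polynomial.C (h i) * Polynomial.X) P
  have hF : F.natDegree < l := by
    refine lt_of_le_of_lt (MvPolynomial.aeval_natDegree_le P le_rfl _ (n := 1) fun i => ?_)
      (by simpa using hP)
    compute_degree
  have hFe : ∀ t : ℝ, F.eval t = MvPolynomial.eval (x + t • h) P := by
    intro t
    have : (Polynomial.evalRingHom t) F = _ :=
      MvPolynomial.map_aeval _ (Polynomial.evalRingHom t) P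
    rw [Polynomial.coe_evalRingHom] at this
    rw [this, MvPolynomial.coe_eval₂Hom]
    have h1 : (Polynomial.evalRingHom t).comp (algebraMap ℝ (Polynomial ℝ)) = RingHom.id ℝ := by
      ext; simp
    rw [h1]
    rw [MvPolynomial.eval, MvPolynomial.coe_eval₂Hom]
    congr 1
    funext i
    simp; ring
  have := congrFun (Polynomial.fwdDiff_iter_eq_zero_of_degree_lt hF) 0
  rw [fwdDiff_iter_eq_sum_shift] at this
  rw [fdiff, ← this.trans (Pi.zero_apply _)]
  refine Finset.sum_congr rfl fun j hj => ?_
  have hjl : j ≤ l := by simpa [Nat.lt_succ_iff] using hj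
  have e : (-1 : ℝ) ^ (l + j) = (-1) ^ (l - j) := by
    have : l + j = (l - j) + 2 * j := by omega
    rw [this, pow_add, pow_mul]; simp
  rw [hFe, e, zsmul_eq_mul]
  push_cast
  rw [nsmul_eq_mul, mul_one, zero_add]
  ring

/-- Composition of a polynomial with an affine change of variables. -/
noncomputable def affineComp {n : ℕ} (a : Fin n → ℝ) (b : ℝ) (P : MvPolynomial (Fin n) ℝ) :
    MvPolynomial (Fin n) ℝ :=
  MvPolynomial.aeval (fun i => MvPolynomial.C (a i) + MvPolynomial.C b * MvPolynomial.X i) P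

theorem eval_affineComp {n : ℕ} (a : Fin n → ℝ) (b : ℝ) (P : MvPolynomial (Fin n) ℝ)
    (x : Fin n → ℝ) :
    MvPolynomial.eval x (affineComp a b P) = MvPolynomial.eval (a + b • x) P := by
  have : (MvPolynomial.eval x) (affineComp a b P) = _ :=
    MvPolynomial.map_aeval _ (MvPolynomial.eval x) P
  rw [this, MvPolynomial.coe_eval₂Hom]
  have h1 : (MvPolynomial.eval x).comp (algebraMap ℝ (MvPolynomial (Fin n) ℝ)) = RingHom.id ℝ := by
    ext; simp
  rw [h1, MvPolynomial.eval, MvPolynomial.coe_eval₂Hom]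
  congr 1
  funext i
  simp

theorem totalDegree_affineComp_le {n : ℕ} (a : Fin n → ℝ) (b : ℝ)
    (P : MvPolynomial (Fin n) ℝ) : (affineComp a b P).totalDegree ≤ P.totalDegree := by
  rw [affineComp, MvPolynomial.aeval_def, MvPolynomial.eval₂_eq]
  refine MvPolynomial.totalDegree_finsetSum_le fun d hd => ?_
  refine (MvPolynomial.totalDegree_mul _ _).trans ?_
  rw [MvPolynomial.algebraMap_eq, MvPolynomial.totalDegree_C, zero_add]
  refine (MvPolynomial.totalDegree_finsetProd _ _).trans ?_
  refine le_trans (Finset.sum_le_sum (g := fun i => d i) fun i _ => ?_)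
    (MvPolynomial.le_totalDegree hd)
  refine (MvPolynomial.totalDegree_pow _ _).trans ?_
  have : (MvPolynomial.C (a i) + MvPolynomial.C b * MvPolynomial.X i :
      MvPolynomial (Fin n) ℝ).totalDegree ≤ 1 := by
    refine (MvPolynomial.totalDegree_add _ _).trans (max_le (by simp) ?_)
    refine (MvPolynomial.totalDegree_mul _ _).trans (by simp)
  simpa using Nat.mul_le_mul_left (d i) this

/-- The polynomial `x ↦ ∏ i, (x i choose α i)`. -/
noncomputable def binomPoly {n : ℕ} (α : Fin n → ℕ) : MvPolynomial (Fin n) ℝ :=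
  ∏ i, (MvPolynomial.C ((α i).factorial : ℝ)⁻¹ *
    ∏ t ∈ Finset.range (α i), (MvPolynomial.X i - MvPolynomial.C (t : ℝ)))

theorem totalDegree_binomPoly_le {n : ℕ} (α : Fin n → ℕ) :
    (binomPoly α).totalDegree ≤ ∑ i, α i := by
  refine (MvPolynomial.totalDegree_finsetProd _ _).trans (Finset.sum_le_sum fun i _ => ?_)
  refine (MvPolynomial.totalDegree_mul _ _).trans ?_
  rw [MvPolynomial.totalDegree_C, zero_add]
  refine (MvPolynomial.totalDegree_finsetProd _ _).trans ?_
  refine (Finset.sum_le_card_nsmul _ _ 1 fun t _ => ?_).trans (by simp)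
  exact (MvPolynomial.totalDegree_sub_C_le _ _).trans (by simp)

theorem eval_binomPoly {n : ℕ} (α m : Fin n → ℕ) :
    MvPolynomial.eval (fun i => (m i : ℝ)) (binomPoly α) = ∏ i, ((m i).choose (α i) : ℝ) := by
  rw [binomPoly, map_prod]
  refine Finset.prod_congr rfl fun i _ => ?_
  rw [map_mul, map_prod, MvPolynomial.eval_C]
  simp only [map_sub, MvPolynomial.eval_X, MvPolynomial.eval_C]
  have h0 : ((α i).factorial : ℝ) ≠ 0 := by positivity
  rw [inv_mul_eq_iff_eq_mul₀ h0]
  have h1 := Nat.descFactorial_eq_factorial_mul_choose (m i) (α i)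
  have h2 : ∀ a b : ℕ, ((a.descFactorial b : ℕ) : ℝ) = ∏ t ∈ Finset.range b, ((a : ℝ) - t) := by
    intro a b
    induction b with
    | zero => simp
    | succ b ih =>
      rw [Nat.descFactorial_succ, Finset.prod_range_succ, ← ih, Nat.cast_mul, mul_comm]
      rcases le_or_gt b a with hab | hab
      · rw [Nat.cast_sub hab]
      · rw [Nat.descFactorial_of_lt hab]; simp
  rw [← h2, h1]; push_cast; ring

/-! Approximation on grids -/

/-- Newton's forward formula in operator form: expand T^{m_i} = (1 + (T - 1))^{m_i} in each
direction. The range of α does not depend on m because the binomial coefficients vanish beyond m_i,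
so the coefficients are polynomials in m. -/
theorem prod_shift_pow {n : ℕ} (h : ℝ) (m : Fin n → ℕ) (N : ℕ) (hm : ∀ i, m i ≤ N) :
    shift (h • (fun i => (m i : ℝ)) : Fin n → ℝ) =
      ∑ α ∈ Fintype.piFinset fun _ : Fin n => Finset.range (N + 1),
        (∏ i, ((m i).choose (α i) : ℝ)) •
          ∏ i, (shift (h • Pi.single i (1 : ℝ)) - 1) ^ α i := by
  have e1 : (h • (fun i => (m i : ℝ)) : Fin n → ℝ) =
      ∑ i, (m i : ℝ) • (h • Pi.single i (1 : ℝ)) := by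
    ext k
    simp [Finset.sum_apply, Pi.single_apply, mul_comm]
  rw [e1, shift_sum]
  have e2 : ∀ i, shift ((m i : ℝ) • (h • Pi.single i (1 : ℝ) : Fin n → ℝ)) =
      ∑ a ∈ Finset.range (N + 1), ((m i).choose a : ℝ) •
        (shift (h • Pi.single i (1 : ℝ)) - 1) ^ a := by
    intro i
    rw [shift_nsmul]
    generalize shift (h • Pi.single i (1 : ℝ) : Fin n → ℝ) = T
    conv_lhs => rw [← sub_add_cancel T 1, add_pow]
    have hsub : Finset.range (m i + 1) ⊆ Finset.range (N + 1) :=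
      Finset.range_subset_range.2 (Nat.succ_le_succ (hm i))
    rw [← Finset.sum_subset hsub]
    · refine Finset.sum_congr rfl fun a _ => ?_
      rw [one_pow, mul_one, mul_comm, ← nsmul_eq_mul, Nat.cast_smul_eq_nsmul]
    · intro a _ ha
      rw [Nat.choose_eq_zero_of_lt (by simpa using ha)]; simp
  rw [Finset.prod_congr rfl fun i _ => e2 i, Finset.prod_univ_sum]
  refine Finset.sum_congr rfl fun α _ => ?_
  exact Finset.prod_smul _ _ _

/-- The mixed difference is a product of |α| factors `1 - shift`, indexed by pairs (i, t) with t <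
α_i. Partial sums of their steps lead only to grid points with coordinates at most N, and the
reciprocal weights give steps of norm at most l h. -/
theorem abs_evalAt_grid_le {n : ℕ} (l N : ℕ) (u : (Fin n → ℝ) → ℝ) (x₀ : Fin n → ℝ) (h κ : ℝ)
    (hh : 0 < h)
    (H : ∀ β : Fin n → ℕ, (∀ i, β i ≤ N) → ∀ k : Fin n → ℝ, ‖k‖ ≤ l * h →
      |fdiff l u (x₀ + h • fun i => (β i : ℝ)) k| ≤ κ)
    (α : Fin n → ℕ) (hα : ∀ i, α i ≤ N) (hl : l ≤ ∑ i, α i) :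
    |evalAt u x₀ (∏ i, (shift (h • Pi.single i (1 : ℝ)) - 1) ^ α i)| ≤ 2 ^ (∑ i, α i) * κ := by
  classical
  let s : Finset ((_ : Fin n) × ℕ) := Finset.univ.sigma fun i => Finset.range (α i)
  let v : ((_ : Fin n) × ℕ) → (Fin n → ℝ) := fun p => h • Pi.single p.1 (1 : ℝ)
  have hcard : s.card = ∑ i, α i := by simp [s]
  have e1 : ∏ i, (shift (h • Pi.single i (1 : ℝ) : Fin n → ℝ) - 1) ^ α i =
      ((-1 : ℝ) ^ s.card) • ∏ p ∈ s, (1 - shift (v p)) := by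
    have : ∏ p ∈ s, (1 - shift (v p)) =
        ∏ p ∈ s, -(shift (h • Pi.single p.1 (1 : ℝ) : Fin n → ℝ) - 1) :=
      Finset.prod_congr rfl fun p _ => by simp [v]
    rw [this, Finset.prod_neg, Finset.prod_sigma]
    simp only [Finset.prod_const, Finset.card_range]
    rcases Nat.even_or_odd s.card with h' | h' <;> simp [h'.neg_one_pow]
  obtain ⟨c, hc0, hcs, hc⟩ := exists_reciprocals s l (hcard ▸ hl)
  rw [e1, map_smul, smul_eq_mul, abs_mul, abs_pow, abs_neg, abs_one, one_pow, one_mul, ← hcard]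
  refine abs_evalAt_prod_le l u x₀ s v c hc κ fun S hS => ?_
  have e2 : ∑ p ∈ S, v p = h • fun i => (((S.filter fun p => p.1 = i).card : ℕ) : ℝ) := by
    ext k
    simp [v, Finset.sum_apply, Pi.single_apply, Finset.sum_ite, mul_comm, eq_comm]
  rw [e2]
  refine H _ (fun i => ?_) _ ?_
  · refine le_trans ?_ (hα i)
    have : (S.filter fun p => p.1 = i) ⊆ (Finset.range (α i)).map ⟨Sigma.mk i, sigma_mk_injective⟩ := by
      intro p hp
      obtain ⟨hp1, rfl⟩ := Finset.mem_filter.1 hp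
      have := (Finset.mem_sigma.1 (hS hp1)).2
      exact Finset.mem_map.2 ⟨p.2, this, rfl⟩
    simpa using Finset.card_le_card this
  · rw [norm_neg]
    refine (norm_sum_le _ _).trans ?_
    have : ∀ p ∈ S, ‖c p • v p‖ ≤ c p * h := fun p _ => by
      rw [norm_smul, Real.norm_of_nonneg (hc0 p)]
      refine mul_le_mul_of_nonneg_left ?_ (hc0 p)
      simp [v, norm_smul, abs_of_pos hh, Pi.norm_single]
    refine (Finset.sum_le_sum this).trans ?_
    rw [← Finset.sum_mul]
    refine mul_le_mul_of_nonneg_right (le_trans ?_ hcs) hh.le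
    exact Finset.sum_le_sum_of_subset_of_nonneg hS fun i _ _ => hc0 i

/-- In Newton's formula the terms of total order < l form the polynomial P; all other terms are
mixed differences of order at least l, hence multiples of κ. -/
theorem exists_poly_near_grid (n l N : ℕ) (hl : 1 ≤ l) : ∃ C : ℝ, 0 ≤ C ∧
    ∀ (u : (Fin n → ℝ) → ℝ) (x₀ : Fin n → ℝ) (h κ : ℝ), 0 < h → 0 ≤ κ →
    (∀ β : Fin n → ℕ, (∀ i, β i ≤ N) → ∀ k : Fin n → ℝ, ‖k‖ ≤ l * h →
      |fdiff l u (x₀ + h • fun i => (β i : ℝ)) k| ≤ κ) →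
    ∃ P : MvPolynomial (Fin n) ℝ, P.totalDegree < l ∧ ∀ m : Fin n → ℕ, (∀ i, m i ≤ N) →
      |u (x₀ + h • fun i => (m i : ℝ)) -
        MvPolynomial.eval (x₀ + h • fun i => (m i : ℝ)) P| ≤ C * κ := by
  classical
  let A := Fintype.piFinset fun _ : Fin n => Finset.range (N + 1)
  refine ⟨∑ α ∈ A, (∏ _i : Fin n, (2 : ℝ) ^ N) * 2 ^ (∑ i, α i), by positivity, ?_⟩
  intro u x₀ h κ hh hκ H
  let D : (Fin n → ℕ) → ℝ := fun α =>
    evalAt u x₀ (∏ i, (shift (h • Pi.single i (1 : ℝ)) - 1) ^ α i)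
  let Q : MvPolynomial (Fin n) ℝ :=
    ∑ α ∈ A with ∑ i, α i < l, MvPolynomial.C (D α) * binomPoly α
  have hQ : Q.totalDegree < l := by
    refine lt_of_le_of_lt (MvPolynomial.totalDegree_finsetSum_le (d := l - 1) fun α hα => ?_)
      (by omega)
    refine (MvPolynomial.totalDegree_mul _ _).trans ?_
    rw [MvPolynomial.totalDegree_C, zero_add]
    have := (Finset.mem_filter.1 hα).2
    exact (totalDegree_binomPoly_le α).trans (by omega)
  refine ⟨affineComp (-(h⁻¹ • x₀)) h⁻¹ Q, (totalDegree_affineComp_le _ _ _).trans_lt hQ, ?_⟩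
  intro m hm
  have e1 : -(h⁻¹ • x₀) + h⁻¹ • (x₀ + h • fun i => (m i : ℝ)) = fun i => (m i : ℝ) := by
    rw [smul_add, smul_smul, inv_mul_cancel₀ hh.ne', one_smul]; abel
  rw [eval_affineComp, e1]
  have e2 : u (x₀ + h • fun i => (m i : ℝ)) =
      ∑ α ∈ A, (∏ i, ((m i).choose (α i) : ℝ)) * D α := by
    rw [← evalAt_shift u x₀ (h • fun i => (m i : ℝ)), prod_shift_pow h m N hm, map_sum]
    simp [D, A]
  have e3 : MvPolynomial.eval (fun i => (m i : ℝ)) Q =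
      ∑ α ∈ A with ∑ i, α i < l, (∏ i, ((m i).choose (α i) : ℝ)) * D α := by
    simp [Q, map_sum, eval_binomPoly, mul_comm]
  rw [e2, e3, ← Finset.sum_filter_add_sum_filter_not A (fun α => ∑ i, α i < l),
    add_sub_cancel_left, Finset.sum_mul]
  refine (Finset.abs_sum_le_sum_abs _ _).trans ?_
  refine (Finset.sum_le_sum (g := fun α => (∏ _i : Fin n, (2 : ℝ) ^ N) * 2 ^ (∑ i, α i) * κ)
    fun α hα => ?_).trans ?_
  · obtain ⟨hα1, hα2⟩ := Finset.mem_filter.1 hα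
    have hαN : ∀ i, α i ≤ N := fun i => by
      have := Fintype.mem_piFinset.1 hα1 i
      simpa [Nat.lt_succ_iff] using this
    rw [abs_mul, mul_assoc]
    refine mul_le_mul ?_ (abs_evalAt_grid_le l N u x₀ h κ hh H α hαN (not_lt.1 hα2))
      (abs_nonneg _) (by positivity)
    rw [Finset.abs_prod]
    refine Finset.prod_le_prod (fun i _ => abs_nonneg _) fun i _ => ?_
    rw [Nat.abs_cast]
    have h1 : (m i).choose (α i) ≤ 2 ^ (m i) := Nat.choose_le_two_pow _ _
    have h2 : 2 ^ (m i) ≤ 2 ^ N := Nat.pow_le_pow_right (by norm_num) (hm i)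
    exact_mod_cast h1.trans h2
  · exact Finset.sum_le_sum_of_subset_of_nonneg (Finset.filter_subset _ _)
      fun α _ _ => by positivity

/-! ### From grid values to the whole cube -/

theorem fdiff_eq_add_sum {E : Type*} [AddCommGroup E] [Module ℝ E] (l : ℕ) (g : E → ℝ) (x h : E) :
    fdiff l g x h = (-1) ^ l * g x + ∑ j ∈ Finset.range (l + 1),
      (l.choose j : ℝ) * (-1) ^ (l + j) * (if j = 0 then 0 else g (x + (j : ℝ) • h)) := by
  rw [fdiff, Finset.sum_range_succ', Finset.sum_range_succ' _ l]
  simp [add_comm]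

/-- A value of `g` is controlled by a difference and the other values entering the difference. -/
theorem abs_le_of_fdiff {E : Type*} [AddCommGroup E] [Module ℝ E] (l : ℕ) (g : E → ℝ) (x h : E)
    (M : ℝ) (hM : 0 ≤ M) (H : ∀ j : ℕ, 1 ≤ j → j ≤ l → |g (x + (j : ℝ) • h)| ≤ M) :
    |g x| ≤ |fdiff l g x h| + 2 ^ l * M := by
  have h1 := abs_sum_choose_le l (fun j => if j = 0 then 0 else g (x + (j : ℝ) • h)) M
    (fun j hj => by
      split_ifs with h0
      · simpa using hM
      · exact H j (Nat.one_le_iff_ne_zero.2 h0) hj)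
  have h2 := fdiff_eq_add_sum l g x h
  have h3 : |g x| = |(-1) ^ l * g x| := by simp [abs_mul]
  rw [h3, eq_sub_of_add_eq h2.symm]
  exact (abs_sub _ _).trans (add_le_add le_rfl h1)

/-- Polynomials of degree less than `l` are determined linearly by their values on a product grid
with `l + 1` nodes in each direction. -/
theorem exists_interpolation_basis (n l : ℕ) (hl : 1 ≤ l) (a : Fin (l + 1) → ℝ)
    (ha : Function.Injective a) :
    ∃ e : (Fin n → Fin (l + 1)) → MvPolynomial (Fin n) ℝ,
      ∀ P : MvPolynomial (Fin n) ℝ, P.totalDegree < l →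
        P = ∑ m, MvPolynomial.C (MvPolynomial.eval (fun i => a (m i)) P) * e m := by
  let W := MvPolynomial.restrictTotalDegree (Fin n) ℝ (l - 1)
  let f : W →ₗ[ℝ] ((Fin n → Fin (l + 1)) → ℝ) :=
    LinearMap.pi fun m => (MvPolynomial.aeval (fun i => a (m i))).toLinearMap ∘ₗ W.subtype
  -- A polynomial of degree < l in each variable cannot vanish on a grid with l + 1 nodes per
  -- direction. A left inverse of the evaluation map then supplies the basis.
  have hf : LinearMap.ker f = ⊥ := by
    rw [LinearMap.ker_eq_bot']
    intro P hP
    have hdeg : P.1.totalDegree ≤ l - 1 := (MvPolynomial.mem_restrictTotalDegree _ _ _).1 P.2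
    refine Subtype.ext (MvPolynomial.eq_zero_of_eval_zero_at_prod_finset P.1
      (fun _ => Finset.univ.map ⟨a, ha⟩) (fun i => ?_) fun x hx => ?_)
    · have := MvPolynomial.degreeOf_le_totalDegree P.1 i
      simp; omega
    · choose m hm using fun i => Finset.mem_map.1 (hx i)
      have := congrFun hP m
      have hx' : (fun i => a (m i)) = x := funext fun i => (hm i).2
      simpa [f, hx', MvPolynomial.aeval_eq_eval] using this
  obtain ⟨g, hg⟩ := f.exists_leftInverse_of_injective hf
  refine ⟨fun m => (g (Pi.single m 1)).1, fun P hP => ?_⟩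
  have hPW : P ∈ W := (MvPolynomial.mem_restrictTotalDegree _ _ _).2 (by omega)
  have h1 : g (f ⟨P, hPW⟩) = ⟨P, hPW⟩ := LinearMap.congr_fun hg _
  have h2 : f ⟨P, hPW⟩ = ∑ m, MvPolynomial.eval (fun i => a (m i)) P • Pi.single m (1 : ℝ) := by
    ext m
    simp [f, Finset.sum_apply, Pi.single_apply, MvPolynomial.aeval_eq_eval]
  rw [h2, map_sum] at h1
  have h3 := congrArg Subtype.val h1
  simp only [map_smul] at h3
  refine h3.symm.trans ?_
  simp [MvPolynomial.smul_eq_C_mul]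

-- Interpolate u on a fine grid in the smaller cube of radius R = 1 - τ, pass to all its points by
-- the continuity of u and P, and reach the boundary layer by one difference pointing to the centre.
-- The order of the quantifiers matters: η₀ is fixed before the scale d, so that d can later be
-- chosen from η₀, whereas C may depend on d through the mesh.
set_option maxHeartbeats 1000000 in
theorem exists_poly_near_of_fdiff_le (n l : ℕ) (hl : 1 ≤ l) (ρ η : ℝ) (hρ : 0 < ρ) (hη : 0 < η) :
    ∃ η₀ : ℝ, 0 < η₀ ∧ ∀ d : ℝ, 0 < d → ∃ C : ℝ, 0 ≤ C ∧
    ∀ (u : (Fin n → ℝ) → ℝ) (M κ : ℝ), 0 ≤ M → 0 ≤ κ →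
    (∀ x ∈ Metric.ball 0 1, |u x| ≤ M) →
    (∀ x ∈ Metric.ball 0 1, ∀ y ∈ Metric.ball 0 1, ‖x - y‖ ≤ d → |u x - u y| ≤ η₀ * M) →
    (∀ x ∈ Metric.ball 0 1, ∀ k, x + (l : ℝ) • k ∈ Metric.ball 0 1 → ‖k‖ ≤ ρ →
      |fdiff l u x k| ≤ κ) →
    ∃ P : MvPolynomial (Fin n) ℝ, P.totalDegree < l ∧
      ∀ x ∈ Metric.ball 0 1, |u x - MvPolynomial.eval x P| ≤ C * κ + η * M := by
  have hl0 : (0 : ℝ) < l := by exact_mod_cast hl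
  have hl1 : (1 : ℝ) ≤ l := by exact_mod_cast hl
  set τ : ℝ := min ρ (1 / (2 * l)) with hτdef
  have hτ0 : 0 < τ := lt_min hρ (by positivity)
  have hτρ : τ ≤ ρ := min_le_left _ _
  have hτl : l * τ ≤ 1 / 2 := by
    calc l * τ ≤ l * (1 / (2 * l)) := by gcongr; exact min_le_right _ _
      _ = 1 / 2 := by field_simp
  have hτ1 : τ ≤ 1 / 2 := by nlinarith
  set R : ℝ := 1 - τ with hR
  have hR0 : 0 < R := by linarith
  let a : Fin (l + 1) → ℝ := fun m => -R + (2 * R / l) * (m : ℕ)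
  have ha : Function.Injective a := by
    intro i j hij
    have h0 : (2 * R / l) ≠ 0 := by positivity
    have : ((i : ℕ) : ℝ) = (j : ℕ) := by
      have := add_left_cancel hij
      exact mul_left_cancel₀ h0 this
    exact Fin.ext (by exact_mod_cast this)
  obtain ⟨e, he⟩ := exists_interpolation_basis n l hl a ha
  set K : ℝ := ((Fintype.card (Fin n → Fin (l + 1)) : ℕ) : ℝ) with hK
  have hK0 : 0 < K := by rw [hK]; exact_mod_cast Fintype.card_pos
  -- The inner error contains 2 η₀ M, and the passage to the boundary layer multiplies it by 2^l.
  set η₀ : ℝ := η / 2 ^ (l + 1) with hη₀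
  have hη₀0 : 0 < η₀ := by positivity
  obtain ⟨d₁, hd₁, hd₁'⟩ : ∃ d₁ : ℝ, 0 < d₁ ∧ ∀ m, ∀ x ∈ Metric.closedBall (0 : Fin n → ℝ) R,
      ∀ y ∈ Metric.closedBall (0 : Fin n → ℝ) R, ‖x - y‖ < d₁ →
      |MvPolynomial.eval x (e m) - MvPolynomial.eval y (e m)| ≤ η₀ / K := by
    have hc : Continuous fun x : Fin n → ℝ => fun m => MvPolynomial.eval x (e m) :=
      continuous_pi fun m => MvPolynomial.continuous_eval (e m)
    have := (isCompact_closedBall (0 : Fin n → ℝ) R).uniformContinuousOn_of_continuous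
      hc.continuousOn
    obtain ⟨d₁, hd₁, H⟩ := Metric.uniformContinuousOn_iff.1 this (η₀ / K) (by positivity)
    refine ⟨d₁, hd₁, fun m x hx y hy hxy => ?_⟩
    have h1 := H x hx y hy (by rwa [dist_eq_norm])
    rw [dist_eq_norm] at h1
    exact (norm_le_pi_norm _ m).trans h1.le
  refine ⟨η₀, hη₀0, fun d hd => ?_⟩
  -- The mesh lies below d and d₁ to control the oscillation of u and of the basis, below ρ / l so
  -- that steps of norm l h are admissible, and below τ / l² so that differences from grid points
  -- stay in the unit cube. The grid has l N₁ intervals per direction, so the interpolation nodes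
  -- are grid points.
  obtain ⟨N₁, hN₁0, hN₁⟩ : ∃ N₁ : ℕ, 0 < N₁ ∧
      2 * R / (l * N₁) < min (min d d₁) (min (ρ / l) (τ / (l * l))) := by
    set b := min (min d d₁) (min (ρ / l) (τ / (l * l))) with hb
    have hb0 : 0 < b := by
      refine lt_min (lt_min hd hd₁) (lt_min (by positivity) (by positivity))
    obtain ⟨N, hN⟩ := exists_nat_gt (2 * R / (l * b))
    have hN0 : (0 : ℝ) < N := lt_trans (by positivity) hN
    refine ⟨N, by exact_mod_cast hN0, ?_⟩
    rw [div_lt_iff₀ (by positivity)] at hN ⊢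
    nlinarith
  have hN₁0' : (0 : ℝ) < N₁ := by exact_mod_cast hN₁0
  set N := l * N₁ with hN
  set h : ℝ := 2 * R / (l * N₁) with hh
  have hh0 : 0 < h := by positivity
  obtain ⟨⟨hhd, hhd₁⟩, hhρ, hhτ⟩ : (h < d ∧ h < d₁) ∧ h < ρ / l ∧ h < τ / (l * l) := by
    simpa only [lt_min_iff] using hN₁
  have hNh : N * h = 2 * R := by
    rw [hN, hh]; push_cast; field_simp
  obtain ⟨C, hC0, hC⟩ := exists_poly_near_grid n l N hl
  refine ⟨1 + 2 ^ l * ((1 + η₀) * C), by positivity, ?_⟩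
  intro u M κ hM hκ hu huc hud
  set x₀ : Fin n → ℝ := fun _ => -R with hx₀
  have hgrid : ∀ β : Fin n → ℕ, (∀ i, β i ≤ N) →
      x₀ + h • (fun i => (β i : ℝ)) ∈ Metric.closedBall (0 : Fin n → ℝ) R := by
    intro β hβ
    rw [mem_closedBall_zero_iff, pi_norm_le_iff_of_nonneg hR0.le]
    intro i
    have h1 : (β i : ℝ) ≤ N := by exact_mod_cast hβ i
    have h2 : (0 : ℝ) ≤ β i := by positivity
    simp only [hx₀, Pi.add_apply, Pi.smul_apply, smul_eq_mul, Real.norm_eq_abs]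
    rw [abs_le]
    constructor <;> nlinarith
  have hsub : Metric.closedBall (0 : Fin n → ℝ) R ⊆ Metric.ball 0 1 :=
    Metric.closedBall_subset_ball (by linarith)
  obtain ⟨P, hP, hPu⟩ := hC u x₀ h κ hh0 hκ (by
    intro β hβ k hk
    have h1 := hgrid β hβ
    refine hud _ (hsub h1) k ?_ ?_
    · rw [mem_ball_zero_iff]
      rw [mem_closedBall_zero_iff] at h1
      refine (norm_add_le _ _).trans_lt ?_
      rw [norm_smul, Real.norm_of_nonneg hl0.le]
      rw [lt_div_iff₀ (by positivity)] at hhτ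
      nlinarith
    · rw [lt_div_iff₀ (by positivity)] at hhρ
      nlinarith)
  refine ⟨P, hP, ?_⟩
  have hPnodes : ∀ m : Fin n → Fin (l + 1),
      |MvPolynomial.eval (fun i => a (m i)) P| ≤ M + C * κ := by
    intro m
    have hm : ∀ i, N₁ * (m i : ℕ) ≤ N := fun i => by
      rw [hN, mul_comm]; exact Nat.mul_le_mul_right _ (Nat.lt_succ_iff.1 (m i).2)
    have h1 := hPu (fun i => N₁ * (m i : ℕ)) hm
    have h2 := hu _ (hsub (hgrid _ hm))
    have h3 : x₀ + h • (fun i => ((N₁ * (m i : ℕ) : ℕ) : ℝ)) = fun i => a (m i) := by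
      funext i
      simp only [hx₀, Pi.add_apply, Pi.smul_apply, smul_eq_mul, a, hh]
      push_cast; field_simp
    rw [h3] at h1 h2
    have h4 := abs_sub_abs_le_abs_sub (MvPolynomial.eval (fun i => a (m i)) P) (u fun i => a (m i))
    rw [abs_sub_comm] at h4
    linarith
  -- P is the combination of the K basis polynomials with its node values as coefficients, so its
  -- modulus of continuity is controlled by that of the fixed basis.
  have hPc : ∀ x ∈ Metric.closedBall (0 : Fin n → ℝ) R,
      ∀ y ∈ Metric.closedBall (0 : Fin n → ℝ) R, ‖x - y‖ < d₁ →
      |MvPolynomial.eval x P - MvPolynomial.eval y P| ≤ (M + C * κ) * η₀ := by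
    intro x hx y hy hxy
    have e1 : ∀ z, MvPolynomial.eval z P =
        ∑ m, MvPolynomial.eval (fun i => a (m i)) P * MvPolynomial.eval z (e m) := by
      intro z
      conv_lhs => rw [he P hP]
      simp
    rw [e1, e1, ← Finset.sum_sub_distrib]
    refine (Finset.abs_sum_le_sum_abs _ _).trans ?_
    refine (Finset.sum_le_card_nsmul _ _ ((M + C * κ) * (η₀ / K)) fun m _ => ?_).trans ?_
    · rw [← mul_sub, abs_mul]
      exact mul_le_mul (hPnodes m) (hd₁' m x hx y hy hxy) (abs_nonneg _) (by positivity)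
    · rw [Finset.card_univ, nsmul_eq_mul, ← hK]
      apply le_of_eq; field_simp
  have hinner : ∀ x ∈ Metric.closedBall (0 : Fin n → ℝ) R,
      |u x - MvPolynomial.eval x P| ≤ (1 + η₀) * C * κ + 2 * η₀ * M := by
    intro x hx
    have hx' : ∀ i, |x i| ≤ R := fun i =>
      (norm_le_pi_norm x i).trans (mem_closedBall_zero_iff.1 hx)
    let β : Fin n → ℕ := fun i => ⌊(x i + R) / h⌋₊
    have hb0 : ∀ i, 0 ≤ (x i + R) / h := fun i =>
      div_nonneg (by linarith [(abs_le.1 (hx' i)).1]) hh0.le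
    have hβ : ∀ i, β i ≤ N := fun i => by
      refine Nat.floor_le_of_le ?_
      rw [div_le_iff₀ hh0, hNh]
      linarith [(abs_le.1 (hx' i)).2]
    set g := x₀ + h • (fun i => (β i : ℝ)) with hg
    have hxg : ‖x - g‖ ≤ h := by
      rw [pi_norm_le_iff_of_nonneg hh0.le]
      intro i
      have h1 := Nat.floor_le (hb0 i)
      have h2 := (Nat.lt_floor_add_one ((x i + R) / h)).le
      rw [le_div_iff₀ hh0] at h1
      rw [div_le_iff₀ hh0] at h2
      simp only [hg, hx₀, Pi.sub_apply, Pi.add_apply, Pi.smul_apply, smul_eq_mul,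
        Real.norm_eq_abs, β]
      rw [abs_le]
      constructor <;> nlinarith
    have h1 := huc x (hsub hx) g (hsub (hgrid β hβ)) (hxg.trans hhd.le)
    have h2 := hPu β hβ
    have h3 := hPc x hx g (hgrid β hβ) (hxg.trans_lt hhd₁)
    have h4 : u x - MvPolynomial.eval x P = (u x - u g) + (u g - MvPolynomial.eval g P) -
      (MvPolynomial.eval x P - MvPolynomial.eval g P) := by ring
    rw [h4]
    refine (abs_sub _ _).trans ((add_le_add (abs_add_le _ _) le_rfl).trans ?_)
    refine (add_le_add (add_le_add h1 h2) h3).trans (le_of_eq ?_)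
    ring
  intro x hx
  have hx1 : ‖x‖ < 1 := mem_ball_zero_iff.1 hx
  have hpt : ∀ j : ℕ, j ≤ l → x + (j : ℝ) • (-(τ • x)) = (1 - j * τ) • x ∧
      0 ≤ 1 - (j : ℝ) * τ := by
    intro j hj
    have : (j : ℝ) ≤ l := by exact_mod_cast hj
    exact ⟨by module, by linarith [mul_le_mul_of_nonneg_right this hτ0.le]⟩
  have hM' : 0 ≤ (1 + η₀) * C * κ + 2 * η₀ * M := by positivity
  -- With step -τx the nodes j ≥ 1 are (1 - jτ)x, which lie in the inner cube of radius 1 - τ.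
  have h1 := abs_le_of_fdiff l (fun y => u y - MvPolynomial.eval y P) x (-(τ • x)) _ hM' (by
    intro j hj1 hj2
    obtain ⟨h1, h2⟩ := hpt j hj2
    rw [h1]
    refine hinner _ ?_
    rw [mem_closedBall_zero_iff, norm_smul, Real.norm_of_nonneg h2]
    have : (1 : ℝ) ≤ j := by exact_mod_cast hj1
    calc (1 - j * τ) * ‖x‖ ≤ (1 - j * τ) * 1 := by gcongr
      _ ≤ R := by rw [hR]; nlinarith)
  rw [fdiff_sub, fdiff_eval_eq_zero P hP, sub_zero] at h1
  have h2 : |fdiff l u x (-(τ • x))| ≤ κ := by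
    refine hud x hx _ ?_ ?_
    · obtain ⟨h1, h2⟩ := hpt l le_rfl
      rw [h1, mem_ball_zero_iff, norm_smul, Real.norm_of_nonneg h2]
      refine lt_of_le_of_lt (mul_le_of_le_one_left (norm_nonneg x) ?_) hx1
      linarith [mul_nonneg hl0.le hτ0.le]
    · rw [norm_neg, norm_smul, Real.norm_of_nonneg hτ0.le]
      exact (mul_le_of_le_one_right hτ0.le hx1.le).trans hτρ
  have h3 : 2 ^ l * (2 * η₀ * M) = η * M := by
    rw [hη₀, pow_succ]; field_simp
  calc |u x - MvPolynomial.eval x P| ≤ κ + 2 ^ l * ((1 + η₀) * C * κ + 2 * η₀ * M) := by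
        linarith
    _ = (1 + 2 ^ l * ((1 + η₀) * C)) * κ + 2 ^ l * (2 * η₀ * M) := by ring
    _ = _ := by rw [h3]

/-! Measure-theoretic preliminaries -/

theorem exists_notMem_of_sum_lt {α ι : Type*} [MeasurableSpace α] (μ : Measure α) (B : Set α)
    (s : Finset ι) (A : ι → Set α) (c : ι → ℝ) (hc : ∀ i ∈ s, 0 ≤ c i)
    (hA : ∀ i ∈ s, μ (A i) ≤ ENNReal.ofReal (c i)) (v : ℝ) (hv : ∑ i ∈ s, c i < v)
    (hB : ENNReal.ofReal v ≤ μ B) : ∃ x ∈ B, ∀ i ∈ s, x ∉ A i := by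
  by_contra! hcon
  have h1 : B ⊆ ⋃ i ∈ s, A i := fun x hx => by
    obtain ⟨i, hi, hxi⟩ := hcon x hx
    exact Set.mem_biUnion hi hxi
  have h2 : μ B ≤ ENNReal.ofReal (∑ i ∈ s, c i) := by
    rw [ENNReal.ofReal_sum_of_nonneg hc]
    exact (measure_mono h1).trans ((measure_biUnion_finset_le _ _).trans (Finset.sum_le_sum hA))
  have h3 := (ENNReal.ofReal_lt_ofReal_iff_of_nonneg (Finset.sum_nonneg hc)).2 hv
  exact absurd (hB.trans h2) (not_le.2 h3)

/-- Preimages under a dilation by r ≥ 1 have smaller measure. With r = j ≥ 1 this says that a node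
depending on w through j w avoids a small set for most w. -/
theorem measure_preimage_affine_le {F : Type*} [NormedAddCommGroup F] [NormedSpace ℝ F]
    [MeasurableSpace F] [BorelSpace F] [FiniteDimensional ℝ F] (μ : Measure F)
    [μ.IsAddHaarMeasure] (a : F) (r : ℝ) (hr : 1 ≤ r) (S : Set F) :
    μ {w | a + r • w ∈ S} ≤ μ S := by
  have h1 : {w | a + r • w ∈ S} = (fun w => r • w) ⁻¹' ((fun w => a + w) ⁻¹' S) := rfl
  have hr0 : r ≠ 0 := by positivity
  rw [h1, Measure.addHaar_preimage_smul μ hr0, measure_preimage_add]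
  refine mul_le_of_le_one_left zero_le ?_
  rw [ENNReal.ofReal_le_one, abs_of_nonneg (by positivity)]
  exact inv_le_one_of_one_le₀ (one_le_pow₀ hr)

theorem measurable_fdiff {n : ℕ} (l : ℕ) {f : (Fin n → ℝ) → ℝ} (hf : Measurable f) :
    Measurable fun z : (Fin n → ℝ) × (Fin n → ℝ) => fdiff l f z.1 z.2 := by
  unfold fdiff
  refine Finset.measurable_fun_sum _ fun j _ => Measurable.const_mul (hf.comp ?_) _
  fun_prop

/-- The points and steps in the unit cube at which the `l`-th difference exceeds `1`. -/
def badSet {n : ℕ} (l : ℕ) (ρ : ℝ) (f : (Fin n → ℝ) → ℝ) : Set ((Fin n → ℝ) × (Fin n → ℝ)) :=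
  {z | z.1 ∈ Metric.ball 0 1 ∧ z.2 ∈ Metric.ball 0 ρ ∧ z.1 + (l : ℝ) • z.2 ∈ Metric.ball 0 1 ∧
    1 < |fdiff l f z.1 z.2|}

theorem measurableSet_badSet {n : ℕ} (l : ℕ) (ρ : ℝ) {f : (Fin n → ℝ) → ℝ} (hf : Measurable f) :
    MeasurableSet (badSet l ρ f) := by
  have h := measurable_fdiff l hf
  refine (measurable_fst Metric.isOpen_ball.measurableSet).inter
    ((measurable_snd Metric.isOpen_ball.measurableSet).inter (MeasurableSet.inter ?_ ?_))
  · have : Measurable fun z : (Fin n → ℝ) × (Fin n → ℝ) => z.1 + (l : ℝ) • z.2 := by fun_prop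
    exact this Metric.isOpen_ball.measurableSet
  · have h' : Measurable fun z : (Fin n → ℝ) × (Fin n → ℝ) => |fdiff l f z.1 z.2| :=
      continuous_abs.measurable.comp h
    exact measurableSet_lt measurable_const h'

/-- Points `(1 - jτ) y + j w` stay in the unit cube. -/
theorem contract_mem_ball {n : ℕ} {l j : ℕ} (hj : j ≤ l) {τ : ℝ} (hτ : 0 < τ)
    (hlτ : l * τ ≤ 1 / 2) {y w : Fin n → ℝ} (hy : y ∈ Metric.ball 0 1)
    (hw : w ∈ Metric.ball 0 τ) : (1 - j * τ) • y + (j : ℝ) • w ∈ Metric.ball 0 1 := by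
  rw [mem_ball_zero_iff] at *
  have hj' : (j : ℝ) ≤ l := by exact_mod_cast hj
  have hjτ : (j : ℝ) * τ ≤ 1 / 2 := (mul_le_mul_of_nonneg_right hj' hτ.le).trans hlτ
  have h1 : 0 < 1 - (j : ℝ) * τ := by linarith
  refine (norm_add_le _ _).trans_lt ?_
  rw [norm_smul, norm_smul, Real.norm_of_nonneg h1.le, Real.norm_of_nonneg (Nat.cast_nonneg j)]
  have h2 : (1 - j * τ) * ‖y‖ < 1 - j * τ := by
    simpa using mul_lt_mul_of_pos_left hy h1
  have h3 : (j : ℝ) * ‖w‖ ≤ j * τ := mul_le_mul_of_nonneg_left hw.le (Nat.cast_nonneg j)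
  linarith

theorem step_mem_ball {n : ℕ} {τ ρ : ℝ} (hτ : 0 < τ) (hτρ : 2 * τ ≤ ρ) {y w : Fin n → ℝ}
    (hy : y ∈ Metric.ball 0 1) (hw : w ∈ Metric.ball 0 τ) : w - τ • y ∈ Metric.ball 0 ρ := by
  rw [mem_ball_zero_iff] at *
  refine (norm_sub_le _ _).trans_lt ?_
  rw [norm_smul, Real.norm_of_nonneg hτ.le]
  have := mul_le_mul_of_nonneg_left hy.le hτ.le
  linarith

theorem add_smul_step {n : ℕ} (j : ℝ) (τ : ℝ) (y w : Fin n → ℝ) :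
    y + j • (w - τ • y) = (1 - j * τ) • y + j • w := by module

/-! ### Good sets and generic steps -/

theorem volume_ball_pi {n : ℕ} (a : Fin n → ℝ) {r : ℝ} (hr : 0 < r) :
    volume (Metric.ball a r) = ENNReal.ofReal ((2 * r) ^ n) := by
  simpa using Real.volume_pi_ball a hr

/-- A good set for `f`: few bad steps at its points, and it fills most of the unit cube. -/
structure GoodSet {n : ℕ} (l : ℕ) (ρ η δ : ℝ) (f : (Fin n → ℝ) → ℝ) (G : Set (Fin n → ℝ)) :
    Prop where
  meas : MeasurableSet G
  sub : G ⊆ Metric.ball 0 1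
  bad : ∀ x ∈ G, volume {h | (x, h) ∈ badSet l ρ f} ≤ ENNReal.ofReal η
  compl : volume (Metric.ball 0 1 \ G) ≤ ENNReal.ofReal δ

/-- By Fubini the measure of the bad pairs is the integral of the measures of their slices;
Chebyshev's inequality bounds the set of x with a large slice. -/
theorem exists_goodSet {n : ℕ} (l : ℕ) (ρ η δ : ℝ) (hη : 0 < η)
    {f : (Fin n → ℝ) → ℝ} (hf : Measurable f)
    (hb : volume (badSet l ρ f) ≤ ENNReal.ofReal (η * δ)) : ∃ G, GoodSet l ρ η δ f G := by
  have hm := measurableSet_badSet l ρ hf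
  have hmm : Measurable fun x => volume {h | (x, h) ∈ badSet l ρ f} :=
    measurable_measure_prodMk_left hm
  refine ⟨{x ∈ Metric.ball 0 1 | volume {h | (x, h) ∈ badSet l ρ f} ≤ ENNReal.ofReal η},
    Metric.isOpen_ball.measurableSet.inter (measurableSet_le hmm measurable_const),
    fun x hx => hx.1, fun x hx => hx.2, ?_⟩
  have h1 : volume {x | ENNReal.ofReal η ≤ volume {h | (x, h) ∈ badSet l ρ f}} ≤
      ENNReal.ofReal δ := by
    have h2 := mul_meas_ge_le_lintegral (μ := volume) hmm (ENNReal.ofReal η)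
    have h3 : ∫⁻ x, volume {h | (x, h) ∈ badSet l ρ f} = volume (badSet l ρ f) := by
      rw [Measure.volume_eq_prod, Measure.prod_apply hm]; rfl
    rw [h3] at h2
    have h4 := h2.trans hb
    rw [ENNReal.ofReal_mul hη.le] at h4
    exact (ENNReal.mul_le_mul_iff_right (by simpa using hη) ENNReal.ofReal_ne_top).1 h4
  refine (measure_mono ?_).trans h1
  rintro x ⟨hx, hx'⟩
  simp only [Set.mem_ofPred_eq, not_and, not_le] at hx' ⊢
  exact (hx' hx).le

/-- The step is w - τx with w small: its nodes (1 - jτ)x + jw stay in the cube even for x near the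
boundary, and for j ≥ 1 they spread out with w. The set `S 0` collects the w giving a bad step, and
`S j` those whose j-th node misses A. Together they do not fill the ball of radius τ. -/
theorem exists_good_step {n : ℕ} {l : ℕ} {τ ρ η δ : ℝ} (hτ : 0 < τ)
    (hlτ : l * τ ≤ 1 / 2) (hτρ : 2 * τ ≤ ρ) (hη : 0 ≤ η) (hδ : 0 ≤ δ) {f : (Fin n → ℝ) → ℝ}
    {A : Set (Fin n → ℝ)} (hA : volume (Metric.ball 0 1 \ A) ≤ ENNReal.ofReal δ)
    (hsmall : (l + 1) * (η + δ) < (2 * τ) ^ n) {x : Fin n → ℝ} (hx : x ∈ Metric.ball 0 1)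
    (hbad : volume {h | (x, h) ∈ badSet l ρ f} ≤ ENNReal.ofReal η) :
    ∃ w ∈ Metric.ball 0 τ, |fdiff l f x (w - τ • x)| ≤ 1 ∧
      ∀ j : ℕ, 1 ≤ j → j ≤ l → (1 - j * τ) • x + (j : ℝ) • w ∈ A := by
  let S : ℕ → Set (Fin n → ℝ) := fun j =>
    if j = 0 then {w | (x, w - τ • x) ∈ badSet l ρ f} else
      {w | (1 - j * τ) • x + (j : ℝ) • w ∈ Metric.ball 0 1 \ A}
  obtain ⟨w, hw, hwS⟩ := exists_notMem_of_sum_lt volume (Metric.ball (0 : Fin n → ℝ) τ)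
    (Finset.range (l + 1)) S (fun _ => η + δ) (fun _ _ => by positivity) (fun j _ => by
      by_cases hj : j = 0
      · simp only [S, hj, if_true]
        have : {w | (x, w - τ • x) ∈ badSet l ρ f} =
            (fun w => -(τ • x) + w) ⁻¹' {h | (x, h) ∈ badSet l ρ f} := by
          ext w; simp [sub_eq_neg_add]
        rw [this, measure_preimage_add]
        exact hbad.trans (ENNReal.ofReal_le_ofReal (by linarith))
      · simp only [S, hj, if_false]
        refine (measure_preimage_affine_le volume _ _ ?_ _).trans
          (hA.trans (ENNReal.ofReal_le_ofReal (by linarith)))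
        exact_mod_cast Nat.one_le_iff_ne_zero.2 hj) ((2 * τ) ^ n)
    (by rw [Finset.sum_const, Finset.card_range, nsmul_eq_mul]; push_cast; exact hsmall) (volume_ball_pi 0 hτ).ge
  refine ⟨w, hw, ?_, fun j hj1 hj2 => ?_⟩
  · have h0 := hwS 0 (by simp)
    simp only [S, if_true, badSet, Set.mem_ofPred_eq, not_and, not_lt] at h0
    refine h0 hx (step_mem_ball hτ hτρ hx hw) ?_
    rw [add_smul_step]
    exact contract_mem_ball le_rfl hτ hlτ hx hw
  · have h0 := hwS j (by simpa [Nat.lt_succ_iff] using hj2)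
    have hj0 : j ≠ 0 := by omega
    simp only [S, hj0, if_false, Set.mem_ofPred_eq, Set.mem_sdiff, not_and, not_not] at h0
    exact h0 (contract_mem_ball hj2 hτ hlτ hx hw)

/-- On a good set, differences at arbitrary points and small steps are bounded. -/
theorem GoodSet.fdiff_bound {n : ℕ} {l : ℕ} {τ ρ η δ b : ℝ} (hτ : 0 < τ)
    (hlτ : l * τ ≤ 1 / 2) (hτρ : 2 * τ ≤ ρ) (hη : 0 ≤ η) (hb : 0 ≤ b) {f : (Fin n → ℝ) → ℝ}
    (hf : Measurable f) {G : Set (Fin n → ℝ)} (hG : GoodSet l ρ η δ f G)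
    (hbad : volume (badSet l ρ f) ≤ ENNReal.ofReal b)
    (hsmall : (l + 1) * ((2 * (τ / (l + 1))) ^ n * η + b) <
      (2 * (τ / (l + 1))) ^ n * (2 * (τ / (l + 1))) ^ n)
    {x k : Fin n → ℝ} (hk : ‖k‖ ≤ ρ / 2) (hxk : ∀ i : ℕ, i ≤ l → x + (i : ℝ) • k ∈ G) :
    |fdiff l f x k| ≤ 2 ^ (l + 1) := by
  -- If w and w' have norm less than θ, then w + i w' has norm less than τ for all i ≤ l.
  set θ : ℝ := τ / (l + 1) with hθ
  have hθ0 : 0 < θ := by positivity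
  have hθτ : (l + 1) * θ = τ := by rw [hθ]; field_simp
  have hm := measurableSet_badSet l ρ hf
  let p : ℕ → (Fin n → ℝ) := fun i => x + (i : ℝ) • k
  -- For pairs (w, w'), `S₁ i` means that the step from p_i is bad; since p_i ∈ G, each slice at
  -- fixed w' has measure at most η. Membership in `S₂ j` means that the pair ((1 - jτ)x + jw, (1 -
  -- jτ)k + jw') is bad. Here both entries move, so the measure is compared with that of the whole
  -- `badSet`.
  let S₁ : ℕ → Set ((Fin n → ℝ) × (Fin n → ℝ)) := fun i =>
    {z | z.2 ∈ Metric.ball 0 θ ∧ (p i, z.1 + (i : ℝ) • z.2 - τ • p i) ∈ badSet l ρ f}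
  let S₂ : ℕ → Set ((Fin n → ℝ) × (Fin n → ℝ)) := fun j => if j = 0 then ∅ else
    {z | ((1 - j * τ) • x, (1 - j * τ) • k) + (j : ℝ) • z ∈ badSet l ρ f}
  have hS₁ : ∀ i ∈ Finset.range (l + 1), volume (S₁ i) ≤ ENNReal.ofReal ((2 * θ) ^ n * η) := by
    intro i hi
    have hmeas : MeasurableSet (S₁ i) := by
      refine (measurable_snd Metric.isOpen_ball.measurableSet).inter ?_
      have : Measurable fun z : (Fin n → ℝ) × (Fin n → ℝ) =>
        (p i, z.1 + (i : ℝ) • z.2 - τ • p i) := by fun_prop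
      exact this hm
    rw [Measure.volume_eq_prod, Measure.prod_apply_symm hmeas]
    have hle : ∀ y : Fin n → ℝ, volume ((fun w => (w, y)) ⁻¹' S₁ i) ≤
        (Metric.ball (0 : Fin n → ℝ) θ).indicator (fun _ => ENNReal.ofReal η) y := by
      intro y
      by_cases hy : y ∈ Metric.ball (0 : Fin n → ℝ) θ
      · rw [Set.indicator_of_mem hy]
        have : (fun w => (w, y)) ⁻¹' S₁ i =
            (fun w => ((i : ℝ) • y - τ • p i) + w) ⁻¹' {h | (p i, h) ∈ badSet l ρ f} := by
          ext w
          have e : w + (i : ℝ) • y - τ • p i = (i : ℝ) • y - τ • p i + w := by abel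
          simp only [S₁, Set.mem_preimage, Set.mem_ofPred_eq, hy, true_and, e]
        rw [this, measure_preimage_add]
        exact hG.bad _ (hxk i (by simpa [Nat.lt_succ_iff] using hi))
      · have : (fun w => (w, y)) ⁻¹' S₁ i = ∅ := by
          ext w
          simp only [S₁, Set.mem_preimage, Set.mem_ofPred_eq, hy, false_and, Set.mem_empty_iff_false]
        rw [this, measure_empty]; exact zero_le
    refine (lintegral_mono hle).trans ?_
    rw [lintegral_indicator Metric.isOpen_ball.measurableSet, setLIntegral_const,
      volume_ball_pi 0 hθ0, mul_comm, ← ENNReal.ofReal_mul (by positivity)]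
  have hS₂ : ∀ j ∈ Finset.range (l + 1), volume (S₂ j) ≤ ENNReal.ofReal b := by
    intro j _
    by_cases hj : j = 0
    · simp [S₂, hj]
    · simp only [S₂, hj, if_false]
      have : Measure.IsAddHaarMeasure (volume : Measure ((Fin n → ℝ) × (Fin n → ℝ))) :=
        Measure.prod.instIsAddHaarMeasure _ _
      refine (measure_preimage_affine_le volume _ _ ?_ _).trans hbad
      exact_mod_cast Nat.one_le_iff_ne_zero.2 hj
  obtain ⟨⟨w, w'⟩, ⟨hw, hw'⟩, hgood⟩ := exists_notMem_of_sum_lt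
    (volume : Measure ((Fin n → ℝ) × (Fin n → ℝ)))
    (Metric.ball (0 : Fin n → ℝ) θ ×ˢ Metric.ball (0 : Fin n → ℝ) θ)
    (Finset.range (l + 1)) (fun i => S₁ i ∪ S₂ i) (fun _ => (2 * θ) ^ n * η + b)
    (fun _ _ => by positivity) (fun i hi => by
      rw [ENNReal.ofReal_add (by positivity) hb]
      exact (measure_union_le _ _).trans (add_le_add (hS₁ i hi) (hS₂ i hi)))
    ((2 * θ) ^ n * (2 * θ) ^ n) (by
      rw [Finset.sum_const, Finset.card_range, nsmul_eq_mul]; push_cast; exact hsmall) (by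
      rw [Measure.volume_eq_prod, Measure.prod_prod, volume_ball_pi 0 hθ0,
        ← ENNReal.ofReal_mul (by positivity)])
  have hwn := mem_ball_zero_iff.1 hw
  have hwn' := mem_ball_zero_iff.1 hw'
  have hwi : ∀ i : ℕ, i ≤ l → w + (i : ℝ) • w' ∈ Metric.ball 0 τ := by
    intro i hi
    have hi' : (i : ℝ) ≤ l := by exact_mod_cast hi
    rw [mem_ball_zero_iff]
    refine (norm_add_le _ _).trans_lt ?_
    rw [norm_smul, Real.norm_of_nonneg (Nat.cast_nonneg i)]
    have : (i : ℝ) * ‖w'‖ ≤ l * θ := mul_le_mul hi' hwn'.le (norm_nonneg _) (by positivity)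
    linarith
  have hD₁ : ∀ i ≤ l, |fdiff l f (p i) (w + (i : ℝ) • w' - τ • p i)| ≤ 1 := by
    intro i hi
    have hg := hgood i (by simpa [Nat.lt_succ_iff] using hi)
    have hg1 : (w, w') ∉ S₁ i := fun h => hg (Or.inl h)
    have hpi := hG.sub (hxk i hi)
    simp only [S₁, Set.mem_ofPred_eq, hw', true_and, badSet, not_and, not_lt] at hg1
    refine hg1 hpi (step_mem_ball hτ hτρ hpi (hwi i hi)) ?_
    rw [add_smul_step]
    exact contract_mem_ball le_rfl hτ hlτ hpi (hwi i hi)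
  have hD₂ : ∀ j, 1 ≤ j → j ≤ l →
      |fdiff l f ((1 - j * τ) • x + (j : ℝ) • w) ((1 - j * τ) • k + (j : ℝ) • w')| ≤ 1 := by
    intro j hj1 hj
    have hj0 : j ≠ 0 := by omega
    have hj' : (j : ℝ) ≤ l := by exact_mod_cast hj
    have hg := hgood j (by simpa [Nat.lt_succ_iff] using hj)
    have hg2 : (w, w') ∉ S₂ j := fun h => hg (Or.inr h)
    simp only [S₂, hj0, if_false, Set.mem_ofPred_eq, badSet, not_and, not_lt] at hg2
    have hjτ : (j : ℝ) * τ ≤ 1 / 2 := (mul_le_mul_of_nonneg_right hj' hτ.le).trans hlτ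
    have hx0 : x ∈ Metric.ball 0 1 := by simpa using hG.sub (hxk 0 (Nat.zero_le _))
    have hw0 : w ∈ Metric.ball 0 τ := by simpa using hwi 0 (Nat.zero_le _)
    refine hg2 (contract_mem_ball hj hτ hlτ hx0 hw0) ?_ ?_
    · change (1 - j * τ) • k + (j : ℝ) • w' ∈ _
      rw [mem_ball_zero_iff]
      refine (norm_add_le _ _).trans_lt ?_
      rw [norm_smul, norm_smul, Real.norm_of_nonneg (by linarith),
        Real.norm_of_nonneg (Nat.cast_nonneg j)]
      have h1 : (1 - (j : ℝ) * τ) * ‖k‖ ≤ 1 * (ρ / 2) :=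
        mul_le_mul (by linarith [mul_nonneg (Nat.cast_nonneg (α := ℝ) j) hτ.le]) hk
          (norm_nonneg _) zero_le_one
      have h2 : (j : ℝ) * ‖w'‖ ≤ l * θ := mul_le_mul hj' hwn'.le (norm_nonneg _) (by positivity)
      linarith
    · change (1 - j * τ) • x + (j : ℝ) • w + (l : ℝ) • ((1 - j * τ) • k + (j : ℝ) • w') ∈ _
      have : (1 - j * τ) • x + (j : ℝ) • w + (l : ℝ) • ((1 - j * τ) • k + (j : ℝ) • w') =
          (1 - j * τ) • (x + (l : ℝ) • k) + (j : ℝ) • (w + (l : ℝ) • w') := by module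
      rw [this]
      exact contract_mem_ball hj hτ hlτ (hG.sub (hxk l le_rfl)) (hwi l le_rfl)
  -- Summing the same array of values by columns and by rows: every difference on the left is at
  -- most 1, and so is every one on the right except j = 0, which is ± the difference to be
  -- estimated.
  have hid := sum_fdiff_comm l f p (fun i => w + (i : ℝ) • w' - τ • p i) x k w w' τ
    (fun _ => rfl) (fun _ => rfl)
  have hl := abs_sum_choose_le l (fun i => fdiff l f (p i) (w + (i : ℝ) • w' - τ • p i)) 1 hD₁
  rw [hid] at hl
  have hr := abs_sum_choose_le l (fun j => if j = 0 then 0 else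
    fdiff l f ((1 - j * τ) • x + (j : ℝ) • w) ((1 - j * τ) • k + (j : ℝ) • w')) 1 (fun j hj => by
      split_ifs with h0
      · simp
      · exact hD₂ j (by omega) hj)
  have hsplit : ∑ j ∈ Finset.range (l + 1), (l.choose j : ℝ) * (-1) ^ (l + j) *
        fdiff l f ((1 - j * τ) • x + (j : ℝ) • w) ((1 - j * τ) • k + (j : ℝ) • w') =
      (-1) ^ l * fdiff l f x k + ∑ j ∈ Finset.range (l + 1), (l.choose j : ℝ) * (-1) ^ (l + j) *
        (if j = 0 then 0 else
          fdiff l f ((1 - j * τ) • x + (j : ℝ) • w) ((1 - j * τ) • k + (j : ℝ) • w')) := by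
    rw [Finset.sum_range_succ', Finset.sum_range_succ' _ l]
    simp [add_comm]
  rw [hsplit] at hl
  have h3 : |fdiff l f x k| = |(-1) ^ l * fdiff l f x k| := by simp [abs_mul]
  rw [h3, pow_succ, mul_two]
  have h4 := abs_sub_abs_le_abs_add ((-1) ^ l * fdiff l f x k)
    (∑ j ∈ Finset.range (l + 1), (l.choose j : ℝ) * (-1) ^ (l + j) *
        (if j = 0 then 0 else
          fdiff l f ((1 - j * τ) • x + (j : ℝ) • w) ((1 - j * τ) • k + (j : ℝ) • w')))
  linarith

/-- A measurable function is bounded on a good set. -/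
theorem GoodSet.exists_bound {n : ℕ} {l : ℕ} {τ ρ η δ : ℝ} (hτ : 0 < τ)
    (hlτ : l * τ ≤ 1 / 2) (hτρ : 2 * τ ≤ ρ) (hη : 0 ≤ η) (hδ : 0 < δ) {f : (Fin n → ℝ) → ℝ}
    (hf : Measurable f) {G : Set (Fin n → ℝ)} (hG : GoodSet l ρ η δ f G)
    (hsmall : (l + 1) * (η + δ) < (2 * τ) ^ n) : ∃ M : ℝ, 0 ≤ M ∧ ∀ x ∈ G, |f x| ≤ M := by
  -- The superlevel sets decrease to the empty set, so one of them has measure below δ, and a good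
  -- step carries that level to every point of G. The bound depends on f and only starts the
  -- iteration.
  let S : ℕ → Set (Fin n → ℝ) := fun m => {x ∈ Metric.ball 0 1 | (m : ℝ) < |f x|}
  have hSm : ∀ m, MeasurableSet (S m) := fun m =>
    Metric.isOpen_ball.measurableSet.inter
      (measurableSet_lt measurable_const (continuous_abs.measurable.comp hf))
  have hanti : Antitone S := fun m m' hmm x hx =>
    ⟨hx.1, lt_of_le_of_lt (by exact_mod_cast hmm) hx.2⟩
  have hempty : ⋂ m, S m = ∅ := by
    ext x
    simp only [Set.mem_iInter, Set.mem_empty_iff_false, iff_false, not_forall]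
    obtain ⟨m, hm⟩ := exists_nat_ge |f x|
    exact ⟨m, fun h => absurd h.2 (not_lt.2 hm)⟩
  have hlim := tendsto_measure_iInter_atTop (μ := volume) (fun m => (hSm m).nullMeasurableSet)
    hanti ⟨0, (lt_of_le_of_lt (measure_mono fun x hx => hx.1)
      (measure_ball_lt_top (x := (0 : Fin n → ℝ)) (r := 1))).ne⟩
  rw [hempty, measure_empty] at hlim
  obtain ⟨m, hm⟩ := (hlim.eventually (gt_mem_nhds (ENNReal.ofReal_pos.2 hδ))).exists
  refine ⟨1 + 2 ^ l * m, by positivity, fun x hx => ?_⟩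
  have hA : volume (Metric.ball 0 1 \ {x | |f x| ≤ m}) ≤ ENNReal.ofReal δ := by
    refine (measure_mono fun x hx => ?_).trans hm.le
    exact ⟨hx.1, not_le.1 hx.2⟩
  obtain ⟨w, _, hw1, hw2⟩ := exists_good_step hτ hlτ hτρ hη hδ.le hA hsmall (hG.sub hx) (hG.bad x hx)
  have := abs_le_of_fdiff l f x (w - τ • x) m (by positivity) (fun j hj1 hj2 => by
    rw [add_smul_step]; exact hw2 j hj1 hj2)
  linarith

/-! A smoothing operator reproducing polynomials -/

/-- The average of `w ↦ g ((1 - jτ) y + j w)` over the cube `ball 0 τ`. -/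
noncomputable def avg {n : ℕ} (τ : ℝ) (g : (Fin n → ℝ) → ℝ) (j : ℕ) (y : Fin n → ℝ) : ℝ :=
  ((2 * τ) ^ n)⁻¹ * ∫ w in Metric.ball (0 : Fin n → ℝ) τ, g ((1 - j * τ) • y + (j : ℝ) • w)

/-- The average over `w` of the prediction of `g y` from the values `g (y + j (w - τ y))`. -/
noncomputable def smooth {n : ℕ} (l : ℕ) (τ : ℝ) (g : (Fin n → ℝ) → ℝ) (y : Fin n → ℝ) : ℝ :=
  -∑ j ∈ Finset.range (l + 1),
    (l.choose j : ℝ) * (-1) ^ (l + j) * ((-1) ^ l * if j = 0 then 0 else avg τ g j y)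

theorem volume_real_ball_pi {n : ℕ} (a : Fin n → ℝ) {r : ℝ} (hr : 0 < r) :
    volume.real (Metric.ball a r) = (2 * r) ^ n := by
  rw [Measure.real, volume_ball_pi a hr, ENNReal.toReal_ofReal (by positivity)]

theorem integrableOn_ball_of_bounded {n : ℕ} {τ M : ℝ} {F : (Fin n → ℝ) → ℝ} (hF : Measurable F)
    (hM : ∀ w, |F w| ≤ M) : IntegrableOn F (Metric.ball 0 τ) :=
  Measure.integrableOn_of_bounded (M := M) measure_ball_lt_top.ne hF.aestronglyMeasurable
    (Filter.Eventually.of_forall hM)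

theorem measurable_comp_affine {n : ℕ} {g : (Fin n → ℝ) → ℝ} (hg : Measurable g)
    (a : Fin n → ℝ) (r : ℝ) : Measurable fun w => g (a + r • w) :=
  hg.comp (by fun_prop)

/-- The crude bound M₂ counts only on the exceptional set, in proportion to its measure. Later M₂
contains the current error M, and this small factor is a source of the gain in the improvement step.
-/
theorem abs_average_le {n : ℕ} {τ : ℝ} (hτ : 0 < τ) {F : (Fin n → ℝ) → ℝ} {N : Set (Fin n → ℝ)}
    (hN : MeasurableSet N) {C₁ M₂ ν : ℝ} (hC₁ : 0 ≤ C₁) (hM₂ : 0 ≤ M₂) (hν : 0 ≤ ν)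
    (hNν : volume N ≤ ENNReal.ofReal ν) (h1 : ∀ w ∈ Metric.ball 0 τ, w ∉ N → |F w| ≤ C₁)
    (h2 : ∀ w ∈ Metric.ball 0 τ, |F w| ≤ M₂) :
    |((2 * τ) ^ n)⁻¹ * ∫ w in Metric.ball (0 : Fin n → ℝ) τ, F w| ≤
      C₁ + M₂ * (ν / (2 * τ) ^ n) := by
  have hv : (0 : ℝ) < (2 * τ) ^ n := by positivity
  have hint1 : IntegrableOn (fun _ => C₁) (Metric.ball (0 : Fin n → ℝ) τ) :=
    integrableOn_const measure_ball_lt_top.ne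
  have hint2 : IntegrableOn (N.indicator fun _ => M₂) (Metric.ball (0 : Fin n → ℝ) τ) :=
    (integrableOn_const measure_ball_lt_top.ne).indicator hN
  have h3 : ‖∫ w in Metric.ball (0 : Fin n → ℝ) τ, F w‖ ≤
      ∫ w in Metric.ball (0 : Fin n → ℝ) τ, (C₁ + N.indicator (fun _ => M₂) w) := by
    refine norm_integral_le_of_norm_le (hint1.add hint2) ?_
    refine (ae_restrict_iff' Metric.isOpen_ball.measurableSet).2 (Filter.Eventually.of_forall ?_)
    intro w hw
    by_cases hwN : w ∈ N
    · rw [Set.indicator_of_mem hwN]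
      exact (h2 w hw).trans (by linarith)
    · rw [Set.indicator_of_notMem hwN, add_zero]
      exact h1 w hw hwN
  rw [integral_add hint1 hint2, setIntegral_const, volume_real_ball_pi 0 hτ,
    setIntegral_indicator hN, setIntegral_const, smul_eq_mul, smul_eq_mul] at h3
  have h4 : volume.real (Metric.ball (0 : Fin n → ℝ) τ ∩ N) ≤ ν :=
    ENNReal.toReal_le_of_le_ofReal hν ((measure_mono Set.inter_subset_right).trans hNν)
  rw [abs_mul, abs_of_pos (inv_pos.2 hv), inv_mul_le_iff₀ hv]
  rw [Real.norm_eq_abs] at h3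
  have h5 : (2 * τ) ^ n * (C₁ + M₂ * (ν / (2 * τ) ^ n)) = (2 * τ) ^ n * C₁ + ν * M₂ := by
    field_simp
  rw [h5]
  nlinarith [mul_le_mul_of_nonneg_right h4 hM₂]

/-- The node j = 0 contributes (-1)^l g(x), and the average of the other nodes is by definition the
prediction `smooth`, up to sign. So g is close to `smooth l τ g` wherever most differences are
small. -/
theorem average_fdiff {n : ℕ} (l : ℕ) {τ M : ℝ} (hτ : 0 < τ) {g : (Fin n → ℝ) → ℝ}
    (hg : Measurable g) (hM : ∀ w, |g w| ≤ M) (x : Fin n → ℝ) :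
    ((2 * τ) ^ n)⁻¹ * ∫ w in Metric.ball (0 : Fin n → ℝ) τ, fdiff l g x (w - τ • x) =
      (-1) ^ l * (g x - smooth l τ g x) := by
  have hv : (0 : ℝ) < (2 * τ) ^ n := by positivity
  simp only [fdiff_eq_add_sum, add_smul_step]
  have hint : ∀ j ∈ Finset.range (l + 1), IntegrableOn (fun w => (l.choose j : ℝ) * (-1) ^ (l + j) *
      (if j = 0 then 0 else g ((1 - j * τ) • x + (j : ℝ) • w))) (Metric.ball (0 : Fin n → ℝ) τ) := by
    intro j _
    refine Integrable.const_mul ?_ _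
    split_ifs
    · exact integrable_zero _ _ _
    · exact integrableOn_ball_of_bounded (measurable_comp_affine hg _ _) fun w => hM _
  have hint0 : IntegrableOn (fun _ => (-1) ^ l * g x) (Metric.ball (0 : Fin n → ℝ) τ) :=
    integrableOn_const measure_ball_lt_top.ne
  rw [integral_add hint0 (integrable_finsetSum _ hint),
    setIntegral_const, volume_real_ball_pi 0 hτ, integral_finsetSum _ hint, smul_eq_mul, smooth,
    mul_add, inv_mul_cancel_left₀ hv.ne', sub_neg_eq_add, mul_add, Finset.mul_sum, Finset.mul_sum]
  congr 1
  refine Finset.sum_congr rfl fun j _ => ?_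
  rw [integral_const_mul]
  have h2 : ((-1 : ℝ) ^ l) * (-1) ^ l = 1 := by rw [← mul_pow]; simp
  split_ifs with h
  · simp
  · rw [avg]
    linear_combination (-((l.choose j : ℝ) * (-1) ^ (l + j) * (((2 * τ) ^ n)⁻¹ *
      ∫ w in Metric.ball (0 : Fin n → ℝ) τ, g ((1 - j * τ) • x + (j : ℝ) • w)))) * h2

theorem fdiff_avg {n : ℕ} (l : ℕ) {τ M : ℝ} {g : (Fin n → ℝ) → ℝ}
    (hg : Measurable g) (hM : ∀ w, |g w| ≤ M) (j : ℕ) (x k : Fin n → ℝ) :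
    fdiff l (avg τ g j) x k = ((2 * τ) ^ n)⁻¹ * ∫ w in Metric.ball (0 : Fin n → ℝ) τ,
      fdiff l g ((1 - j * τ) • x + (j : ℝ) • w) ((1 - j * τ) • k) := by
  have e : ∀ (i : ℕ) (w : Fin n → ℝ), (1 - j * τ) • (x + (i : ℝ) • k) + (j : ℝ) • w =
      (1 - j * τ) • x + (j : ℝ) • w + (i : ℝ) • ((1 - j * τ) • k) := fun i w => by module
  simp only [fdiff, avg, ← e]
  rw [integral_finsetSum]
  · rw [Finset.mul_sum]
    refine Finset.sum_congr rfl fun i _ => ?_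
    rw [integral_const_mul]; ring
  · intro i _
    exact Integrable.const_mul
      (integrableOn_ball_of_bounded (measurable_comp_affine hg _ _) fun w => hM _) _

theorem fdiff_smooth {n : ℕ} (l : ℕ) (τ : ℝ) (g : (Fin n → ℝ) → ℝ) (x k : Fin n → ℝ) :
    fdiff l (smooth l τ g) x k = -∑ j ∈ Finset.range (l + 1),
      (l.choose j : ℝ) * (-1) ^ (l + j) *
        ((-1) ^ l * if j = 0 then 0 else fdiff l (avg τ g j) x k) := by
  simp only [fdiff, smooth, Finset.mul_sum, mul_neg, Finset.sum_neg_distrib]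
  rw [Finset.sum_comm]
  congr 1
  refine Finset.sum_congr rfl fun j _ => ?_
  split_ifs with h
  · simp
  · rw [Finset.mul_sum, Finset.mul_sum]
    exact Finset.sum_congr rfl fun i _ => by ring

theorem smooth_sub {n : ℕ} (l : ℕ) (τ : ℝ) (g : (Fin n → ℝ) → ℝ) (x y : Fin n → ℝ) :
    smooth l τ g x - smooth l τ g y = -∑ j ∈ Finset.range (l + 1),
      (l.choose j : ℝ) * (-1) ^ (l + j) *
        ((-1) ^ l * if j = 0 then 0 else avg τ g j x - avg τ g j y) := by
  simp only [smooth]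
  rw [neg_sub_neg, ← Finset.sum_sub_distrib, ← Finset.sum_neg_distrib]
  refine Finset.sum_congr rfl fun j _ => ?_
  split_ifs with h
  · simp
  · ring

theorem abs_signed_sum_le (l : ℕ) (a : ℕ → ℝ) {M : ℝ} (hM : 0 ≤ M)
    (h : ∀ j, 1 ≤ j → j ≤ l → |a j| ≤ M) :
    |-∑ j ∈ Finset.range (l + 1), (l.choose j : ℝ) * (-1) ^ (l + j) *
      ((-1) ^ l * if j = 0 then 0 else a j)| ≤ 2 ^ l * M := by
  rw [abs_neg]
  refine abs_sum_choose_le l _ M fun j hj => ?_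
  rw [abs_mul, abs_pow, abs_neg, abs_one, one_pow, one_mul]
  split_ifs with h0
  · simpa using hM
  · exact h j (by omega) hj

theorem abs_avg_le {n : ℕ} {τ M : ℝ} (hτ : 0 < τ) {g : (Fin n → ℝ) → ℝ} (hM0 : 0 ≤ M)
    (hM : ∀ w, |g w| ≤ M) (j : ℕ) (y : Fin n → ℝ) : |avg τ g j y| ≤ M := by
  have := abs_average_le hτ (F := fun w => g ((1 - j * τ) • y + (j : ℝ) • w)) (N := ∅)
    MeasurableSet.empty (ν := 0) hM0 hM0 le_rfl (by simp) (fun w _ _ => hM _) (fun w _ => hM _)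
  rwa [zero_div, mul_zero, add_zero] at this

/-- Moving y to z amounts to translating the averaging cube by e = (1 - jτ)(z - y)/j, of norm at
most ε. The two indicators differ only in the shell between the radii τ - ε and τ + ε. -/
theorem abs_avg_sub_le {n : ℕ} {l j : ℕ} (hj1 : 1 ≤ j) (hj : j ≤ l) {τ M : ℝ} (hτ : 0 < τ)
    (hlτ : l * τ ≤ 1 / 2) {g : (Fin n → ℝ) → ℝ} (hg : Measurable g) (hM0 : 0 ≤ M)
    (hM : ∀ w, |g w| ≤ M) (y z : Fin n → ℝ) {ε : ℝ} (hyz : ‖y - z‖ = ε) (hε : ε < τ) :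
    |avg τ g j y - avg τ g j z| ≤
      M * (((2 * (τ + ε)) ^ n - (2 * (τ - ε)) ^ n) / (2 * τ) ^ n) := by
  have hv : (0 : ℝ) < (2 * τ) ^ n := by positivity
  have hε0 : 0 ≤ ε := hyz ▸ norm_nonneg _
  have hj0 : (0 : ℝ) < j := by exact_mod_cast hj1
  have hj1' : (1 : ℝ) ≤ j := by exact_mod_cast hj1
  have hjl : (j : ℝ) ≤ l := by exact_mod_cast hj
  have hjτ : (j : ℝ) * τ ≤ 1 / 2 := (mul_le_mul_of_nonneg_right hjl hτ.le).trans hlτ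
  set B := Metric.ball (0 : Fin n → ℝ) τ with hB
  have hBm : MeasurableSet B := Metric.isOpen_ball.measurableSet
  set a := (1 - j * τ) • y with ha
  set e := (j : ℝ)⁻¹ • ((1 - j * τ) • (z - y)) with he
  have heε : ‖e‖ ≤ ε := by
    rw [he, norm_smul, norm_smul, norm_sub_rev z y, hyz, Real.norm_of_nonneg (by positivity),
      Real.norm_of_nonneg (by linarith)]
    have h1 : (j : ℝ)⁻¹ ≤ 1 := inv_le_one_of_one_le₀ hj1'
    have h2 : (1 - j * τ) * ε ≤ 1 * ε := by
      gcongr; linarith [mul_nonneg hj0.le hτ.le]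
    calc (j : ℝ)⁻¹ * ((1 - j * τ) * ε) ≤ 1 * (1 * ε) :=
          mul_le_mul h1 h2 (mul_nonneg (by linarith) hε0) zero_le_one
      _ = ε := by ring
  let G : (Fin n → ℝ) → ℝ := fun w => g (a + (j : ℝ) • w)
  have hGm : Measurable G := measurable_comp_affine hg _ _
  have h1 : ∫ w in B, g ((1 - j * τ) • y + (j : ℝ) • w) = ∫ w, B.indicator G w :=
    (integral_indicator hBm).symm
  have h2 : ∫ w in B, g ((1 - j * τ) • z + (j : ℝ) • w) =
      ∫ w, B.indicator (fun _ => (1 : ℝ)) (w - e) * G w := by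
    rw [← integral_indicator hBm, ← integral_sub_right_eq_self _ e]
    congr 1
    funext w
    by_cases hw : w - e ∈ B
    · rw [Set.indicator_of_mem hw, Set.indicator_of_mem hw, one_mul]
      have : (1 - j * τ) • z + (j : ℝ) • (w - e) = a + (j : ℝ) • w := by
        rw [he, smul_sub, smul_inv_smul₀ hj0.ne', ha]; module
      simp only [this, G]
    · rw [Set.indicator_of_notMem hw, Set.indicator_of_notMem hw, zero_mul]
  have hi1 : Integrable (B.indicator G) :=
    (integrable_indicator_iff hBm).2 (integrableOn_ball_of_bounded hGm fun w => hM _)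
  have hBe : MeasurableSet ((fun w => w - e) ⁻¹' B) := by
    have : Measurable fun w : Fin n → ℝ => w - e := by fun_prop
    exact this hBm
  have hBe' : (fun w => w - e) ⁻¹' B = Metric.ball e τ := by
    ext w; simp [hB, dist_eq_norm]
  have hi2 : Integrable fun w => B.indicator (fun _ => (1 : ℝ)) (w - e) * G w := by
    have : (fun w => B.indicator (fun _ => (1 : ℝ)) (w - e) * G w) =
        ((fun w => w - e) ⁻¹' B).indicator G := by
      funext w
      by_cases hw : w - e ∈ B
      · rw [Set.indicator_of_mem hw, Set.indicator_of_mem (by exact hw), one_mul]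
      · rw [Set.indicator_of_notMem hw, Set.indicator_of_notMem (by exact hw), zero_mul]
    rw [this, integrable_indicator_iff hBe, hBe']
    exact Measure.integrableOn_of_bounded (M := M) measure_ball_lt_top.ne hGm.aestronglyMeasurable
      (Filter.Eventually.of_forall fun w => hM _)
  set A := Metric.ball (0 : Fin n → ℝ) (τ + ε) \ Metric.ball 0 (τ - ε) with hA
  have hAm : MeasurableSet A :=
    Metric.isOpen_ball.measurableSet.diff Metric.isOpen_ball.measurableSet
  have hAf : volume A ≠ ∞ :=
    (lt_of_le_of_lt (measure_mono Set.sdiff_subset) measure_ball_lt_top).ne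
  have h3 : ‖∫ w, (B.indicator G w - B.indicator (fun _ => (1 : ℝ)) (w - e) * G w)‖ ≤
      ∫ w, A.indicator (fun _ => M) w := by
    refine norm_integral_le_of_norm_le
      ((integrable_indicator_iff hAm).2 (integrableOn_const hAf)) (Filter.Eventually.of_forall ?_)
    intro w
    have hGw : ‖G w‖ ≤ M := hM _
    have hAw : 0 ≤ A.indicator (fun _ => M) w := Set.indicator_nonneg (fun _ _ => hM0) _
    by_cases hw1 : w ∈ B <;> by_cases hw2 : w - e ∈ B
    · rw [Set.indicator_of_mem hw1, Set.indicator_of_mem hw2, one_mul, sub_self, norm_zero]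
      exact hAw
    · rw [Set.indicator_of_mem hw1, Set.indicator_of_notMem hw2, zero_mul, sub_zero,
        Set.indicator_of_mem]
      · exact hGw
      · rw [hB, mem_ball_zero_iff] at hw1 hw2
        refine ⟨mem_ball_zero_iff.2 (by linarith), fun h => hw2 ?_⟩
        rw [mem_ball_zero_iff] at h
        exact (norm_sub_le _ _).trans_lt (by linarith)
    · rw [Set.indicator_of_notMem hw1, Set.indicator_of_mem hw2, one_mul, zero_sub, norm_neg,
        Set.indicator_of_mem]
      · exact hGw
      · rw [hB, mem_ball_zero_iff] at hw1 hw2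
        refine ⟨mem_ball_zero_iff.2 ?_, fun h => hw1 ?_⟩
        · have := norm_add_le (w - e) e
          rw [sub_add_cancel] at this
          linarith
        · rw [mem_ball_zero_iff] at h
          linarith
    · rw [Set.indicator_of_notMem hw1, Set.indicator_of_notMem hw2, zero_mul, sub_self, norm_zero]
      exact hAw
  rw [integral_sub hi1 hi2, ← h1, ← h2, integral_indicator hAm, setIntegral_const, hA,
    measureReal_sdiff (Metric.ball_subset_ball (by linarith)) Metric.isOpen_ball.measurableSet,
    volume_real_ball_pi 0 (by linarith), volume_real_ball_pi 0 (by linarith), smul_eq_mul,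
    Real.norm_eq_abs] at h3
  rw [avg, avg, ← mul_sub, abs_mul, abs_of_pos (inv_pos.2 hv), inv_mul_le_iff₀ hv]
  refine h3.trans (le_of_eq ?_)
  field_simp

/-! Approximation by polynomials on a good set -/

theorem volume_biUnion_preimage_le {n : ℕ} (l : ℕ) {A : Set (Fin n → ℝ)} {δ : ℝ} (hδ : 0 ≤ δ)
    (hA : volume A ≤ ENNReal.ofReal δ) (a : ℕ → (Fin n → ℝ)) (r : ℕ → ℝ) (s : Finset ℕ)
    (hs : s.card ≤ l + 1) (hr : ∀ i ∈ s, 1 ≤ r i) :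
    volume (⋃ i ∈ s, {w | a i + r i • w ∈ A}) ≤ ENNReal.ofReal ((l + 1) * δ) := by
  refine (measure_biUnion_finset_le _ _).trans ?_
  refine (Finset.sum_le_card_nsmul _ _ (ENNReal.ofReal δ) fun i hi =>
    (measure_preimage_affine_le volume _ _ (hr i hi) _).trans hA).trans ?_
  rw [nsmul_eq_mul, ← ENNReal.ofReal_natCast, ← ENNReal.ofReal_mul (Nat.cast_nonneg _)]
  refine ENNReal.ofReal_le_ofReal (mul_le_mul_of_nonneg_right ?_ hδ)
  exact_mod_cast hs

theorem measurableSet_biUnion_preimage {n : ℕ} {A : Set (Fin n → ℝ)} (hA : MeasurableSet A)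
    (a : ℕ → (Fin n → ℝ)) (r : ℕ → ℝ) (s : Finset ℕ) :
    MeasurableSet (⋃ i ∈ s, {w | a i + r i • w ∈ A}) := by
  refine Finset.measurableSet_biUnion _ fun i _ => ?_
  have : Measurable fun w : Fin n → ℝ => a i + r i • w := by fun_prop
  exact this hA

theorem segment_mem_ball {n : ℕ} {l i : ℕ} (hl : 1 ≤ l) (hi : i ≤ l) {x k : Fin n → ℝ}
    {c : Fin n → ℝ} {r : ℝ}
    (hx : x ∈ Metric.ball c r) (hxk : x + (l : ℝ) • k ∈ Metric.ball c r) :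
    x + (i : ℝ) • k ∈ Metric.ball c r := by
  have hl0 : (0 : ℝ) < l := by exact_mod_cast hl
  have hi' : (i : ℝ) ≤ l := by exact_mod_cast hi
  have := (convex_ball (E := Fin n → ℝ) c r) hx hxk (a := 1 - i / l) (b := i / l)
    (by rw [sub_nonneg, div_le_one hl0]; exact hi') (by positivity) (by ring)
  convert this using 1
  rw [smul_add, smul_smul, div_mul_cancel₀ _ hl0.ne']
  module

set_option maxHeartbeats 800000 in
/-- The improvement step: an approximation on a good set with error `M` can be replaced by one
whose error is about `M / 2`. -/
theorem GoodSet.improve {n : ℕ} {l : ℕ} (hl : 1 ≤ l) {τ ρ η δ C₁ C η' η₀ d : ℝ} (hτ : 0 < τ)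
    (hlτ : l * τ ≤ 1 / 2) (hτρ : 4 * τ ≤ ρ) (hδ : 0 ≤ δ) (hC₁ : 0 ≤ C₁)
    (hη' : 2 ^ l * η' ≤ 1 / 8) (hdτ : d < τ)
    (hd : ∀ ε : ℝ, 0 ≤ ε → ε ≤ d → ((2 * (τ + ε)) ^ n - (2 * (τ - ε)) ^ n) / (2 * τ) ^ n ≤ η₀)
    (hgrid : ∀ (u : (Fin n → ℝ) → ℝ) (M κ : ℝ), 0 ≤ M → 0 ≤ κ →
      (∀ x ∈ Metric.ball 0 1, |u x| ≤ M) →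
      (∀ x ∈ Metric.ball 0 1, ∀ y ∈ Metric.ball 0 1, ‖x - y‖ ≤ d → |u x - u y| ≤ η₀ * M) →
      (∀ x ∈ Metric.ball 0 1, ∀ k, x + (l : ℝ) • k ∈ Metric.ball 0 1 → ‖k‖ ≤ ρ / 2 →
        |fdiff l u x k| ≤ κ) →
      ∃ P : MvPolynomial (Fin n) ℝ, P.totalDegree < l ∧
        ∀ x ∈ Metric.ball 0 1, |u x - MvPolynomial.eval x P| ≤ C * κ + η' * M)
    (hsmall : (1 + C * 2 ^ l) * (2 ^ l * ((l + 1) * δ / (2 * τ) ^ n)) ≤ 1 / 8)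
    {f : (Fin n → ℝ) → ℝ} (hf : Measurable f) {G : Set (Fin n → ℝ)} (hG : GoodSet l ρ η δ f G)
    (hfd : ∀ x k : Fin n → ℝ, ‖k‖ ≤ ρ / 2 → (∀ i : ℕ, i ≤ l → x + (i : ℝ) • k ∈ G) →
      |fdiff l f x k| ≤ C₁)
    {M : ℝ} (hM : 0 ≤ M) {P : MvPolynomial (Fin n) ℝ} (hP : P.totalDegree < l)
    (hfP : ∀ x ∈ G, |f x - MvPolynomial.eval x P| ≤ M) :
    ∃ Q : MvPolynomial (Fin n) ℝ, Q.totalDegree < l ∧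
      ∀ x ∈ G, |f x - MvPolynomial.eval x Q| ≤ (1 + C * 2 ^ l) * C₁ + M / 2 := by
  have hv : (0 : ℝ) < (2 * τ) ^ n := by positivity
  set V := Metric.ball (0 : Fin n → ℝ) 1 with hV
  have hVG : MeasurableSet (V \ G) := Metric.isOpen_ball.measurableSet.diff hG.meas
  -- Cutting off outside G makes g bounded by M everywhere. Its differences are still at most C₁
  -- when all nodes lie in G; for other w only the bound 2^l M is available.
  set g : (Fin n → ℝ) → ℝ := G.indicator fun x => f x - MvPolynomial.eval x P with hg
  have hgm : Measurable g :=
    (hf.sub (MvPolynomial.continuous_eval P).measurable).indicator hG.meas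
  have hgG : ∀ x ∈ G, g x = f x - MvPolynomial.eval x P := fun x hx => Set.indicator_of_mem hx _
  have hgM : ∀ x, |g x| ≤ M := by
    intro x
    by_cases hx : x ∈ G
    · rw [hgG x hx]; exact hfP x hx
    · rw [hg, Set.indicator_of_notMem hx, abs_zero]; exact hM
  have hgfd : ∀ x k : Fin n → ℝ, ‖k‖ ≤ ρ / 2 → (∀ i : ℕ, i ≤ l → x + (i : ℝ) • k ∈ G) →
      |fdiff l g x k| ≤ C₁ := by
    intro x k hk hxk
    have : fdiff l g x k = fdiff l (fun y => f y - MvPolynomial.eval y P) x k := by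
      refine Finset.sum_congr rfl fun i hi => ?_
      rw [hgG _ (hxk i (by simpa [Nat.lt_succ_iff] using hi))]
    rw [this, fdiff_sub, fdiff_eval_eq_zero P hP, sub_zero]
    exact hfd x k hk hxk
  have hgfd' : ∀ x k : Fin n → ℝ, |fdiff l g x k| ≤ 2 ^ l * M := fun x k =>
    abs_fdiff_le l g x k M fun j _ => hgM _
  -- The last factor bounds the proportion of w for which some node leaves G.
  set κ₀ : ℝ := C₁ + 2 ^ l * M * ((l + 1) * δ / (2 * τ) ^ n) with hκ₀
  have hκ₀0 : 0 ≤ κ₀ := by positivity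
  -- the smoothing approximates `g` on `G`
  have h1 : ∀ x ∈ G, |g x - smooth l τ g x| ≤ κ₀ := by
    intro x hx
    have e := average_fdiff l hτ hgm hgM x
    have e' : |g x - smooth l τ g x| = |(-1) ^ l * (g x - smooth l τ g x)| := by simp [abs_mul]
    rw [e', ← e]
    refine abs_average_le hτ (measurableSet_biUnion_preimage hVG (fun j => (1 - j * τ) • x)
      (fun j => (j : ℝ)) (Finset.Icc 1 l)) hC₁ (by positivity) (by positivity)
      (volume_biUnion_preimage_le l hδ hG.compl _ _ _ (by simp) fun i hi => by
        exact_mod_cast (Finset.mem_Icc.1 hi).1) ?_ (fun w _ => hgfd' _ _)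
    intro w hw hwN
    simp only [Set.mem_iUnion, not_exists, Finset.mem_Icc] at hwN
    refine hgfd _ _ ?_ fun i hi => ?_
    · have := mem_ball_zero_iff.1 (step_mem_ball hτ (by linarith : 2 * τ ≤ ρ / 2) (hG.sub hx) hw)
      exact this.le
    · rw [add_smul_step]
      rcases Nat.eq_zero_or_pos i with rfl | hi0
      · simpa using hx
      · have := hwN i ⟨hi0, hi⟩
        by_contra hcon
        exact this ⟨contract_mem_ball hi hτ hlτ (hG.sub hx) hw, hcon⟩
  have h2 : ∀ x ∈ V, ∀ k, x + (l : ℝ) • k ∈ V → ‖k‖ ≤ ρ / 2 →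
      |fdiff l (smooth l τ g) x k| ≤ 2 ^ l * κ₀ := by
    intro x hx k hxk hk
    rw [fdiff_smooth]
    refine abs_signed_sum_le l _ hκ₀0 fun j hj1 hj => ?_
    rw [fdiff_avg l hgm hgM]
    have hj' : (j : ℝ) ≤ l := by exact_mod_cast hj
    have hjτ : (j : ℝ) * τ ≤ 1 / 2 := (mul_le_mul_of_nonneg_right hj' hτ.le).trans hlτ
    have e : ∀ (i : ℕ) (w : Fin n → ℝ), (1 - j * τ) • x + (j : ℝ) • w +
        (i : ℝ) • ((1 - j * τ) • k) = (1 - j * τ) • (x + (i : ℝ) • k) + (j : ℝ) • w :=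
      fun i w => by module
    refine abs_average_le hτ (measurableSet_biUnion_preimage hVG
      (fun i => (1 - j * τ) • (x + (i : ℝ) • k))
      (fun _ => (j : ℝ)) (Finset.range (l + 1))) hC₁ (by positivity) (by positivity)
      (volume_biUnion_preimage_le l hδ hG.compl _ _ _ (by simp) fun i hi => by
        exact_mod_cast hj1) ?_ (fun w _ => hgfd' _ _)
    intro w hw hwN
    simp only [Set.mem_iUnion, not_exists, Finset.mem_range, Nat.lt_succ_iff] at hwN
    refine hgfd _ _ ?_ fun i hi => ?_
    · rw [norm_smul, Real.norm_of_nonneg (by linarith)]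
      refine (mul_le_of_le_one_left (norm_nonneg _) ?_).trans hk
      linarith [mul_nonneg (Nat.cast_nonneg (α := ℝ) j) hτ.le]
    · rw [e]
      have := hwN i hi
      by_contra hcon
      exact this ⟨contract_mem_ball hj hτ hlτ (segment_mem_ball hl hi hx hxk) hw, hcon⟩
  have h3 : ∀ x, |smooth l τ g x| ≤ 2 ^ l * M := fun x =>
    abs_signed_sum_le l _ hM fun j _ _ => abs_avg_le hτ hM hgM j x
  have h4 : ∀ x ∈ V, ∀ y ∈ V, ‖x - y‖ ≤ d →
      |smooth l τ g x - smooth l τ g y| ≤ η₀ * (2 ^ l * M) := by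
    intro x _ y _ hxy
    have hq := hd _ (norm_nonneg (x - y)) hxy
    have hη₀ : 0 ≤ M * η₀ := by
      refine mul_nonneg hM (le_trans (div_nonneg (sub_nonneg.2 ?_) hv.le) hq)
      refine pow_le_pow_left₀ ?_ ?_ _ <;> linarith [norm_nonneg (x - y)]
    rw [smooth_sub]
    refine (abs_signed_sum_le l _ hη₀ fun j hj1 hj => ?_).trans (le_of_eq (by ring))
    refine (abs_avg_sub_le hj1 hj hτ hlτ hgm hM hgM x y rfl (hxy.trans_lt hdτ)).trans ?_
    exact mul_le_mul_of_nonneg_left hq hM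
  obtain ⟨Q, hQ, hQu⟩ := hgrid (smooth l τ g) (2 ^ l * M) (2 ^ l * κ₀) (by positivity)
    (by positivity) (fun x _ => h3 x) h4 h2
  refine ⟨P + Q, lt_of_le_of_lt (MvPolynomial.totalDegree_add _ _) (max_lt hP hQ), ?_⟩
  intro x hx
  have e1 : f x - MvPolynomial.eval x (P + Q) =
      (g x - smooth l τ g x) + (smooth l τ g x - MvPolynomial.eval x Q) := by
    rw [hgG x hx, map_add]; ring
  rw [e1]
  refine (abs_add_le _ _).trans ((add_le_add (h1 x hx) (hQu x (hG.sub hx))).trans ?_)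
  -- The exceptional w and the interpolation error η' each cost at most M / 8.
  have h5 : (1 + C * 2 ^ l) * (2 ^ l * ((l + 1) * δ / (2 * τ) ^ n)) * M ≤ 1 / 8 * M :=
    mul_le_mul_of_nonneg_right hsmall hM
  have h6 : 2 ^ l * η' * M ≤ 1 / 8 * M := mul_le_mul_of_nonneg_right hη' hM
  have h7 : κ₀ + (C * (2 ^ l * κ₀) + η' * (2 ^ l * M)) = (1 + C * 2 ^ l) * C₁ +
      (1 + C * 2 ^ l) * (2 ^ l * ((l + 1) * δ / (2 * τ) ^ n)) * M + 2 ^ l * η' * M := by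
    rw [hκ₀]; ring
  rw [h7]
  linarith

/-- The recursion M ↦ K + M/2 yields errors 2K + M₀/2^m, so the starting error is forgotten after
finitely many steps. -/
theorem exists_iterate_improvement {α : Type*} (err : α → ℝ → Prop) (K M₀ : ℝ) (hK : 0 < K)
    (h0 : ∃ a, err a M₀) (hM₀ : 0 ≤ M₀) (hmono : ∀ a M M', M ≤ M' → err a M → err a M')
    (hstep : ∀ a M, 0 ≤ M → err a M → ∃ b, err b (K + M / 2)) : ∃ a, err a (3 * K) := by
  have h1 : ∀ m : ℕ, ∃ a, err a (2 * K + M₀ / 2 ^ m) := by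
    intro m
    induction m with
    | zero =>
      obtain ⟨a, ha⟩ := h0
      exact ⟨a, hmono a _ _ (by simp; linarith) ha⟩
    | succ m ih =>
      obtain ⟨a, ha⟩ := ih
      obtain ⟨b, hb⟩ := hstep a _ (by positivity) ha
      refine ⟨b, hmono b _ _ (le_of_eq ?_) hb⟩
      rw [pow_succ]; field_simp; ring
  obtain ⟨m, hm⟩ := exists_nat_gt (M₀ / K)
  obtain ⟨a, ha⟩ := h1 m
  refine ⟨a, hmono a _ _ ?_ ha⟩
  have h2 : (m : ℝ) < 2 ^ m := by exact_mod_cast Nat.lt_two_pow_self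
  have h3 : M₀ / 2 ^ m ≤ K := by
    rw [div_le_iff₀ (by positivity), mul_comm, ← div_le_iff₀ hK]
    linarith
  linarith

/-- The parameters are chosen in the order τ, η₀, d, C, then δ and η, then b. The initial bound M₀
on G depends on f, but the iteration removes it, so b and C are uniform in f. -/
theorem exists_poly_of_small_badSet (n l : ℕ) (hl : 1 ≤ l) (ρ δ₀ : ℝ) (hρ : 0 < ρ) (hδ₀ : 0 < δ₀) :
    ∃ b C : ℝ, 0 < b ∧ 0 < C ∧ ∀ f : (Fin n → ℝ) → ℝ, Measurable f →
      volume (badSet l ρ f) ≤ ENNReal.ofReal b →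
      ∃ P : MvPolynomial (Fin n) ℝ, P.totalDegree < l ∧ ∃ G : Set (Fin n → ℝ),
        MeasurableSet G ∧ G ⊆ Metric.ball 0 1 ∧
        volume (Metric.ball 0 1 \ G) ≤ ENNReal.ofReal δ₀ ∧
        ∀ x ∈ G, |f x - MvPolynomial.eval x P| ≤ C := by
  have hl0 : (0 : ℝ) < l := by exact_mod_cast hl
  set τ : ℝ := min (ρ / 4) (1 / (2 * l)) with hτdef
  have hτ0 : 0 < τ := lt_min (by positivity) (by positivity)
  have hτρ : 4 * τ ≤ ρ := by have := min_le_left (ρ / 4) (1 / (2 * (l : ℝ))); linarith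
  have hlτ : l * τ ≤ 1 / 2 := by
    calc l * τ ≤ l * (1 / (2 * l)) := by gcongr; exact min_le_right _ _
      _ = 1 / 2 := by field_simp
  have hv : (0 : ℝ) < (2 * τ) ^ n := by positivity
  have hl1 : (0 : ℝ) < (l : ℝ) + 1 := by positivity
  set v' : ℝ := (2 * (τ / (l + 1))) ^ n with hv'def
  have hv' : 0 < v' := by positivity
  obtain ⟨η₀, hη₀, hgrid⟩ := exists_poly_near_of_fdiff_le n l hl (ρ / 2) (1 / (8 * 2 ^ l))
    (by positivity) (by positivity)
  -- The relative volume of the shell tends to 0 with ε, which gives the smoothed function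
  -- oscillation at most η₀ times its bound at scale d.
  obtain ⟨d, hd0, hdτ, hd⟩ : ∃ d : ℝ, 0 < d ∧ d < τ ∧ ∀ ε : ℝ, 0 ≤ ε → ε ≤ d →
      ((2 * (τ + ε)) ^ n - (2 * (τ - ε)) ^ n) / (2 * τ) ^ n ≤ η₀ := by
    have hcont : Continuous fun ε : ℝ =>
        ((2 * (τ + ε)) ^ n - (2 * (τ - ε)) ^ n) / (2 * τ) ^ n := by fun_prop
    have h0 : ((2 * (τ + 0)) ^ n - (2 * (τ - 0)) ^ n) / (2 * τ) ^ n < η₀ := by simpa using hη₀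
    obtain ⟨d, hd, H⟩ := Metric.eventually_nhds_iff.1
      (hcont.continuousAt.eventually (gt_mem_nhds h0))
    refine ⟨min (d / 2) (τ / 2), by positivity, ?_, fun ε hε hεd => ?_⟩
    · exact (min_le_right _ _).trans_lt (by linarith)
    · refine (H ?_).le
      rw [Real.dist_eq, sub_zero, abs_of_nonneg hε]
      have := hεd.trans (min_le_left _ _)
      linarith
  obtain ⟨C, hC, hgrid⟩ := hgrid d hd0
  set δ : ℝ := min δ₀ (min ((2 * τ) ^ n / (4 * (l + 1)))
    ((2 * τ) ^ n / (8 * (1 + C * 2 ^ l) * 2 ^ l * (l + 1)))) with hδdef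
  have hδ : 0 < δ := lt_min hδ₀ (lt_min (by positivity) (by positivity))
  have hδ₁ : δ ≤ δ₀ := min_le_left _ _
  have hδ₂ : (l + 1) * δ ≤ (2 * τ) ^ n / 4 := by
    have : δ ≤ (2 * τ) ^ n / (4 * (l + 1)) := (min_le_right _ _).trans (min_le_left _ _)
    rw [le_div_iff₀ (by positivity)] at this
    linarith
  have hδ₃ : (1 + C * 2 ^ l) * (2 ^ l * ((l + 1) * δ / (2 * τ) ^ n)) ≤ 1 / 8 := by
    have : δ ≤ (2 * τ) ^ n / (8 * (1 + C * 2 ^ l) * 2 ^ l * (l + 1)) :=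
      (min_le_right _ _).trans (min_le_right _ _)
    rw [le_div_iff₀ (by positivity)] at this
    have e : (1 + C * 2 ^ l) * (2 ^ l * ((l + 1) * δ / (2 * τ) ^ n)) =
      (δ * (8 * (1 + C * 2 ^ l) * 2 ^ l * (l + 1))) / (2 * τ) ^ n / 8 := by ring
    rw [e]
    have : (δ * (8 * (1 + C * 2 ^ l) * 2 ^ l * (l + 1))) / (2 * τ) ^ n ≤ 1 :=
      (div_le_one hv).2 this
    linarith
  set η : ℝ := min ((2 * τ) ^ n / (4 * (l + 1))) (v' / (4 * (l + 1))) with hηdef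
  have hη : 0 < η := lt_min (by positivity) (by positivity)
  have hη₁ : (l + 1) * η ≤ (2 * τ) ^ n / 4 := by
    have : η ≤ (2 * τ) ^ n / (4 * (l + 1)) := min_le_left _ _
    rw [le_div_iff₀ (by positivity)] at this
    linarith
  have hη₂ : (l + 1) * η ≤ v' / 4 := by
    have : η ≤ v' / (4 * (l + 1)) := min_le_right _ _
    rw [le_div_iff₀ (by positivity)] at this
    linarith
  -- The value η δ is what Chebyshev's inequality needs to produce G; the other bound leaves room
  -- for a generic pair (w, w').
  set b : ℝ := min (η * δ) (v' * v' / (4 * (l + 1))) with hbdef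
  have hb : 0 < b := lt_min (by positivity) (by positivity)
  have hb₂ : (l + 1) * b ≤ v' * v' / 4 := by
    have : b ≤ v' * v' / (4 * (l + 1)) := min_le_right _ _
    rw [le_div_iff₀ (by positivity)] at this
    linarith
  refine ⟨b, 3 * ((1 + C * 2 ^ l) * 2 ^ (l + 1)), hb, by positivity, fun f hf hbad => ?_⟩
  obtain ⟨G, hG⟩ := exists_goodSet l ρ η δ hη hf
    (hbad.trans (ENNReal.ofReal_le_ofReal (min_le_left _ _)))
  have hsm1 : (l + 1) * (η + δ) < (2 * τ) ^ n := by linarith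
  have hsm2 : (l + 1) * (v' * η + b) < v' * v' := by
    have := mul_le_mul_of_nonneg_left hη₂ hv'.le
    have h2 : 0 < v' * v' := by positivity
    linarith
  have hfd : ∀ x k : Fin n → ℝ, ‖k‖ ≤ ρ / 2 → (∀ i : ℕ, i ≤ l → x + (i : ℝ) • k ∈ G) →
      |fdiff l f x k| ≤ 2 ^ (l + 1) := fun x k hk hxk =>
    hG.fdiff_bound hτ0 hlτ (by linarith) hη.le hb.le hf hbad hsm2 hk hxk
  obtain ⟨M₀, hM₀, hfM₀⟩ := hG.exists_bound hτ0 hlτ (by linarith) hη.le hδ hf hsm1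
  obtain ⟨P, hP, hPf⟩ := exists_iterate_improvement
    (fun (P : MvPolynomial (Fin n) ℝ) M => P.totalDegree < l ∧
      ∀ x ∈ G, |f x - MvPolynomial.eval x P| ≤ M)
    ((1 + C * 2 ^ l) * 2 ^ (l + 1)) M₀ (by positivity)
    ⟨0, by simpa using (by omega : 0 < l), by simpa using hfM₀⟩ hM₀
    (fun P M M' hMM' h => ⟨h.1, fun x hx => (h.2 x hx).trans hMM'⟩)
    (fun P M hM h => hG.improve hl hτ0 hlτ hτρ hδ.le (by positivity)
      (by apply le_of_eq; field_simp) hdτ hd hgrid hδ₃ hf hfd hM h.1 h.2)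
  exact ⟨P, hP, G, hG.meas, hG.sub, hG.compl.trans (ENNReal.ofReal_le_ofReal hδ₁), hPf⟩

/-! Whitney's inequality with small steps -/

theorem ENNReal_add_rpow_le (a b : ℝ≥0∞) {s : ℝ} (hs : 0 ≤ s) :
    (a + b) ^ s ≤ 2 ^ s * (a ^ s + b ^ s) := by
  have h1 : a + b ≤ 2 * max a b := by
    rw [two_mul]; exact add_le_add (le_max_left _ _) (le_max_right _ _)
  refine (ENNReal.rpow_le_rpow h1 hs).trans ?_
  rw [ENNReal.mul_rpow_of_nonneg _ _ hs]
  gcongr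
  rcases max_cases a b with ⟨h, _⟩ | ⟨h, _⟩ <;> rw [h]
  · exact le_self_add
  · exact le_add_self

/-- The integral over admissible small steps `h` of `|Δ^l_h f (x)|^s`. -/
noncomputable def stepIntegral {n : ℕ} (l : ℕ) (ρ s : ℝ) (U : Set (Fin n → ℝ))
    (f : (Fin n → ℝ) → ℝ) (x : Fin n → ℝ) : ℝ≥0∞ :=
  ∫⁻ h in {h | h ∈ Metric.ball 0 ρ ∧ x + (l : ℝ) • h ∈ U}, ‖fdiff l f x h‖ₑ ^ s

theorem measurableSet_steps {n : ℕ} (l : ℕ) (ρ : ℝ) {U : Set (Fin n → ℝ)} (hU : MeasurableSet U)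
    (x : Fin n → ℝ) : MeasurableSet {h | h ∈ Metric.ball 0 ρ ∧ x + (l : ℝ) • h ∈ U} := by
  have : Measurable fun h : Fin n → ℝ => x + (l : ℝ) • h := by fun_prop
  exact Metric.isOpen_ball.measurableSet.inter (this hU)

theorem measurable_fdiff_rpow {n : ℕ} (l : ℕ) (s : ℝ) {f : (Fin n → ℝ) → ℝ} (hf : Measurable f)
    (x : Fin n → ℝ) : Measurable fun h => ‖fdiff l f x h‖ₑ ^ s :=
  (((measurable_fdiff l hf).comp measurable_prodMk_left).enorm).pow_const s

theorem fdiff_const_mul {E : Type*} [AddCommGroup E] [Module ℝ E] (l : ℕ) (c : ℝ) (f : E → ℝ)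
    (x h : E) : fdiff l (fun y => c * f y) x h = c * fdiff l f x h := by
  rw [fdiff, fdiff, Finset.mul_sum]
  exact Finset.sum_congr rfl fun j _ => by ring

/-- Chebyshev's inequality on pairs: where the difference of f / λ exceeds 1, that of f exceeds λ.
-/
theorem volume_badSet_le {n : ℕ} (l : ℕ) {ρ s : ℝ} (hs : 0 < s) {lam : ℝ} (hlam : 0 < lam)
    {f : (Fin n → ℝ) → ℝ} (hf : Measurable f) :
    ENNReal.ofReal lam ^ s * volume (badSet l ρ fun y => lam⁻¹ * f y) ≤
      ∫⁻ x in Metric.ball 0 1, stepIntegral l ρ s (Metric.ball 0 1) f x := by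
  have hm := measurableSet_badSet l ρ (hf.const_mul lam⁻¹)
  have hmm : Measurable fun x => volume {h | (x, h) ∈ badSet l ρ fun y => lam⁻¹ * f y} :=
    measurable_measure_prodMk_left hm
  rw [Measure.volume_eq_prod, Measure.prod_apply hm]
  change ENNReal.ofReal lam ^ s *
    ∫⁻ x, volume {h | (x, h) ∈ badSet l ρ fun y => lam⁻¹ * f y} ≤ _
  rw [← lintegral_const_mul _ hmm, ← lintegral_indicator Metric.isOpen_ball.measurableSet]
  refine lintegral_mono fun x => ?_
  by_cases hx : x ∈ Metric.ball (0 : Fin n → ℝ) 1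
  · rw [Set.indicator_of_mem hx, stepIntegral, ← setLIntegral_const]
    refine (setLIntegral_mono (measurable_fdiff_rpow l s hf x) ?_).trans
      (lintegral_mono_set fun h hh => ⟨hh.2.1, hh.2.2.1⟩)
    intro h hh
    have h1 : 1 < |fdiff l (fun y => lam⁻¹ * f y) x h| := hh.2.2.2
    rw [fdiff_const_mul, abs_mul, abs_of_pos (inv_pos.2 hlam), inv_mul_eq_div,
      one_lt_div hlam] at h1
    refine ENNReal.rpow_le_rpow ?_ hs.le
    rw [Real.enorm_eq_ofReal_abs]
    exact ENNReal.ofReal_le_ofReal h1.le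
  · have : {h | (x, h) ∈ badSet l ρ fun y => lam⁻¹ * f y} = ∅ := by
      ext h; simp only [Set.mem_ofPred_eq, Set.mem_empty_iff_false, iff_false]
      exact fun hh => hx hh.1
    rw [this, measure_empty, mul_zero]; exact zero_le

/-- With λ^s = ε / b the function f / λ has a small bad set, so f is within Cλ of a polynomial on a
large set G. For arbitrary x, take a step whose other nodes all lie in G and whose difference is at
most average; it predicts f(x) with the stated error. Positivity of ε gives λ > 0. -/
theorem exists_poly_pointwise_unit (n l : ℕ) (hl : 1 ≤ l) (ρ s : ℝ) (hρ : 0 < ρ) (hs : 0 < s) :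
    ∃ C : ℝ≥0∞, C ≠ ∞ ∧ ∀ f : (Fin n → ℝ) → ℝ, Measurable f → ∀ ε : ℝ≥0∞, ε ≠ 0 → ε ≠ ∞ →
      ∫⁻ x in Metric.ball 0 1, stepIntegral l ρ s (Metric.ball 0 1) f x ≤ ε →
      ∃ P : MvPolynomial (Fin n) ℝ, P.totalDegree < l ∧ ∀ x ∈ Metric.ball 0 1,
        ‖f x - MvPolynomial.eval x P‖ₑ ^ s ≤
          C * (ε + stepIntegral l ρ s (Metric.ball 0 1) f x) := by
  have hl0 : (0 : ℝ) < l := by exact_mod_cast hl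
  set τ : ℝ := min (ρ / 2) (1 / (2 * l)) with hτdef
  have hτ0 : 0 < τ := lt_min (by positivity) (by positivity)
  have hτρ : 2 * τ ≤ ρ := by have := min_le_left (ρ / 2) (1 / (2 * (l : ℝ))); linarith
  have hlτ : l * τ ≤ 1 / 2 := by
    calc l * τ ≤ l * (1 / (2 * l)) := by gcongr; exact min_le_right _ _
      _ = 1 / 2 := by field_simp
  have hv : (0 : ℝ) < (2 * τ) ^ n := by positivity
  set V := Metric.ball (0 : Fin n → ℝ) 1 with hV
  -- The w for which some node leaves G then fill at most half of the ball of radius τ.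
  set δ : ℝ := (2 * τ) ^ n / (2 * (l + 1)) with hδ
  have hδ0 : 0 < δ := by positivity
  obtain ⟨b, C, hb, hC, H⟩ := exists_poly_of_small_badSet n l hl ρ δ hρ hδ0
  set v := ENNReal.ofReal ((2 * τ) ^ n / 2) with hvdef
  have hv0 : v ≠ 0 := by simpa [v] using hv
  have hvt : v ≠ ∞ := ENNReal.ofReal_ne_top
  have hbt : ENNReal.ofReal b ≠ 0 := by simpa using hb
  refine ⟨2 ^ s * (v⁻¹ + ENNReal.ofReal (2 ^ l * C) ^ s * (ENNReal.ofReal b)⁻¹), ?_, ?_⟩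
  · refine ENNReal.mul_ne_top (ENNReal.rpow_ne_top_of_nonneg hs.le (by simp))
      (ENNReal.add_ne_top.2 ⟨ENNReal.inv_ne_top.2 hv0, ENNReal.mul_ne_top
        (ENNReal.rpow_ne_top_of_nonneg hs.le ENNReal.ofReal_ne_top) (ENNReal.inv_ne_top.2 hbt)⟩)
  intro f hf ε hε0 hεt hfε
  set lam : ℝ := ((ε / ENNReal.ofReal b) ^ s⁻¹).toReal with hlam
  have hquot0 : ε / ENNReal.ofReal b ≠ 0 := ENNReal.div_ne_zero.2 ⟨hε0, ENNReal.ofReal_ne_top⟩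
  have hquott : ε / ENNReal.ofReal b ≠ ∞ := ENNReal.div_ne_top hεt hbt
  have hpt : (ε / ENNReal.ofReal b) ^ s⁻¹ ≠ ∞ := ENNReal.rpow_ne_top_of_nonneg (by positivity) hquott
  have hlam0 : 0 < lam := ENNReal.toReal_pos (by
    rw [Ne, ENNReal.rpow_eq_zero_iff]; simp [hquot0, hquott]) hpt
  have hlams : ENNReal.ofReal lam ^ s = ε / ENNReal.ofReal b := by
    rw [hlam, ENNReal.ofReal_toReal hpt, ← ENNReal.rpow_mul, inv_mul_cancel₀ hs.ne',
      ENNReal.rpow_one]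
  obtain ⟨P, hP, G, hGm, hGV, hGδ, hGf⟩ := H (fun y => lam⁻¹ * f y) (hf.const_mul _) (by
    have h1 := (volume_badSet_le l (ρ := ρ) hs hlam0 hf).trans hfε
    rw [hlams] at h1
    have h2 : ε = ε / ENNReal.ofReal b * ENNReal.ofReal b :=
      (ENNReal.div_mul_cancel hbt ENNReal.ofReal_ne_top).symm
    conv_rhs at h1 => rw [h2]
    exact (ENNReal.mul_le_mul_iff_right hquot0 hquott).1 h1)
  refine ⟨MvPolynomial.C lam * P, ?_, fun x hx => ?_⟩
  · refine (MvPolynomial.totalDegree_mul _ _).trans_lt ?_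
    rwa [MvPolynomial.totalDegree_C, zero_add]
  have hGf' : ∀ y ∈ G, |f y - MvPolynomial.eval y (MvPolynomial.C lam * P)| ≤ C * lam := by
    intro y hy
    have h1 := hGf y hy
    have h2 : f y - MvPolynomial.eval y (MvPolynomial.C lam * P) =
        lam * (lam⁻¹ * f y - MvPolynomial.eval y P) := by
      rw [map_mul, MvPolynomial.eval_C, mul_sub, mul_inv_cancel_left₀ hlam0.ne']
    rw [h2, abs_mul, abs_of_pos hlam0, mul_comm]
    exact mul_le_mul_of_nonneg_right h1 hlam0.le
  have hPl : (MvPolynomial.C lam * P).totalDegree < l := by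
    refine (MvPolynomial.totalDegree_mul _ _).trans_lt ?_
    rwa [MvPolynomial.totalDegree_C, zero_add]
  generalize MvPolynomial.C lam * P = Q at hGf' hPl
  set N := ⋃ j ∈ Finset.Icc 1 l, {w | (1 - (j : ℝ) * τ) • x + (j : ℝ) • w ∈ V \ G} with hN
  have hNm : MeasurableSet N := measurableSet_biUnion_preimage
    (Metric.isOpen_ball.measurableSet.diff hGm) (fun j => (1 - (j : ℝ) * τ) • x) (fun j => (j : ℝ))
    (Finset.Icc 1 l)
  have hNv : volume N ≤ v := by
    have := volume_biUnion_preimage_le l hδ0.le hGδ (fun j => (1 - (j : ℝ) * τ) • x)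
      (fun j => (j : ℝ)) (Finset.Icc 1 l) (by simp) fun i hi => by
        exact_mod_cast (Finset.mem_Icc.1 hi).1
    refine this.trans (le_of_eq ?_)
    rw [hvdef, hδ]; congr 1; field_simp
  set B := Metric.ball (0 : Fin n → ℝ) τ with hB
  have hW : v ≤ volume (B \ N) := by
    have h1 : volume B ≤ volume (B \ N) + volume N := by
      have h3 : B ⊆ (B \ N) ∪ N := by rw [Set.sdiff_union_self]; exact Set.subset_union_left
      exact (measure_mono h3).trans (measure_union_le _ _)
    have h2 : volume B = v + v := by
      rw [hB, volume_ball_pi 0 hτ0, hvdef, ← ENNReal.ofReal_add (by positivity) (by positivity)]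
      congr 1; ring
    rw [h2] at h1
    exact (ENNReal.add_le_add_iff_right hvt).1 (h1.trans (add_le_add le_rfl hNv))
  have hFm : Measurable fun w => ‖fdiff l f x (w - τ • x)‖ₑ ^ s :=
    (measurable_fdiff_rpow l s hf x).comp (by fun_prop : Measurable fun w : Fin n → ℝ => w - τ • x)
  -- Among the w with all nodes j ≥ 1 in G, one has a difference not exceeding the mean, which
  -- `stepIntegral` controls.
  obtain ⟨w, hw, hwF⟩ := exists_le_setLAverage (μ := volume) (s := B \ N)
    (f := fun w => ‖fdiff l f x (w - τ • x)‖ₑ ^ s)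
    (fun h => hv0 (le_antisymm (h ▸ hW) zero_le))
    (lt_of_le_of_lt (measure_mono Set.sdiff_subset) measure_ball_lt_top).ne hFm.aemeasurable
  have hint : ∫⁻ w in B \ N, ‖fdiff l f x (w - τ • x)‖ₑ ^ s ≤ stepIntegral l ρ s V f x := by
    rw [stepIntegral, ← lintegral_indicator (measurableSet_steps l ρ Metric.isOpen_ball.measurableSet x),
      ← lintegral_indicator (Metric.isOpen_ball.measurableSet.diff hNm)]
    refine le_trans (lintegral_mono fun w => ?_) (lintegral_sub_right_eq_self _ (τ • x)).le
    by_cases hw : w ∈ B \ N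
    · rw [Set.indicator_of_mem hw, Set.indicator_of_mem]
      refine ⟨step_mem_ball hτ0 hτρ hx hw.1, ?_⟩
      rw [add_smul_step]
      exact contract_mem_ball le_rfl hτ0 hlτ hx hw.1
    · rw [Set.indicator_of_notMem hw]; exact zero_le
  have hwF' : ‖fdiff l f x (w - τ • x)‖ₑ ^ s ≤ v⁻¹ * stepIntegral l ρ s V f x := by
    refine hwF.trans ?_
    rw [setLAverage_eq, ENNReal.div_eq_inv_mul]
    exact mul_le_mul' (ENNReal.inv_le_inv.2 hW) hint
  have habs := abs_le_of_fdiff l (fun y => f y - MvPolynomial.eval y Q) x (w - τ • x) (C * lam)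
    (by positivity) (fun j hj1 hj2 => by
      refine hGf' _ ?_
      rw [add_smul_step]
      by_contra hcon
      exact hw.2 (Set.mem_biUnion (Finset.mem_coe.2 (Finset.mem_Icc.2 ⟨hj1, hj2⟩))
        ⟨contract_mem_ball hj2 hτ0 hlτ hx hw.1, hcon⟩))
  rw [fdiff_sub, fdiff_eval_eq_zero Q hPl, sub_zero] at habs
  have henorm : ‖f x - MvPolynomial.eval x Q‖ₑ ≤
      ‖fdiff l f x (w - τ • x)‖ₑ + ENNReal.ofReal (2 ^ l * C) * ENNReal.ofReal lam := by
    rw [Real.enorm_eq_ofReal_abs, Real.enorm_eq_ofReal_abs, ← ENNReal.ofReal_mul (by positivity),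
      ← ENNReal.ofReal_add (abs_nonneg _) (by positivity), mul_assoc]
    exact ENNReal.ofReal_le_ofReal habs
  refine (ENNReal.rpow_le_rpow henorm hs.le).trans ((ENNReal_add_rpow_le _ _ hs.le).trans ?_)
  rw [ENNReal.mul_rpow_of_nonneg _ _ hs.le, hlams, mul_assoc]
  gcongr
  rw [add_mul, add_comm]
  refine (add_le_add (le_of_eq ?_) hwF').trans (le_of_eq (add_comm _ _)) |>.trans
    (add_le_add (mul_le_mul_right le_add_self _) (mul_le_mul_right le_self_add _))
  rw [ENNReal.div_eq_inv_mul, mul_assoc]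

/-! Whitney's inequality on arbitrary cubes -/

theorem lintegral_comp_affine {n : ℕ} (a : Fin n → ℝ) {R : ℝ} (hR : 0 < R)
    (φ : (Fin n → ℝ) → ℝ≥0∞) :
    ∫⁻ y, φ (a + R • y) = (ENNReal.ofReal (R ^ n))⁻¹ * ∫⁻ x, φ x := by
  have h1 := Measure.map_addHaar_smul (volume : Measure (Fin n → ℝ)) hR.ne'
  have he : MeasurableEmbedding fun y : Fin n → ℝ => R • y :=
    measurableEmbedding_const_smul₀ hR.ne'
  have h2 : ∫⁻ y, φ (a + R • y) = ∫⁻ y, φ (a + y) ∂(Measure.map (fun y => R • y) volume) :=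
    (he.lintegral_map fun y => φ (a + y)).symm
  rw [h2]
  change ∫⁻ y, φ (a + y) ∂(Measure.map (R • ·) volume) = _
  rw [h1, lintegral_smul_measure, lintegral_add_left_eq_self]
  simp only [Module.finrank_fin_fun, smul_eq_mul]
  rw [abs_of_pos (by positivity), ENNReal.ofReal_inv_of_pos (by positivity)]

theorem fdiff_comp_affine {n : ℕ} (l : ℕ) (f : (Fin n → ℝ) → ℝ) (a : Fin n → ℝ) (R : ℝ)
    (x h : Fin n → ℝ) : fdiff l (fun y => f (a + R • y)) x h = fdiff l f (a + R • x) (R • h) := by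
  refine Finset.sum_congr rfl fun j _ => ?_
  have : a + R • (x + (j : ℝ) • h) = a + R • x + (j : ℝ) • R • h := by module
  simp only [this]

theorem affine_mem_ball {n : ℕ} (a : Fin n → ℝ) {R : ℝ} (hR : 0 < R) (r : ℝ) (y : Fin n → ℝ) :
    a + R • y ∈ Metric.ball a (r * R) ↔ y ∈ Metric.ball 0 r := by
  rw [mem_ball_iff_norm, mem_ball_zero_iff, add_sub_cancel_left, norm_smul,
    Real.norm_of_nonneg hR.le, mul_comm, mul_lt_mul_iff_left₀ hR]

theorem stepIntegral_comp_affine {n : ℕ} (l : ℕ) (ρ s : ℝ) (a : Fin n → ℝ) {R : ℝ} (hR : 0 < R)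
    (f : (Fin n → ℝ) → ℝ) (x : Fin n → ℝ) :
    stepIntegral l ρ s (Metric.ball 0 1) (fun y => f (a + R • y)) x =
      (ENNReal.ofReal (R ^ n))⁻¹ * stepIntegral l (ρ * R) s (Metric.ball a R) f (a + R • x) := by
  rw [stepIntegral, stepIntegral,
    ← lintegral_indicator (measurableSet_steps l _ Metric.isOpen_ball.measurableSet _),
    ← lintegral_indicator (measurableSet_steps l _ Metric.isOpen_ball.measurableSet _),
    ← lintegral_comp_affine 0 hR]
  congr 1
  funext h
  have h1 : 0 + R • h ∈ Metric.ball (0 : Fin n → ℝ) (ρ * R) ↔ h ∈ Metric.ball 0 ρ :=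
    affine_mem_ball 0 hR ρ h
  have h2 : a + R • x + (l : ℝ) • (0 + R • h) ∈ Metric.ball a R ↔
      x + (l : ℝ) • h ∈ Metric.ball 0 1 := by
    have e : a + R • x + (l : ℝ) • (0 + R • h) = a + R • (x + (l : ℝ) • h) := by module
    rw [e, ← affine_mem_ball a hR 1, one_mul]
  by_cases hh : h ∈ Metric.ball 0 ρ ∧ x + (l : ℝ) • h ∈ Metric.ball 0 1
  · rw [Set.indicator_of_mem (by exact hh), Set.indicator_of_mem (by exact ⟨h1.2 hh.1, h2.2 hh.2⟩),
      fdiff_comp_affine, zero_add]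
  · rw [Set.indicator_of_notMem (by exact hh),
      Set.indicator_of_notMem (by exact fun h => hh ⟨h1.1 h.1, h2.1 h.2⟩)]

/-- Affine rescaling of the unit cube. Each integration, over x and over h, contributes one factor
R^{-n}. -/
theorem exists_poly_pointwise (n l : ℕ) (hl : 1 ≤ l) (ρ s : ℝ) (hρ : 0 < ρ) (hs : 0 < s) :
    ∃ C : ℝ≥0∞, C ≠ ∞ ∧ ∀ f : (Fin n → ℝ) → ℝ, Measurable f → ∀ (a : Fin n → ℝ) (R : ℝ), 0 < R →
      ∀ ε : ℝ≥0∞, ε ≠ 0 → ε ≠ ∞ →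
      (ENNReal.ofReal (R ^ n))⁻¹ * ((ENNReal.ofReal (R ^ n))⁻¹ *
        ∫⁻ x in Metric.ball a R, stepIntegral l (ρ * R) s (Metric.ball a R) f x) ≤ ε →
      ∃ P : MvPolynomial (Fin n) ℝ, P.totalDegree < l ∧ ∀ x ∈ Metric.ball a R,
        ‖f x - MvPolynomial.eval x P‖ₑ ^ s ≤ C * (ε + (ENNReal.ofReal (R ^ n))⁻¹ *
          stepIntegral l (ρ * R) s (Metric.ball a R) f x) := by
  obtain ⟨C, hC, H⟩ := exists_poly_pointwise_unit n l hl ρ s hρ hs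
  refine ⟨C, hC, fun f hf a R hR ε hε0 hεt hε => ?_⟩
  have hmem : ∀ y : Fin n → ℝ, a + R • y ∈ Metric.ball a R ↔ y ∈ Metric.ball 0 1 := fun y => by
    simpa using affine_mem_ball a hR 1 y
  have hRt : (ENNReal.ofReal (R ^ n))⁻¹ ≠ ∞ := ENNReal.inv_ne_top.2 (by simpa using by positivity)
  obtain ⟨P, hP, hPf⟩ := H (fun y => f (a + R • y)) (hf.comp (by fun_prop)) ε hε0 hεt (by
    refine le_trans (le_of_eq ?_) hε
    simp only [stepIntegral_comp_affine l ρ s a hR f]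
    rw [lintegral_const_mul' _ _ hRt, mul_left_comm]
    congr 1
    rw [← lintegral_indicator Metric.isOpen_ball.measurableSet,
      ← lintegral_indicator Metric.isOpen_ball.measurableSet, ← lintegral_comp_affine a hR]
    congr 1
    funext y
    by_cases hy : y ∈ Metric.ball (0 : Fin n → ℝ) 1
    · rw [Set.indicator_of_mem hy, Set.indicator_of_mem ((hmem y).2 hy)]
    · rw [Set.indicator_of_notMem hy, Set.indicator_of_notMem fun h => hy ((hmem y).1 h)])
  refine ⟨affineComp (-(R⁻¹ • a)) R⁻¹ P, (totalDegree_affineComp_le _ _ _).trans_lt hP, ?_⟩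
  intro x hx
  have e : a + R • (-(R⁻¹ • a) + R⁻¹ • x) = x := by
    rw [smul_add, smul_neg, smul_inv_smul₀ hR.ne', smul_inv_smul₀ hR.ne']; abel
  have h1 := hPf (-(R⁻¹ • a) + R⁻¹ • x) ((hmem _).1 (by rwa [e]))
  rw [stepIntegral_comp_affine l ρ s a hR f, e] at h1
  rw [eval_affineComp]
  exact h1

/-- The pairs `(h, x)` of a small step and a point of `U` with `x + l h ∈ U`. -/
def stepSet {n : ℕ} (l : ℕ) (ρ : ℝ) (U : Set (Fin n → ℝ)) : Set ((Fin n → ℝ) × (Fin n → ℝ)) :=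
  {z | z.1 ∈ Metric.ball 0 ρ ∧ z.2 ∈ U ∧ z.2 + (l : ℝ) • z.1 ∈ U}

theorem measurableSet_stepSet {n : ℕ} (l : ℕ) (ρ : ℝ) {U : Set (Fin n → ℝ)}
    (hU : MeasurableSet U) : MeasurableSet (stepSet l ρ U) := by
  have : Measurable fun z : (Fin n → ℝ) × (Fin n → ℝ) => z.2 + (l : ℝ) • z.1 := by fun_prop
  exact (measurable_fst Metric.isOpen_ball.measurableSet).inter
    ((measurable_snd hU).inter (this hU))

theorem measurable_fdiff_swap {n : ℕ} (l : ℕ) {f : (Fin n → ℝ) → ℝ} (hf : Measurable f) :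
    Measurable fun z : (Fin n → ℝ) × (Fin n → ℝ) => fdiff l f z.2 z.1 :=
  (measurable_fdiff l hf).comp measurable_swap

theorem lintegral_stepSet {n : ℕ} (l : ℕ) (ρ s : ℝ) {U : Set (Fin n → ℝ)}
    (hU : MeasurableSet U) {f : (Fin n → ℝ) → ℝ} (hf : Measurable f) :
    ∫⁻ z in stepSet l ρ U, ‖fdiff l f z.2 z.1‖ₑ ^ s =
      ∫⁻ x in U, stepIntegral l ρ s U f x := by
  have hm : Measurable ((stepSet l ρ U).indicator
      fun z : (Fin n → ℝ) × (Fin n → ℝ) => ‖fdiff l f z.2 z.1‖ₑ ^ s) :=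
    ((measurable_fdiff_swap l hf).enorm.pow_const s).indicator (measurableSet_stepSet l ρ hU)
  rw [← lintegral_indicator (measurableSet_stepSet l ρ hU), Measure.volume_eq_prod,
    lintegral_prod_symm _ hm.aemeasurable, ← lintegral_indicator hU]
  congr 1
  funext x
  by_cases hx : x ∈ U
  · rw [Set.indicator_of_mem hx, stepIntegral, ← lintegral_indicator (measurableSet_steps l _ hU _)]
    congr 1
    funext h
    by_cases hh : h ∈ Metric.ball 0 ρ ∧ x + (l : ℝ) • h ∈ U
    · rw [Set.indicator_of_mem (by exact ⟨hh.1, hx, hh.2⟩), Set.indicator_of_mem (by exact hh)]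
    · rw [Set.indicator_of_notMem (by exact fun h => hh ⟨h.1, h.2.2⟩),
        Set.indicator_of_notMem (by exact hh)]
  · rw [Set.indicator_of_notMem hx]
    refine (lintegral_congr fun h => ?_).trans lintegral_zero
    exact Set.indicator_of_notMem (fun h => hx h.2.1) _

/-- By Fubini for null sets, the essential supremum over pairs bounds almost every difference at
almost every x. The swap is needed because `stepSet` lists the step first. -/
theorem ae_stepIntegral_le {n : ℕ} (l : ℕ) (ρ : ℝ) (hρ : 0 < ρ) {U : Set (Fin n → ℝ)}
    (hU : MeasurableSet U) {f : (Fin n → ℝ) → ℝ} :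
    ∀ᵐ x ∂(volume.restrict U), stepIntegral l ρ 1 U f x ≤ ENNReal.ofReal ((2 * ρ) ^ n) *
      eLpNorm (fun z : (Fin n → ℝ) × (Fin n → ℝ) => fdiff l f z.2 z.1) ∞
        (volume.restrict (stepSet l ρ U)) := by
  set S := eLpNorm (fun z : (Fin n → ℝ) × (Fin n → ℝ) => fdiff l f z.2 z.1) ∞
        (volume.restrict (stepSet l ρ U)) with hS
  have h1 : ∀ᵐ z ∂(volume.restrict (stepSet l ρ U)), ‖fdiff l f z.2 z.1‖ₑ ≤ S := by
    rw [hS, eLpNorm_exponent_top]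
    exact enorm_ae_le_eLpNormEssSup _ _
  rw [ae_restrict_iff' (measurableSet_stepSet l ρ hU), Measure.volume_eq_prod] at h1
  have h2 : ∀ᵐ z ∂((volume : Measure (Fin n → ℝ)).prod (volume : Measure (Fin n → ℝ))),
      z.swap ∈ stepSet l ρ U → ‖fdiff l f z.swap.2 z.swap.1‖ₑ ≤ S := by
    rw [← Measure.prod_swap] at h1
    exact ae_of_ae_map measurable_swap.aemeasurable h1
  have h3 := Measure.ae_ae_of_ae_prod h2
  rw [ae_restrict_iff' hU]
  filter_upwards [h3] with x hx hxU
  rw [stepIntegral]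
  calc ∫⁻ h in {h | h ∈ Metric.ball 0 ρ ∧ x + (l : ℝ) • h ∈ U}, ‖fdiff l f x h‖ₑ ^ (1 : ℝ)
      ≤ ∫⁻ h in {h | h ∈ Metric.ball 0 ρ ∧ x + (l : ℝ) • h ∈ U}, S := by
        refine setLIntegral_mono_ae' (measurableSet_steps l ρ hU x) ?_
        filter_upwards [hx] with h hh hh'
        rw [ENNReal.rpow_one]
        exact hh ⟨hh'.1, hxU, hh'.2⟩
    _ ≤ ENNReal.ofReal ((2 * ρ) ^ n) * S := by
        rw [setLIntegral_const, mul_comm, ← volume_ball_pi (0 : Fin n → ℝ) hρ]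
        gcongr
        exact fun h hh => hh.1

theorem Cube.toSet_eq_ball {n : ℕ} (Q : Cube n) (hQ : 0 < Q.side) :
    Q.toSet = Metric.ball Q.center (Q.side / 2) := by
  rw [ball_pi _ (by positivity), Cube.toSet]
  congr 1
  funext i
  rw [Real.ball_eq_Ioo]

theorem ENNReal_le_of_forall_le_add_mul {x y K : ℝ≥0∞} (hK : K ≠ ∞)
    (h : ∀ e : ℝ≥0∞, e ≠ 0 → e ≠ ∞ → x ≤ y + K * e) : x ≤ y := by
  refine ENNReal.le_of_forall_pos_le_add fun ε hε _ => ?_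
  have h1 : K + 1 ≠ 0 := by simp
  have h2 : K + 1 ≠ ∞ := by simp [hK]
  have hε' : (ε : ℝ≥0∞) ≠ 0 := by exact_mod_cast hε.ne'
  refine (h (ε / (K + 1)) (ENNReal.div_ne_zero.2 ⟨hε', h2⟩)
    (ENNReal.div_ne_top ENNReal.coe_ne_top h1)).trans (add_le_add le_rfl ?_)
  calc K * (ε / (K + 1)) ≤ (K + 1) * (ε / (K + 1)) := by gcongr; exact le_self_add
    _ = ε := ENNReal.mul_div_cancel h1 h2

/-- For fixed step the map is a translation, so null sets pull back to null sets. Differences may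
thus be computed from a measurable representative. -/
theorem quasiMeasurePreserving_add_smul {n : ℕ} (c : ℝ) :
    Measure.QuasiMeasurePreserving (fun z : (Fin n → ℝ) × (Fin n → ℝ) => z.2 + c • z.1)
      (volume.prod volume) volume := by
  have hm : Measurable fun z : (Fin n → ℝ) × (Fin n → ℝ) => z.2 + c • z.1 := by fun_prop
  refine ⟨hm, Measure.AbsolutelyContinuous.mk fun N hN hN0 => ?_⟩
  rw [Measure.map_apply hm hN, Measure.measure_prod_null (hm hN)]
  refine Filter.Eventually.of_forall fun h => ?_
  change volume ((fun x => x + c • h) ⁻¹' N) = 0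
  rw [measure_preimage_add_right, hN0]

theorem fdiff_congr_ae {n : ℕ} (l : ℕ) {f g : (Fin n → ℝ) → ℝ} (hfg : f =ᵐ[volume] g) :
    (fun z : (Fin n → ℝ) × (Fin n → ℝ) => fdiff l f z.2 z.1) =ᵐ[volume]
      fun z => fdiff l g z.2 z.1 := by
  have h1 : ∀ j : ℕ, ∀ᵐ z : (Fin n → ℝ) × (Fin n → ℝ),
      f (z.2 + (j : ℝ) • z.1) = g (z.2 + (j : ℝ) • z.1) := fun j =>
    (quasiMeasurePreserving_add_smul (j : ℝ)).ae hfg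
  filter_upwards [ae_all_iff.2 h1] with z hz
  exact Finset.sum_congr rfl fun j _ => by rw [hz j]

theorem whitney_of_measurable_lt_top (n l : ℕ) (hl : 1 ≤ l) (ρ s : ℝ) (hρ : 0 < ρ) (hs : 0 < s) :
    ∃ C : ℝ≥0∞, C ≠ ∞ ∧ ∀ f : (Fin n → ℝ) → ℝ, Measurable f → ∀ (a : Fin n → ℝ) (R : ℝ), 0 < R →
      ⨅ (P : MvPolynomial (Fin n) ℝ) (_ : P.totalDegree < l),
        ∫⁻ x in Metric.ball a R, ‖f x - MvPolynomial.eval x P‖ₑ ^ s ≤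
      C * ((ENNReal.ofReal (R ^ n))⁻¹ *
        ∫⁻ z in stepSet l (ρ * R) (Metric.ball a R), ‖fdiff l f z.2 z.1‖ₑ ^ s) := by
  obtain ⟨C, hC, H⟩ := exists_poly_pointwise n l hl ρ s hρ hs
  refine ⟨(C + 1) * (2 ^ n + 1), ENNReal.mul_ne_top (by simp [hC]) (by finiteness),
    fun f hf a R hR => ?_⟩
  set c := ENNReal.ofReal (R ^ n) with hc
  have hc0 : c ≠ 0 := by simpa [hc] using by positivity
  have hct : c ≠ ∞ := ENNReal.ofReal_ne_top
  set U := Metric.ball a R with hU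
  have hUm : MeasurableSet U := Metric.isOpen_ball.measurableSet
  have hvolU : volume U = 2 ^ n * c := by
    rw [hU, volume_ball_pi a hR, mul_pow, ENNReal.ofReal_mul (by positivity),
      ENNReal.ofReal_pow (by norm_num)]
    simp [hc]
  rw [lintegral_stepSet l (ρ * R) s hUm hf]
  set I := ∫⁻ x in U, stepIntegral l (ρ * R) s U f x with hI
  rcases eq_or_ne I ∞ with hIt | hIt
  · rw [hIt, ENNReal.mul_top (ENNReal.inv_ne_zero.2 hct), ENNReal.mul_top (by simp)]
    exact le_top
  -- The pointwise estimate needs a positive ε, and the mean may vanish; take ε to be the mean plus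
  -- e and let e tend to 0.
  refine ENNReal_le_of_forall_le_add_mul (K := (C + 1) * (2 ^ n * c))
    (ENNReal.mul_ne_top (by simp [hC]) (ENNReal.mul_ne_top (by finiteness) hct)) fun e he0 het => ?_
  have hci : c⁻¹ ≠ ∞ := ENNReal.inv_ne_top.2 hc0
  obtain ⟨P, hP, hPf⟩ := H f hf a R hR (c⁻¹ * (c⁻¹ * I) + e) (by simp [he0])
    (ENNReal.add_ne_top.2 ⟨ENNReal.mul_ne_top hci (ENNReal.mul_ne_top hci hIt), het⟩) le_self_add
  refine (iInf₂_le P hP).trans ?_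
  calc ∫⁻ x in U, ‖f x - MvPolynomial.eval x P‖ₑ ^ s
      ≤ ∫⁻ x in U, C * ((c⁻¹ * (c⁻¹ * I) + e) + c⁻¹ * stepIntegral l (ρ * R) s U f x) :=
        setLIntegral_mono' hUm hPf
    _ = C * ((c⁻¹ * (c⁻¹ * I) + e) * (2 ^ n * c) + c⁻¹ * I) := by
        rw [lintegral_const_mul' _ _ hC, lintegral_add_left measurable_const, setLIntegral_const,
          hvolU, lintegral_const_mul' _ _ hci]
    _ = C * (2 ^ n * (c * c⁻¹) * (c⁻¹ * I) + c⁻¹ * I + 2 ^ n * c * e) := by ring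
    _ = C * ((2 ^ n + 1) * (c⁻¹ * I) + 2 ^ n * c * e) := by
        rw [ENNReal.mul_inv_cancel hc0 hct]; ring
    _ ≤ (C + 1) * ((2 ^ n + 1) * (c⁻¹ * I) + 2 ^ n * c * e) := by gcongr; exact le_self_add
    _ = _ := by ring

/-- The pointwise estimate with s = 1 suffices: almost every normalized `stepIntegral` is at most a
constant times the essential supremum of the differences. -/
theorem whitney_of_measurable_top (n l : ℕ) (hl : 1 ≤ l) (ρ : ℝ) (hρ : 0 < ρ) :
    ∃ C : ℝ≥0∞, C ≠ ∞ ∧ ∀ f : (Fin n → ℝ) → ℝ, Measurable f → ∀ (a : Fin n → ℝ) (R : ℝ), 0 < R →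
      ⨅ (P : MvPolynomial (Fin n) ℝ) (_ : P.totalDegree < l),
        eLpNorm (fun x => f x - MvPolynomial.eval x P) ∞ (volume.restrict (Metric.ball a R)) ≤
      C * eLpNorm (fun z : (Fin n → ℝ) × (Fin n → ℝ) => fdiff l f z.2 z.1) ∞
          (volume.restrict (stepSet l (ρ * R) (Metric.ball a R))) := by
  obtain ⟨C, hC, H⟩ := exists_poly_pointwise n l hl ρ 1 hρ zero_lt_one
  set d := ENNReal.ofReal ((2 * ρ) ^ n) with hd
  refine ⟨C * ((2 ^ n + 1) * d) + 1, by simp [d]; finiteness, fun f hf a R hR => ?_⟩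
  set c := ENNReal.ofReal (R ^ n) with hc
  have hc0 : c ≠ 0 := by simpa [hc] using by positivity
  have hct : c ≠ ∞ := ENNReal.ofReal_ne_top
  have hci : c⁻¹ ≠ ∞ := ENNReal.inv_ne_top.2 hc0
  set U := Metric.ball a R with hU
  have hUm : MeasurableSet U := Metric.isOpen_ball.measurableSet
  have hvolU : volume U = 2 ^ n * c := by
    rw [hU, volume_ball_pi a hR, mul_pow, ENNReal.ofReal_mul (by positivity),
      ENNReal.ofReal_pow (by norm_num)]
    simp [hc]
  have hae := ae_stepIntegral_le (n := n) l (ρ * R) (by positivity) hUm (f := f)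
  set S := eLpNorm (fun z : (Fin n → ℝ) × (Fin n → ℝ) => fdiff l f z.2 z.1) ∞
          (volume.restrict (stepSet l (ρ * R) U)) with hS
  have hdc : ENNReal.ofReal ((2 * (ρ * R)) ^ n) = d * c := by
    rw [hd, hc, ← ENNReal.ofReal_mul (by positivity), ← mul_pow]; ring_nf
  rw [hdc] at hae
  rcases eq_or_ne S ∞ with hSt | hSt
  · rw [hSt, ENNReal.mul_top (by simp)]
    exact le_top
  have hae' : ∀ᵐ x ∂(volume.restrict U), c⁻¹ * stepIntegral l (ρ * R) 1 U f x ≤ d * S := by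
    filter_upwards [hae] with x hx
    calc c⁻¹ * stepIntegral l (ρ * R) 1 U f x ≤ c⁻¹ * (d * c * S) := by gcongr
      _ = (c⁻¹ * c) * (d * S) := by ring
      _ = d * S := by rw [ENNReal.inv_mul_cancel hc0 hct, one_mul]
  have hint : c⁻¹ * (c⁻¹ * ∫⁻ x in U, stepIntegral l (ρ * R) 1 U f x) ≤ 2 ^ n * (d * S) := by
    rw [← lintegral_const_mul' _ _ hci]
    calc c⁻¹ * ∫⁻ x in U, c⁻¹ * stepIntegral l (ρ * R) 1 U f x
        ≤ c⁻¹ * ∫⁻ _ in U, d * S := by gcongr c⁻¹ * ?_; exact lintegral_mono_ae hae'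
      _ = (c⁻¹ * c) * (2 ^ n * (d * S)) := by rw [setLIntegral_const, hvolU]; ring
      _ = _ := by rw [ENNReal.inv_mul_cancel hc0 hct, one_mul]
  refine ENNReal_le_of_forall_le_add_mul (K := C) hC fun e he0 het => ?_
  obtain ⟨P, hP, hPf⟩ := H f hf a R hR (2 ^ n * (d * S) + e) (by simp [he0])
    (ENNReal.add_ne_top.2 ⟨ENNReal.mul_ne_top (by finiteness)
      (ENNReal.mul_ne_top ENNReal.ofReal_ne_top hSt), het⟩) (hint.trans le_self_add)
  refine (iInf₂_le P hP).trans ?_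
  rw [eLpNorm_exponent_top]
  refine eLpNormEssSup_le_of_ae_enorm_bound ?_
  filter_upwards [hae', ae_restrict_mem hUm] with x hx hxU
  have h1 := hPf x hxU
  rw [ENNReal.rpow_one] at h1
  calc ‖f x - MvPolynomial.eval x P‖ₑ ≤ C * (2 ^ n * (d * S) + e + d * S) :=
        h1.trans (by gcongr)
    _ = C * ((2 ^ n + 1) * d) * S + C * e := by ring
    _ ≤ _ := by gcongr; exact le_self_add

/-- Whitney's inequality: the best approximation on a cube is controlled by differences with small
steps inside the cube. -/
theorem bestApprox_le_eLpNorm_fdiff (n l : ℕ) (hl : 1 ≤ l) (ρ : ℝ) (hρ : 0 < ρ) (r : ℝ≥0∞)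
    (hr : 0 < r) :
    ∃ C : ℝ≥0∞, C ≠ ∞ ∧ ∀ φ : (Fin n → ℝ) → ℝ, AEStronglyMeasurable φ volume →
      ∀ Q : Cube n, 0 < Q.side → bestApprox l r φ Q ≤
        C * (ENNReal.ofReal Q.side ^ n) ^ (-(1 / r.toReal)) *
          eLpNorm (fun z : (Fin n → ℝ) × (Fin n → ℝ) => fdiff l φ z.2 z.1) r
            (volume.restrict (stepSet l (ρ * Q.side) Q.toSet)) := by
  suffices h : ∃ C : ℝ≥0∞, C ≠ ∞ ∧ ∀ φ : (Fin n → ℝ) → ℝ, Measurable φ →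
      ∀ Q : Cube n, 0 < Q.side → bestApprox l r φ Q ≤
        C * (ENNReal.ofReal Q.side ^ n) ^ (-(1 / r.toReal)) *
          eLpNorm (fun z : (Fin n → ℝ) × (Fin n → ℝ) => fdiff l φ z.2 z.1) r
            (volume.restrict (stepSet l (ρ * Q.side) Q.toSet)) by
    obtain ⟨C, hC, H⟩ := h
    refine ⟨C, hC, fun φ hφ Q hQ => ?_⟩
    have hae := hφ.ae_eq_mk
    have h1 : bestApprox l r φ Q = bestApprox l r (hφ.mk φ) Q := by
      refine iInf_congr fun P => iInf_congr fun _ => eLpNorm_congr_ae (ae_restrict_of_ae ?_)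
      filter_upwards [hae] with x hx
      rw [hx]
    rw [h1, eLpNorm_congr_ae (ae_restrict_of_ae (fdiff_congr_ae l hae))]
    exact H _ hφ.stronglyMeasurable_mk.measurable Q hQ
  rcases eq_or_ne r ∞ with rfl | hrt
  -- A cube of side s is a ball of radius s/2, hence the factor 2.
  · obtain ⟨C, hC, H⟩ := whitney_of_measurable_top n l hl (2 * ρ) (by positivity)
    refine ⟨C, hC, fun φ hφ Q hQ => ?_⟩
    have h1 := H φ hφ Q.center (Q.side / 2) (by positivity)
    rw [← Cube.toSet_eq_ball Q hQ] at h1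
    have e : 2 * ρ * (Q.side / 2) = ρ * Q.side := by ring
    rw [e] at h1
    simpa [bestApprox] using h1
  · set s := r.toReal with hs
    have hs0 : 0 < s := ENNReal.toReal_pos hr.ne' hrt
    obtain ⟨C, hC, H⟩ := whitney_of_measurable_lt_top n l hl (2 * ρ) s (by positivity) hs0
    refine ⟨(C * 2 ^ n) ^ (1 / s), ENNReal.rpow_ne_top_of_nonneg (by positivity)
      (ENNReal.mul_ne_top hC (by finiteness)), fun φ hφ Q hQ => ?_⟩
    have h1 := H φ hφ Q.center (Q.side / 2) (by positivity)
    rw [← Cube.toSet_eq_ball Q hQ] at h1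
    have e : 2 * ρ * (Q.side / 2) = ρ * Q.side := by ring
    rw [e] at h1
    have h2 : (ENNReal.ofReal ((Q.side / 2) ^ n))⁻¹ = 2 ^ n * (ENNReal.ofReal Q.side ^ n)⁻¹ := by
      rw [div_pow, ENNReal.ofReal_div_of_pos (by positivity), ENNReal.ofReal_pow hQ.le,
        ENNReal.ofReal_pow (by norm_num), ENNReal.inv_div (by simp) (by simp),
        ENNReal.div_eq_inv_mul, mul_comm]
      simp
    have h3 : bestApprox l r φ Q ^ s ≤
        ⨅ (P : MvPolynomial (Fin n) ℝ) (_ : P.totalDegree < l),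
          ∫⁻ x in Q.toSet, ‖φ x - MvPolynomial.eval x P‖ₑ ^ s := by
      refine le_iInf₂ fun P hP => ?_
      have h4 : bestApprox l r φ Q ≤ _ := iInf₂_le P hP
      refine (ENNReal.rpow_le_rpow h4 hs0.le).trans (le_of_eq ?_)
      rw [eLpNorm_eq_lintegral_rpow_enorm_toReal hr.ne' hrt, ← ENNReal.rpow_mul,
        one_div_mul_cancel hs0.ne', ENNReal.rpow_one]
    have h5 := ENNReal.rpow_le_rpow (h3.trans h1) (by positivity : 0 ≤ 1 / s)
    rw [← ENNReal.rpow_mul, mul_one_div_cancel hs0.ne', ENNReal.rpow_one, h2] at h5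
    refine h5.trans (le_of_eq ?_)
    rw [eLpNorm_eq_lintegral_rpow_enorm_toReal hr.ne' hrt, ← mul_assoc, ← mul_assoc,
      ENNReal.mul_rpow_of_nonneg _ _ (by positivity),
      ENNReal.mul_rpow_of_nonneg _ _ (by positivity), ENNReal.rpow_neg, ENNReal.inv_rpow]

/-! Quasi-norm inequalities for finite sums and finite coverings -/

theorem ENNReal_sum_rpow_le {ι : Type*} (s : Finset ι) (a : ι → ℝ≥0∞) {t : ℝ} (ht : 0 < t) :
    (∑ i ∈ s, a i) ^ t ≤ (s.card : ℝ≥0∞) ^ t * ∑ i ∈ s, a i ^ t := by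
  rcases s.eq_empty_or_nonempty with rfl | hs
  · simp [ht]
  obtain ⟨i₀, hi₀, hmax⟩ := s.exists_max_image a hs
  have h1 : ∑ i ∈ s, a i ≤ s.card * a i₀ := by
    simpa using Finset.sum_le_card_nsmul s a (a i₀) hmax
  refine (ENNReal.rpow_le_rpow h1 ht.le).trans ?_
  rw [ENNReal.mul_rpow_of_nonneg _ _ ht.le]
  gcongr
  exact Finset.single_le_sum (f := fun i => a i ^ t) (fun _ _ => zero_le) hi₀

theorem eLpNorm_le_sum_of_cover {X ι F : Type*} [MeasurableSpace X] [NormedAddCommGroup F]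
    (r : ℝ≥0∞) (hr : 0 < r) (μ : Measure X) (f : X → F) (T : Set X) (s : Finset ι) (S : ι → Set X)
    (hT : ∀ᵐ x ∂μ, x ∈ T → ∃ i ∈ s, x ∈ S i) :
    eLpNorm f r (μ.restrict T) ≤
      (s.card : ℝ≥0∞) ^ (1 / r.toReal) * ∑ i ∈ s, eLpNorm f r (μ.restrict (S i)) := by
  have hle : μ.restrict T ≤ μ.restrict (⋃ i ∈ s, S i) := by
    refine Measure.restrict_mono_ae ?_
    filter_upwards [hT] with x hx hxT
    obtain ⟨i, hi, hxi⟩ := hx hxT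
    exact Set.mem_biUnion hi hxi
  refine (eLpNorm_mono_measure f hle).trans ?_
  rcases eq_or_ne r ∞ with rfl | hrt
  · simp only [ENNReal.toReal_top, div_zero, ENNReal.rpow_zero, one_mul, eLpNorm_exponent_top]
    refine eLpNormEssSup_le_of_ae_enorm_bound ?_
    rw [ae_restrict_biUnion_finset_iff]
    intro i hi
    filter_upwards [enorm_ae_le_eLpNormEssSup f (μ.restrict (S i))] with x hx
    exact hx.trans (Finset.single_le_sum (f := fun i => eLpNormEssSup f (μ.restrict (S i)))
      (fun _ _ => zero_le) hi)
  · have hs0 : 0 < r.toReal := ENNReal.toReal_pos hr.ne' hrt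
    simp only [eLpNorm_eq_lintegral_rpow_enorm_toReal hr.ne' hrt]
    refine le_trans (ENNReal.rpow_le_rpow ?_ (by positivity))
      (ENNReal_sum_rpow_le s _ (by positivity))
    rw [← lintegral_finsetSum_measure]
    refine lintegral_mono' ?_ le_rfl
    clear hle hT
    refine Measure.le_iff.2 fun A hA => ?_
    rw [Measure.restrict_apply hA, Set.inter_iUnion₂, Measure.finsetSum_apply]
    refine (measure_biUnion_finset_le _ _).trans (Finset.sum_le_sum fun i _ => ?_)
    rw [Measure.restrict_apply hA]

theorem eLpNorm_finsetSum_le {X ι F : Type*} [MeasurableSpace X] [NormedAddCommGroup F]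
    (r : ℝ≥0∞) (μ : Measure X) (s : Finset ι) (f : ι → X → F)
    (hf : ∀ i ∈ s, AEStronglyMeasurable (f i) μ) :
    eLpNorm (fun x => ∑ i ∈ s, f i x) r μ ≤
      (ENNReal.LpAddConst r + 1) ^ s.card * ∑ i ∈ s, eLpNorm (f i) r μ := by
  classical
  induction s using Finset.induction_on with
  | empty => simp
  | insert a s ha ih =>
    simp only [Finset.sum_insert ha, Finset.card_insert_of_notMem ha]
    have h1 := eLpNorm_add_le' (p := r) (hf a (Finset.mem_insert_self a s))
      (Finset.aestronglyMeasurable_fun_sum s fun i hi => hf i (Finset.mem_insert_of_mem hi))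
    refine h1.trans ?_
    rw [pow_succ']
    have h2 := ih fun i hi => hf i (Finset.mem_insert_of_mem hi)
    have h3 : (1 : ℝ≥0∞) ≤ (ENNReal.LpAddConst r + 1) ^ s.card := one_le_pow₀ le_add_self
    calc ENNReal.LpAddConst r * (eLpNorm (f a) r μ + eLpNorm (fun x => ∑ i ∈ s, f i x) r μ)
        ≤ (ENNReal.LpAddConst r + 1) * ((ENNReal.LpAddConst r + 1) ^ s.card * eLpNorm (f a) r μ +
          (ENNReal.LpAddConst r + 1) ^ s.card * ∑ i ∈ s, eLpNorm (f i) r μ) := by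
          gcongr
          · exact le_self_add
          · exact le_mul_of_one_le_left zero_le h3
      _ = _ := by ring

/-- The difference does not change when φ is replaced by φ - P. Each node contributes φ - P composed
with z ↦ x + jh, whose norm is read off from the pushforward measure. -/
theorem eLpNorm_fdiff_le_of_map_le {n l : ℕ} {r : ℝ≥0∞} {φ : (Fin n → ℝ) → ℝ}
    (hφ : AEStronglyMeasurable φ volume) {X : Type*} [MeasurableSpace X] {μ : Measure X}
    {x h : X → (Fin n → ℝ)} (hx : Measurable x) (hh : Measurable h) {K : ℝ≥0∞}
    {U : Set (Fin n → ℝ)}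
    (hK : ∀ j : ℕ, j ≤ l → Measure.map (fun z => x z + (j : ℝ) • h z) μ ≤ K • volume.restrict U)
    (hK0 : K ≠ 0) {P : MvPolynomial (Fin n) ℝ} (hP : P.totalDegree < l) :
    eLpNorm (fun z => fdiff l φ (x z) (h z)) r μ ≤ (ENNReal.LpAddConst r + 1) ^ (l + 1) *
      (∑ j ∈ Finset.range (l + 1), ‖(l.choose j : ℝ) * (-1) ^ (l + j)‖ₑ *
        (K ^ (1 / r.toReal) *
          eLpNorm (fun x => φ x - MvPolynomial.eval x P) r (volume.restrict U))) := by
  have hΦ : ∀ j : ℕ, Measurable fun z => x z + (j : ℝ) • h z := fun j =>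
    hx.add (hh.const_smul (j : ℝ))
  have hac : ∀ j : ℕ, j ≤ l → (Measure.map (fun z => x z + (j : ℝ) • h z) μ) ≪ volume := fun j hj =>
    (Measure.absolutelyContinuous_of_le (hK j hj)).trans
      ((Measure.smul_absolutelyContinuous).trans Measure.absolutelyContinuous_restrict)
  obtain ⟨g, hg⟩ : ∃ g : (Fin n → ℝ) → ℝ, g = fun y => φ y - MvPolynomial.eval y P := ⟨_, rfl⟩
  rw [← hg]
  have hgm : AEStronglyMeasurable g volume := by
    rw [hg]
    exact hφ.sub (MvPolynomial.continuous_eval P).aestronglyMeasurable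
  have e1 : (fun z => fdiff l φ (x z) (h z)) = fun z => ∑ j ∈ Finset.range (l + 1),
      ((l.choose j : ℝ) * (-1) ^ (l + j)) • g (x z + (j : ℝ) • h z) := by
    funext z
    have : fdiff l φ (x z) (h z) = fdiff l g (x z) (h z) := by
      rw [hg, fdiff_sub, fdiff_eval_eq_zero P hP, sub_zero]
    rw [this]
    simp only [fdiff, smul_eq_mul]
  have hcomp : ∀ j ∈ Finset.range (l + 1),
      AEStronglyMeasurable (fun z => g (x z + (j : ℝ) • h z)) μ := fun j hj =>
    (hgm.mono_ac (hac j (by simpa [Nat.lt_succ_iff] using hj))).comp_measurable (hΦ j)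
  rw [e1]
  refine (eLpNorm_finsetSum_le r μ (Finset.range (l + 1))
    (fun j z => ((l.choose j : ℝ) * (-1) ^ (l + j)) • g (x z + (j : ℝ) • h z)) fun j hj =>
    (hcomp j hj).const_smul ((l.choose j : ℝ) * (-1) ^ (l + j))).trans ?_
  rw [Finset.card_range]
  refine mul_le_mul' le_rfl (Finset.sum_le_sum fun j hj => ?_)
  have hj' : j ≤ l := by simpa [Nat.lt_succ_iff] using hj
  have e2 := eLpNorm_const_smul (p := r) (μ := μ) ((l.choose j : ℝ) * (-1) ^ (l + j))
    (fun z => g (x z + (j : ℝ) • h z))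
  refine (le_of_eq e2).trans (mul_le_mul' le_rfl ?_)
  have e3 := eLpNorm_map_measure (p := r) (μ := μ) (f := fun z => x z + (j : ℝ) • h z) (g := g)
    (hgm.mono_ac (hac j hj')) (hΦ j).aemeasurable
  refine (le_of_eq e3.symm).trans ((eLpNorm_mono_measure g (hK j hj')).trans ?_)
  rw [eLpNorm_smul_measure_of_ne_zero hK0, smul_eq_mul, ENNReal.toReal_div, ENNReal.toReal_one]

/-- Differences are controlled by best approximation. -/
theorem eLpNorm_fdiff_le_bestApprox (n l : ℕ) (r : ℝ≥0∞) :
    ∃ C : ℝ≥0∞, C ≠ ∞ ∧ ∀ φ : (Fin n → ℝ) → ℝ, AEStronglyMeasurable φ volume →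
      ∀ (X : Type) [MeasurableSpace X] (μ : Measure X) (x h : X → (Fin n → ℝ)),
      Measurable x → Measurable h → ∀ (K : ℝ≥0∞) (Q : Cube n),
      (∀ j : ℕ, j ≤ l → Measure.map (fun z => x z + (j : ℝ) • h z) μ ≤
        K • volume.restrict Q.toSet) → K ≠ 0 → K ≠ ∞ →
      eLpNorm (fun z => fdiff l φ (x z) (h z)) r μ ≤
        C * K ^ (1 / r.toReal) * bestApprox l r φ Q := by
  obtain ⟨A, hA⟩ : ∃ A, A = (ENNReal.LpAddConst r + 1) ^ (l + 1) := ⟨_, rfl⟩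
  obtain ⟨S, hS⟩ : ∃ S, S = ∑ j ∈ Finset.range (l + 1), ‖(l.choose j : ℝ) * (-1) ^ (l + j)‖ₑ :=
    ⟨_, rfl⟩
  have hCt : A * S ≠ ∞ := by
    rw [hA, hS]
    exact ENNReal.mul_ne_top (ENNReal.pow_ne_top (by simp [(ENNReal.LpAddConst_lt_top r).ne]))
      (ENNReal.sum_ne_top.2 fun _ _ => enorm_ne_top)
  refine ⟨A * S + 1, ENNReal.add_ne_top.2 ⟨hCt, by simp⟩, ?_⟩
  intro φ hφ X _ μ x h hx hh K Q hK hK0 hKt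
  have hc0 : (A * S + 1) * K ^ (1 / r.toReal) ≠ 0 :=
    mul_ne_zero (by simp) (by simp [ENNReal.rpow_eq_zero_iff, hK0, hKt])
  have hct : (A * S + 1) * K ^ (1 / r.toReal) ≠ ∞ :=
    ENNReal.mul_ne_top (ENNReal.add_ne_top.2 ⟨hCt, by simp⟩)
      (ENNReal.rpow_ne_top_of_nonneg (by positivity) hKt)
  rw [← ENNReal.div_le_iff' hc0 hct]
  refine le_iInf₂ fun P hP => ?_
  rw [ENNReal.div_le_iff' hc0 hct]
  refine (eLpNorm_fdiff_le_of_map_le hφ hx hh hK hK0 hP).trans ?_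
  rw [← Finset.sum_mul, ← hA, ← hS, ← mul_assoc, ← mul_assoc]
  gcongr
  exact le_self_add

/-! Local quantities as norms of differences over sets of steps -/

theorem boxAt_toSet_eq_ball {n : ℕ} (x : Fin n → ℝ) {s : ℝ} (hs : 0 < s) :
    (boxAt x s).toSet = Metric.ball x s := by
  rw [Cube.toSet_eq_ball _ (by simpa [boxAt] using hs)]
  simp [boxAt]

theorem Cube.isOpen_toSet {n : ℕ} (Q : Cube n) : IsOpen Q.toSet :=
  isOpen_set_pi Set.finite_univ fun _ _ => isOpen_Ioo

theorem Cube.convex_toSet {n : ℕ} (Q : Cube n) : Convex ℝ Q.toSet :=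
  convex_pi fun _ _ => convex_Ioo _ _

theorem diff_univ {n : ℕ} (l : ℕ) (h : Fin n → ℝ) (g : (Fin n → ℝ) → ℝ) (x : Fin n → ℝ) :
    diff l h Set.univ g x = fdiff l g x h := by
  simp [diff, fdiff]

theorem diff_cube {n : ℕ} (l : ℕ) (h : Fin n → ℝ) (Q : Cube n) (g : (Fin n → ℝ) → ℝ) :
    diff l h Q.toSet g =
      {x | x ∈ Q.toSet ∧ x + (l : ℝ) • h ∈ Q.toSet}.indicator fun x => fdiff l g x h := by
  classical
  funext x
  have e : segment ℝ x (x + (l : ℝ) • h) ⊆ Q.toSet ↔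
      x ∈ {x | x ∈ Q.toSet ∧ x + (l : ℝ) • h ∈ Q.toSet} :=
    ⟨fun H => ⟨H (left_mem_segment ℝ _ _), H (right_mem_segment ℝ _ _)⟩,
      fun H => Q.convex_toSet.segment_subset H.1 H.2⟩
  by_cases hx : x ∈ {x | x ∈ Q.toSet ∧ x + (l : ℝ) • h ∈ Q.toSet}
  · rw [Set.indicator_of_mem hx, diff, if_pos (e.2 hx)]; rfl
  · rw [Set.indicator_of_notMem hx, diff, if_neg (mt e.1 hx)]

theorem measurableSet_stepSlice {n : ℕ} (l : ℕ) (h : Fin n → ℝ) (Q : Cube n) :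
    MeasurableSet {x | x ∈ Q.toSet ∧ x + (l : ℝ) • h ∈ Q.toSet} :=
  Q.isOpen_toSet.measurableSet.inter
    (measurableSet_preimage (by fun_prop : Measurable fun x : Fin n → ℝ => x + (l : ℝ) • h)
      Q.isOpen_toSet.measurableSet)

theorem eLpNorm_diff_cube {n : ℕ} (l : ℕ) (r : ℝ≥0∞) (h : Fin n → ℝ) (Q : Cube n)
    (g : (Fin n → ℝ) → ℝ) :
    eLpNorm (diff l h Q.toSet g) r volume = eLpNorm (fun x => fdiff l g x h) r
      (volume.restrict {x | x ∈ Q.toSet ∧ x + (l : ℝ) • h ∈ Q.toSet}) := by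
  rw [diff_cube, eLpNorm_indicator_eq_eLpNorm_restrict (measurableSet_stepSlice l h Q)]

theorem delta_univ {n : ℕ} (l : ℕ) (r : ℝ≥0∞) (Q : Cube n) (hQ : 0 < Q.side)
    (g : (Fin n → ℝ) → ℝ) :
    delta l r Q Set.univ g = (ENNReal.ofReal Q.side ^ (2 * n)) ^ (-(1 / r.toReal)) *
      eLpNorm (fun z : (Fin n → ℝ) × (Fin n → ℝ) => fdiff l g z.2 z.1) r
        (volume.restrict (Metric.ball 0 Q.side ×ˢ Q.toSet)) := by
  rw [delta, Measure.prod_restrict, ← Measure.volume_eq_prod, boxAt_toSet_eq_ball _ hQ]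
  simp only [diff_univ]

theorem delta_self {n : ℕ} (l : ℕ) (r : ℝ≥0∞) (Q : Cube n) (hQ : 0 < Q.side)
    (g : (Fin n → ℝ) → ℝ) :
    delta l r Q Q.toSet g = (ENNReal.ofReal Q.side ^ (2 * n)) ^ (-(1 / r.toReal)) *
      eLpNorm (fun z : (Fin n → ℝ) × (Fin n → ℝ) => fdiff l g z.2 z.1) r
        (volume.restrict (stepSet l Q.side Q.toSet)) := by
  classical
  have hm := measurableSet_stepSet (n := n) l Q.side Q.isOpen_toSet.measurableSet
  rw [delta, Measure.prod_restrict, ← Measure.volume_eq_prod, boxAt_toSet_eq_ball _ hQ,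
    ← eLpNorm_indicator_eq_eLpNorm_restrict hm,
    ← eLpNorm_indicator_eq_eLpNorm_restrict
      (Metric.isOpen_ball.measurableSet.prod Q.isOpen_toSet.measurableSet)]
  congr 2
  funext z
  simp only [diff_cube, Set.indicator_apply, stepSet, Set.mem_prod, Set.mem_ofPred_eq]
  by_cases h1 : z.1 ∈ Metric.ball 0 Q.side <;> by_cases h2 : z.2 ∈ Q.toSet <;>
    simp only [h1, h2, true_and, and_true, and_false, false_and, if_true, if_false]

/-! Comparison with best approximation -/

theorem bestApprox_mono {n : ℕ} (l : ℕ) (r : ℝ≥0∞) (φ : (Fin n → ℝ) → ℝ) {Q Q' : Cube n}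
    (h : Q.toSet ⊆ Q'.toSet) : bestApprox l r φ Q ≤ bestApprox l r φ Q' :=
  iInf₂_mono fun _ _ => eLpNorm_mono_measure _ (Measure.restrict_mono h le_rfl)

theorem bestApprox_le_eLpNorm {n l : ℕ} (hl : 1 ≤ l) (r : ℝ≥0∞) (φ : (Fin n → ℝ) → ℝ)
    (Q : Cube n) : bestApprox l r φ Q ≤ eLpNorm φ r (volume.restrict Q.toSet) :=
  (iInf₂_le 0 (by rw [MvPolynomial.totalDegree_zero]; exact hl)).trans (le_of_eq (by simp))

/-- For a fixed step the node maps are translations, and convexity keeps intermediate nodes in Q, so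
the pushforwards are dominated with K = 1. -/
theorem modulus_le_bestApprox (n l : ℕ) (r : ℝ≥0∞) :
    ∃ C : ℝ≥0∞, C ≠ ∞ ∧ ∀ φ : (Fin n → ℝ) → ℝ, AEStronglyMeasurable φ volume →
      ∀ Q : Cube n, 0 < Q.side → modulus l r φ Q ≤ C * bestApprox l r φ Q := by
  obtain ⟨C, hC, H⟩ := eLpNorm_fdiff_le_bestApprox n l r
  refine ⟨C, hC, fun φ hφ Q hQ => iSup₂_le fun h _ => ?_⟩
  rw [eLpNorm_diff_cube]
  set U := {x | x ∈ Q.toSet ∧ x + (l : ℝ) • h ∈ Q.toSet} with hU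
  have h1 := H φ hφ (Fin n → ℝ) (volume.restrict U) id (fun _ => h) measurable_id measurable_const 1
    Q (fun j hj => ?_) one_ne_zero (by simp)
  · simpa using h1
  rw [one_smul]
  refine Measure.le_iff.2 fun A hA => ?_
  have hm : Measurable fun z : Fin n → ℝ => id z + (j : ℝ) • h := by fun_prop
  rw [Measure.map_apply hm hA, Measure.restrict_apply (hm hA), Measure.restrict_apply hA,
    ← measure_preimage_add_right volume ((j : ℝ) • h) (A ∩ Q.toSet)]
  refine measure_mono fun x hx => ⟨hx.1, ?_⟩
  rcases Nat.eq_zero_or_pos l with rfl | hl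
  · obtain rfl : j = 0 := by omega
    simpa using hx.2.1
  · have hx2 := hx.2
    simp only [hU, Set.mem_ofPred_eq] at hx2
    rw [Cube.toSet_eq_ball Q hQ] at hx2 ⊢
    exact segment_mem_ball hl hj hx2.1 hx2.2

/-- For each fixed step the node map is a translation into U; integrating over the steps gives the
factor `volume B`. -/
theorem map_add_smul_restrict_le {n : ℕ} (c : ℝ) {T : Set ((Fin n → ℝ) × (Fin n → ℝ))}
    {B U : Set (Fin n → ℝ)} (hB : MeasurableSet B) (hU : MeasurableSet U)
    (hTB : ∀ z ∈ T, z.1 ∈ B) (hTU : ∀ z ∈ T, z.2 + c • z.1 ∈ U) :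
    Measure.map (fun z : (Fin n → ℝ) × (Fin n → ℝ) => z.2 + c • z.1) (volume.restrict T) ≤
      volume B • volume.restrict U := by
  refine Measure.le_iff.2 fun A hA => ?_
  have hm : Measurable fun z : (Fin n → ℝ) × (Fin n → ℝ) => z.2 + c • z.1 := by fun_prop
  rw [Measure.map_apply hm hA, Measure.restrict_apply (hm hA), Measure.smul_apply,
    Measure.restrict_apply hA, smul_eq_mul]
  have hS : MeasurableSet ((fun z : (Fin n → ℝ) × (Fin n → ℝ) => z.2 + c • z.1) ⁻¹' (A ∩ U) ∩
      Prod.fst ⁻¹' B) := (hm (hA.inter hU)).inter (measurable_fst hB)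
  refine (measure_mono (t := (fun z : (Fin n → ℝ) × (Fin n → ℝ) => z.2 + c • z.1) ⁻¹' (A ∩ U) ∩
      Prod.fst ⁻¹' B) fun z hz => ⟨⟨hz.1, hTU z hz.2⟩, hTB z hz.2⟩).trans ?_
  rw [Measure.volume_eq_prod, Measure.prod_apply hS]
  calc ∫⁻ h, volume (Prod.mk h ⁻¹' ((fun z : (Fin n → ℝ) × (Fin n → ℝ) => z.2 + c • z.1) ⁻¹'
          (A ∩ U) ∩ Prod.fst ⁻¹' B))
      ≤ ∫⁻ h, B.indicator (fun _ => volume (A ∩ U)) h := by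
        refine lintegral_mono fun h => ?_
        by_cases hh : h ∈ B
        · rw [Set.indicator_of_mem hh, ← measure_preimage_add_right volume (c • h) (A ∩ U)]
          exact measure_mono fun x hx => hx.1
        · rw [Set.indicator_of_notMem hh]
          refine le_of_eq ?_
          convert measure_empty (μ := (volume : Measure (Fin n → ℝ)))
          ext x
          simp [hh]
    _ = volume B * volume (A ∩ U) := by
        rw [lintegral_indicator hB, setLIntegral_const, mul_comm]

/-- The norm of differences over a set of steps of length less than `ρ` is controlled by the best
approximation. -/
theorem eLpNorm_fdiff_restrict_le_bestApprox (n l : ℕ) (r : ℝ≥0∞) :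
    ∃ C : ℝ≥0∞, C ≠ ∞ ∧ ∀ φ : (Fin n → ℝ) → ℝ, AEStronglyMeasurable φ volume →
      ∀ (T : Set ((Fin n → ℝ) × (Fin n → ℝ))) (ρ : ℝ) (Q : Cube n), 0 < ρ →
      (∀ z ∈ T, z.1 ∈ Metric.ball 0 ρ) →
      (∀ j : ℕ, j ≤ l → ∀ z ∈ T, z.2 + (j : ℝ) • z.1 ∈ Q.toSet) →
      eLpNorm (fun z : (Fin n → ℝ) × (Fin n → ℝ) => fdiff l φ z.2 z.1) r (volume.restrict T) ≤
        C * (ENNReal.ofReal ρ ^ n) ^ (1 / r.toReal) * bestApprox l r φ Q := by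
  obtain ⟨C, hC, H⟩ := eLpNorm_fdiff_le_bestApprox n l r
  refine ⟨C * (2 ^ n) ^ (1 / r.toReal), ENNReal.mul_ne_top hC
    (ENNReal.rpow_ne_top_of_nonneg (by positivity) (by finiteness)), fun φ hφ T ρ Q hρ hT1 hT2 => ?_⟩
  have hv : volume (Metric.ball (0 : Fin n → ℝ) ρ) = 2 ^ n * ENNReal.ofReal ρ ^ n := by
    rw [volume_ball_pi 0 hρ, mul_pow, ENNReal.ofReal_mul (by positivity),
      ENNReal.ofReal_pow (by norm_num), ENNReal.ofReal_pow hρ.le]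
    simp
  refine (H φ hφ _ (volume.restrict T) Prod.snd Prod.fst measurable_snd measurable_fst
    (volume (Metric.ball (0 : Fin n → ℝ) ρ)) Q (fun j hj => map_add_smul_restrict_le (j : ℝ)
      Metric.isOpen_ball.measurableSet Q.isOpen_toSet.measurableSet hT1 (hT2 j hj))
      (Metric.measure_ball_pos volume 0 hρ).ne' measure_ball_lt_top.ne).trans (le_of_eq ?_)
  rw [hv, ENNReal.mul_rpow_of_nonneg _ _ (by positivity)]
  ring

/-! Comparison with the modulus of continuity -/

theorem fdiff_zero_step {n l : ℕ} (hl : 1 ≤ l) (g : (Fin n → ℝ) → ℝ) (x : Fin n → ℝ) :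
    fdiff l g x 0 = 0 := by
  have h := fdiff_eval_eq_zero (n := n) (l := l) (MvPolynomial.C (g x))
    (by rw [MvPolynomial.totalDegree_C]; exact hl) x 0
  simpa [fdiff] using h

theorem eLpNorm_fdiff_slice_le_modulus {n l : ℕ} (hl : 1 ≤ l) (r : ℝ≥0∞) (φ : (Fin n → ℝ) → ℝ)
    (Q : Cube n) (h : Fin n → ℝ) :
    eLpNorm (fun x => fdiff l φ x h) r
      (volume.restrict {x | x ∈ Q.toSet ∧ x + (l : ℝ) • h ∈ Q.toSet}) ≤ modulus l r φ Q := by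
  rcases eq_or_ne h 0 with rfl | hh
  · simp [fdiff_zero_step hl]
  · rw [← eLpNorm_diff_cube]
    exact le_iSup₂ (f := fun (h : Fin n → ℝ) (_ : h ≠ 0) => eLpNorm (diff l h Q.toSet φ) r volume)
      h hh

theorem modulus_congr_ae {n : ℕ} (l : ℕ) (r : ℝ≥0∞) {f g : (Fin n → ℝ) → ℝ}
    (hfg : f =ᵐ[volume] g) (Q : Cube n) : modulus l r f Q = modulus l r g Q := by
  refine iSup_congr fun h => iSup_congr fun _ => ?_
  rw [eLpNorm_diff_cube, eLpNorm_diff_cube]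
  refine eLpNorm_congr_ae (ae_restrict_of_ae ?_)
  have h1 : ∀ j : ℕ, ∀ᵐ x : Fin n → ℝ, f (x + (j : ℝ) • h) = g (x + (j : ℝ) • h) := fun j =>
    (measurePreserving_add_right volume ((j : ℝ) • h)).quasiMeasurePreserving.ae hfg
  filter_upwards [ae_all_iff.2 h1] with z hz
  exact Finset.sum_congr rfl fun j _ => by rw [hz j]

/-- Slice by the step h: every slice is bounded by the modulus, and the steps fill a ball. For r = ∞
the exceptional null slices combine to a null set only after a measurable representative is chosen.
-/
theorem eLpNorm_fdiff_stepSet_le_modulus {n l : ℕ} (hl : 1 ≤ l) (r : ℝ≥0∞) (hr : 0 < r)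
    {φ : (Fin n → ℝ) → ℝ} (hφ : AEStronglyMeasurable φ volume) (Q : Cube n) (ρ : ℝ) :
    eLpNorm (fun z : (Fin n → ℝ) × (Fin n → ℝ) => fdiff l φ z.2 z.1) r
        (volume.restrict (stepSet l ρ Q.toSet)) ≤
      volume (Metric.ball (0 : Fin n → ℝ) ρ) ^ (1 / r.toReal) * modulus l r φ Q := by
  classical
  have hS := measurableSet_stepSet (n := n) l ρ Q.isOpen_toSet.measurableSet
  rcases eq_or_ne r ∞ with rfl | hrt
  · have hae := hφ.ae_eq_mk
    rw [eLpNorm_congr_ae (ae_restrict_of_ae (fdiff_congr_ae l hae)), modulus_congr_ae l ∞ hae]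
    have hf := hφ.stronglyMeasurable_mk.measurable
    set f := hφ.mk φ
    simp only [ENNReal.toReal_top, div_zero, ENNReal.rpow_zero, one_mul]
    rw [eLpNorm_exponent_top]
    refine eLpNormEssSup_le_of_ae_enorm_bound ?_
    rw [ae_restrict_iff' hS, ae_iff, Measure.volume_eq_prod, Measure.measure_prod_null]
    · refine Filter.Eventually.of_forall fun h => ?_
      have h1 := eLpNorm_fdiff_slice_le_modulus hl ∞ f Q h
      rw [eLpNorm_exponent_top] at h1
      have h2 := enorm_ae_le_eLpNormEssSup (fun x => fdiff l f x h)
        (volume.restrict {x | x ∈ Q.toSet ∧ x + (l : ℝ) • h ∈ Q.toSet})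
      rw [ae_restrict_iff' (measurableSet_stepSlice l h Q)] at h2
      refine measure_mono_null (fun x hx => ?_) (ae_iff.1 h2)
      simp only [Set.mem_preimage, Set.mem_ofPred_eq, Classical.not_imp, stepSet] at hx ⊢
      exact ⟨hx.1.2, fun h3 => hx.2 (h3.trans h1)⟩
    · have : {z : (Fin n → ℝ) × (Fin n → ℝ) | ¬ (z ∈ stepSet l ρ Q.toSet →
          ‖fdiff l f z.2 z.1‖ₑ ≤ modulus l ∞ f Q)} = stepSet l ρ Q.toSet ∩
          {z | modulus l ∞ f Q < ‖fdiff l f z.2 z.1‖ₑ} := by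
        ext z; simp
      rw [this]
      exact hS.inter (measurableSet_lt measurable_const (measurable_fdiff_swap l hf).enorm)
  · have hs0 : 0 < r.toReal := ENNReal.toReal_pos hr.ne' hrt
    set s := r.toReal with hs
    rw [eLpNorm_eq_lintegral_rpow_enorm_toReal hr.ne' hrt, ← hs]
    have key : ∫⁻ z in stepSet l ρ Q.toSet, ‖fdiff l φ z.2 z.1‖ₑ ^ s ≤
        volume (Metric.ball (0 : Fin n → ℝ) ρ) * modulus l r φ Q ^ s := by
      rw [← lintegral_indicator hS, Measure.volume_eq_prod]
      refine (lintegral_prod_le _).trans ?_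
      calc _ ≤ ∫⁻ h, (Metric.ball (0 : Fin n → ℝ) ρ).indicator
              (fun _ => modulus l r φ Q ^ s) h := by
            refine lintegral_mono fun h => ?_
            by_cases hh : h ∈ Metric.ball (0 : Fin n → ℝ) ρ
            · rw [Set.indicator_of_mem hh]
              have h1 := eLpNorm_fdiff_slice_le_modulus hl r φ Q h
              rw [eLpNorm_eq_lintegral_rpow_enorm_toReal hr.ne' hrt, ← hs] at h1
              have h2 := ENNReal.rpow_le_rpow h1 hs0.le
              rw [← ENNReal.rpow_mul, one_div_mul_cancel hs0.ne', ENNReal.rpow_one,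
                ← lintegral_indicator (measurableSet_stepSlice l h Q)] at h2
              refine le_trans (lintegral_mono fun x => ?_) h2
              simp only [Set.indicator_apply, stepSet, Set.mem_ofPred_eq]
              simp only [hh, true_and, le_refl]
            · rw [Set.indicator_of_notMem hh]
              refine le_of_eq ?_
              rw [← lintegral_zero (μ := (volume : Measure (Fin n → ℝ)))]
              congr 1
              funext x
              simp only [Set.indicator_apply, stepSet, Set.mem_ofPred_eq, hh, false_and, if_false]
        _ = _ := by
            rw [lintegral_indicator Metric.isOpen_ball.measurableSet, setLIntegral_const, mul_comm]
    refine (ENNReal.rpow_le_rpow key (by positivity)).trans (le_of_eq ?_)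
    rw [ENNReal.mul_rpow_of_nonneg _ _ (by positivity), ← ENNReal.rpow_mul,
      mul_one_div_cancel hs0.ne', ENNReal.rpow_one]

/-! Geometry of dyadic cubes -/

theorem mem_dilate_dyadicCube {n k : ℕ} {m : Fin n → ℤ} {a : ℝ} (ha : 0 < a) {x : Fin n → ℝ} :
    x ∈ ((dyadicCube k m).dilate a).toSet ↔
      ‖x - (dyadicCube k m).center‖ < a / 2 * (1 / 2 ^ k) := by
  rw [Cube.toSet_eq_ball _ (by simp only [Cube.dilate, dyadicCube]; positivity),
    mem_ball_iff_norm]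
  simp only [Cube.dilate, dyadicCube]
  rw [show a * (1 / (2 : ℝ) ^ k) / 2 = a / 2 * (1 / 2 ^ k) by ring]

theorem dilate_one {n : ℕ} (Q : Cube n) : Q.dilate 1 = Q := by
  simp [Cube.dilate]

theorem mem_dyadicCube {n k : ℕ} {m : Fin n → ℤ} {x : Fin n → ℝ} :
    x ∈ (dyadicCube k m).toSet ↔
      ‖x - (dyadicCube k m).center‖ < 1 / 2 * (1 / 2 ^ k) := by
  rw [← mem_dilate_dyadicCube one_pos, dilate_one]

theorem ae_exists_mem_dyadicCube (n k : ℕ) :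
    ∀ᵐ x : Fin n → ℝ, ∃ m : Fin n → ℤ, x ∈ (dyadicCube k m).toSet := by
  have h1 : ∀ i : Fin n, ∀ j : ℤ, ∀ᵐ x : Fin n → ℝ, x i ≠ (j : ℝ) / 2 ^ k := fun i j => by
    rw [ae_iff]
    simpa [volume_pi] using Measure.pi_hyperplane (fun _ : Fin n => (volume : Measure ℝ)) i ((j : ℝ) / 2 ^ k)
  filter_upwards [ae_all_iff.2 fun i => ae_all_iff.2 (h1 i)] with x hx
  refine ⟨fun i => ⌊x i * 2 ^ k⌋, ?_⟩
  rw [dyadicCube_toSet]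
  intro i _
  have hk : (0 : ℝ) < 2 ^ k := by positivity
  refine ⟨lt_of_le_of_ne ?_ (hx i _).symm, ?_⟩
  · rw [div_le_iff₀ hk]; exact Int.floor_le _
  · rw [lt_div_iff₀ hk]; exact Int.lt_floor_add_one _

theorem disjoint_dyadicCube {n k : ℕ} {m m' : Fin n → ℤ} (h : m ≠ m') :
    Disjoint (dyadicCube k m).toSet (dyadicCube k m').toSet := by
  obtain ⟨i, hi⟩ := Function.ne_iff.1 h
  rw [Set.disjoint_left]
  intro x hx hx'
  rw [dyadicCube_toSet] at hx hx'
  have hk : (0 : ℝ) < 2 ^ k := by positivity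
  have h1 := hx i trivial
  have h2 := hx' i trivial
  rw [Set.mem_Ioo, div_lt_iff₀ hk, lt_div_iff₀ hk] at h1 h2
  have h3 : (m i : ℝ) < m' i + 1 := h1.1.trans h2.2
  have h4 : (m' i : ℝ) < m i + 1 := h2.1.trans h1.2
  have h3' : m i < m' i + 1 := by exact_mod_cast h3
  have h4' : m' i < m i + 1 := by exact_mod_cast h4
  omega

theorem center_dyadicCube_add {n k : ℕ} (m e : Fin n → ℤ) (i : Fin n) :
    (dyadicCube k (m + e)).center i = (dyadicCube k m).center i + e i * (1 / 2 ^ k) := by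
  simp only [dyadicCube, Pi.add_apply, Int.cast_add]
  ring

/-- The index shifts of size at most `N`. -/
noncomputable def shifts (n N : ℕ) : Finset (Fin n → ℤ) :=
  Fintype.piFinset fun _ => Finset.Icc (-(N : ℤ)) N

theorem mem_shifts {n N : ℕ} {e : Fin n → ℤ} : e ∈ shifts n N ↔ ∀ i, |e i| ≤ N := by
  simp [shifts, abs_le]

/-- The centres of two cubes with a common point differ by less than (κ/2 + 1/2) 2^{-k} in each
coordinate. -/
theorem sub_mem_shifts {n k N : ℕ} {m m' : Fin n → ℤ} {κ : ℝ} (hκ : 0 < κ)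
    (hN : κ / 2 + 1 / 2 ≤ N) {x : Fin n → ℝ} (hx : x ∈ ((dyadicCube k m).dilate κ).toSet)
    (hx' : x ∈ (dyadicCube k m').toSet) : m' - m ∈ shifts n N := by
  rw [mem_shifts]
  intro i
  rw [mem_dilate_dyadicCube hκ] at hx
  rw [mem_dyadicCube] at hx'
  have h1 := (norm_le_pi_norm _ i).trans_lt hx
  have h2 := (norm_le_pi_norm _ i).trans_lt hx'
  have hk : (0 : ℝ) < 1 / 2 ^ k := by positivity
  have e1 : (dyadicCube k m').center i = (dyadicCube k m).center i + (m' - m) i * (1 / 2 ^ k) := by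
    rw [← center_dyadicCube_add, add_sub_cancel]
  rw [Pi.sub_apply, Real.norm_eq_abs] at h1 h2
  rw [e1] at h2
  have h3 : |(((m' - m) i : ℤ) : ℝ) * (1 / 2 ^ k)| < N * (1 / 2 ^ k) := by
    calc |(((m' - m) i : ℤ) : ℝ) * (1 / 2 ^ k)|
        = |(x i - (dyadicCube k m).center i) - (x i - ((dyadicCube k m).center i +
            (m' - m) i * (1 / 2 ^ k)))| := by ring_nf
      _ ≤ _ := abs_sub _ _
      _ < κ / 2 * (1 / 2 ^ k) + 1 / 2 * (1 / 2 ^ k) := add_lt_add h1 h2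
      _ ≤ N * (1 / 2 ^ k) := by rw [← add_mul]; gcongr
  rw [abs_mul, abs_of_pos hk, mul_lt_mul_iff_left₀ hk] at h3
  exact_mod_cast h3.le

/-! Normalizing factors -/

theorem scale_eq_rpow (n k : ℕ) (s : ℝ≥0∞) :
    scale n k s = (ENNReal.ofReal (1 / 2 ^ k) ^ n) ^ (-(1 / s.toReal)) := by
  have h : ENNReal.ofReal (1 / 2 ^ k) = (2 : ℝ≥0∞) ^ (-(k : ℝ)) := by
    rw [ENNReal.rpow_neg, ENNReal.rpow_natCast, one_div, ENNReal.ofReal_inv_of_pos (by positivity),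
      ENNReal.ofReal_pow (by norm_num)]
    simp
  rw [h, ← ENNReal.rpow_natCast, ← ENNReal.rpow_mul, ← ENNReal.rpow_mul, scale]
  congr 1
  ring

theorem ofReal_side_ne_zero (n k : ℕ) : ENNReal.ofReal (1 / 2 ^ k) ^ n ≠ 0 :=
  pow_ne_zero _ (by simp)

theorem scale_ne_top (n k : ℕ) (s : ℝ≥0∞) : scale n k s ≠ ∞ :=
  ENNReal.rpow_ne_top_of_nonneg (by positivity) (by simp)

theorem ofReal_mul_side_rpow (n k : ℕ) {a : ℝ} (ha : 0 < a) (y : ℝ) :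
    (ENNReal.ofReal (a * (1 / 2 ^ k)) ^ n) ^ y =
      (ENNReal.ofReal a ^ n) ^ y * (ENNReal.ofReal (1 / 2 ^ k) ^ n) ^ y := by
  rw [ENNReal.ofReal_mul ha.le, mul_pow, ENNReal.mul_rpow_of_ne_top (by finiteness) (by finiteness)]

theorem ofReal_pow_rpow_ne_top (n : ℕ) {a : ℝ} (ha : 0 < a) (y : ℝ) :
    (ENNReal.ofReal a ^ n) ^ y ≠ ∞ :=
  ENNReal.rpow_ne_top_of_ne_zero (pow_ne_zero _ (by simpa using ha)) (by finiteness)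

theorem ofReal_mul_side_neg_rpow (n k : ℕ) (s : ℝ≥0∞) {a : ℝ} (ha : 0 < a) :
    (ENNReal.ofReal (a * (1 / 2 ^ k)) ^ n) ^ (-(1 / s.toReal)) =
      (ENNReal.ofReal a ^ n) ^ (-(1 / s.toReal)) * scale n k s := by
  rw [ofReal_mul_side_rpow n k ha, scale_eq_rpow]

theorem scale_mul_rpow (n k : ℕ) (s : ℝ≥0∞) {a : ℝ} (ha : 0 < a) :
    scale n k s * (ENNReal.ofReal (a * (1 / 2 ^ k)) ^ n) ^ (1 / s.toReal) =
      (ENNReal.ofReal a ^ n) ^ (1 / s.toReal) := by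
  rw [ofReal_mul_side_rpow n k ha, scale_eq_rpow, mul_left_comm, ← ENNReal.rpow_add _ _
    (ofReal_side_ne_zero n k) (by finiteness)]
  simp

theorem ofReal_mul_side_two_neg_rpow (n k : ℕ) (s : ℝ≥0∞) {a : ℝ} (ha : 0 < a) :
    (ENNReal.ofReal (a * (1 / 2 ^ k)) ^ (2 * n)) ^ (-(1 / s.toReal)) =
      (ENNReal.ofReal a ^ (2 * n)) ^ (-(1 / s.toReal)) * scale n k s ^ 2 := by
  rw [ofReal_mul_side_rpow (2 * n) k ha, scale_eq_rpow, ← ENNReal.rpow_natCast,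
    ← ENNReal.rpow_natCast, ← ENNReal.rpow_natCast, ← ENNReal.rpow_natCast, ← ENNReal.rpow_mul,
    ← ENNReal.rpow_mul, ← ENNReal.rpow_mul, ← ENNReal.rpow_mul]
  congr 2
  push_cast
  ring

theorem ofReal_pow_rpow_ne_zero (n : ℕ) {a : ℝ} (ha : 0 < a) (y : ℝ) :
    (ENNReal.ofReal a ^ n) ^ y ≠ 0 := by
  have h1 : ENNReal.ofReal a ^ n ≠ 0 := pow_ne_zero _ (by simpa using ha)
  have h2 : ENNReal.ofReal a ^ n ≠ ∞ := by finiteness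
  simp [ENNReal.rpow_eq_zero_iff, h1, h2]

/-! Inequalities between the local quantities -/

theorem dilate_side_pos {n k : ℕ} {m : Fin n → ℤ} {a : ℝ} (ha : 0 < a) :
    0 < ((dyadicCube k m).dilate a).side := by
  simp only [Cube.dilate, dyadicCube]; positivity

/-- A local Whitney estimate: the best approximation on `κ Q_{k,m}` is controlled by differences
whose base point lies in a neighbour of `Q_{k,m}`. -/
theorem scale_bestApprox_le_sum_eLpNorm (n l : ℕ) (hl : 1 ≤ l) (r : ℝ≥0∞) (hr : 0 < r) {κ ρ : ℝ}
    (hκ : 0 < κ) (hρ : 0 < ρ) {N : ℕ} (hN : κ / 2 + 1 / 2 ≤ N) :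
    ∃ C : ℝ≥0∞, C ≠ ∞ ∧ ∀ φ : (Fin n → ℝ) → ℝ, AEStronglyMeasurable φ volume →
      ∀ (k : ℕ) (m : Fin n → ℤ), scale n k r * bestApprox l r φ ((dyadicCube k m).dilate κ) ≤
        C * ∑ e ∈ shifts n N, scale n k r ^ 2 *
          eLpNorm (fun z : (Fin n → ℝ) × (Fin n → ℝ) => fdiff l φ z.2 z.1) r
            (volume.restrict (Metric.ball 0 (ρ * (1 / 2 ^ k)) ×ˢ (dyadicCube k (m + e)).toSet)) := by
  -- On a cube of side κ 2^{-k} this allows steps shorter than ρ 2^{-k}.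
  obtain ⟨C, hC, H⟩ := bestApprox_le_eLpNorm_fdiff n l hl (ρ / κ) (by positivity) r hr
  refine ⟨C * (ENNReal.ofReal κ ^ n) ^ (-(1 / r.toReal)) *
    ((shifts n N).card : ℝ≥0∞) ^ (1 / r.toReal), ENNReal.mul_ne_top (ENNReal.mul_ne_top hC
      (ofReal_pow_rpow_ne_top n hκ _)) (ENNReal.rpow_ne_top_of_nonneg (by positivity) (by simp)),
    fun φ hφ k m => ?_⟩
  have h1 := H φ hφ _ (dilate_side_pos (k := k) (m := m) hκ)
  have e1 : ((dyadicCube k m).dilate κ).side = κ * (1 / 2 ^ k) := rfl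
  rw [e1, ofReal_mul_side_neg_rpow n k r hκ,
    show ρ / κ * (κ * (1 / 2 ^ k)) = ρ * (1 / 2 ^ k) by field_simp] at h1
  have hae : ∀ᵐ z : (Fin n → ℝ) × (Fin n → ℝ),
      z ∈ stepSet l (ρ * (1 / 2 ^ k)) ((dyadicCube k m).dilate κ).toSet →
      ∃ e ∈ shifts n N, z ∈ Metric.ball (0 : Fin n → ℝ) (ρ * (1 / 2 ^ k)) ×ˢ
        (dyadicCube k (m + e)).toSet := by
    filter_upwards [Measure.quasiMeasurePreserving_snd.ae (ae_exists_mem_dyadicCube n k)]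
      with z hz hzT
    obtain ⟨m', hm'⟩ := hz
    refine ⟨m' - m, sub_mem_shifts hκ hN hzT.2.1 hm', hzT.1, ?_⟩
    rwa [add_sub_cancel]
  have h2 := eLpNorm_le_sum_of_cover r hr volume
    (fun z : (Fin n → ℝ) × (Fin n → ℝ) => fdiff l φ z.2 z.1) _ (shifts n N) _ hae
  rw [← Finset.mul_sum]
  calc _ ≤ scale n k r * (C * ((ENNReal.ofReal κ ^ n) ^ (-(1 / r.toReal)) * scale n k r) *
      (((shifts n N).card : ℝ≥0∞) ^ (1 / r.toReal) * _)) :=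
        mul_le_mul' le_rfl (h1.trans (mul_le_mul' le_rfl h2))
    _ = _ := by ring

theorem sq_scale_mul_eLpNorm_le_delta_univ {n : ℕ} (l : ℕ) (r : ℝ≥0∞) (φ : (Fin n → ℝ) → ℝ)
    {ρ : ℝ} (hρ : ρ ≤ 1) (k : ℕ) (m : Fin n → ℤ) :
    scale n k r ^ 2 * eLpNorm (fun z : (Fin n → ℝ) × (Fin n → ℝ) => fdiff l φ z.2 z.1) r
        (volume.restrict (Metric.ball 0 (ρ * (1 / 2 ^ k)) ×ˢ (dyadicCube k m).toSet)) ≤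
      delta l r (dyadicCube k m) Set.univ φ := by
  have e1 : (dyadicCube k m).side = 1 * (1 / 2 ^ k) := by simp [dyadicCube]
  rw [delta_univ l r _ (by rw [e1]; positivity), e1, ofReal_mul_side_two_neg_rpow n k r one_pos]
  simp only [ENNReal.ofReal_one, one_pow, ENNReal.one_rpow, one_mul]
  gcongr
  refine (mul_le_mul_of_nonneg_right hρ (by positivity)).trans (one_mul _).le

/-- A base point in Q_{k,m} moves by less than l ρ 2^{-k}, and 1 + 2lρ ≤ c keeps it inside c
Q_{k,m}. This is where the room given by c > 1 is spent. -/
theorem sq_scale_mul_eLpNorm_le_delta_self (n l : ℕ) (r : ℝ≥0∞) {c ρ : ℝ} (hc : 1 < c)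
    (hρ1 : ρ ≤ 1) (hρc : 1 + 2 * l * ρ ≤ c) :
    ∃ C : ℝ≥0∞, C ≠ ∞ ∧ ∀ (φ : (Fin n → ℝ) → ℝ) (k : ℕ) (m : Fin n → ℤ),
      scale n k r ^ 2 * eLpNorm (fun z : (Fin n → ℝ) × (Fin n → ℝ) => fdiff l φ z.2 z.1) r
        (volume.restrict (Metric.ball 0 (ρ * (1 / 2 ^ k)) ×ˢ (dyadicCube k m).toSet)) ≤
      C * delta l r ((dyadicCube k m).dilate c) ((dyadicCube k m).dilate c).toSet φ := by
  have hc0 : 0 < c := by linarith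
  refine ⟨((ENNReal.ofReal c ^ (2 * n)) ^ (-(1 / r.toReal)))⁻¹,
    ENNReal.inv_ne_top.2 (ofReal_pow_rpow_ne_zero _ hc0 _), fun φ k m => ?_⟩
  have e1 : ((dyadicCube k m).dilate c).side = c * (1 / 2 ^ k) := rfl
  rw [delta_self l r _ (dilate_side_pos hc0), e1, ofReal_mul_side_two_neg_rpow n k r hc0, mul_assoc,
    ← mul_assoc _ ((ENNReal.ofReal c ^ (2 * n)) ^ (-(1 / r.toReal))),
    ENNReal.inv_mul_cancel (ofReal_pow_rpow_ne_zero _ hc0 _) (ofReal_pow_rpow_ne_top _ hc0 _),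
    one_mul]
  refine mul_le_mul' le_rfl (eLpNorm_mono_measure _ (Measure.restrict_mono ?_ le_rfl))
  rintro z ⟨hz1, hz2⟩
  have hk : (0 : ℝ) < 1 / 2 ^ k := by positivity
  rw [mem_ball_zero_iff] at hz1
  rw [mem_dyadicCube] at hz2
  refine ⟨?_, ?_, ?_⟩
  · rw [mem_ball_zero_iff]
    exact hz1.trans_le (by gcongr; linarith)
  · rw [mem_dilate_dyadicCube hc0]
    exact hz2.trans_le (by gcongr)
  · rw [mem_dilate_dyadicCube hc0, add_sub_right_comm]
    calc ‖z.2 - (dyadicCube k m).center + (l : ℝ) • z.1‖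
        ≤ ‖z.2 - (dyadicCube k m).center‖ + ‖(l : ℝ) • z.1‖ := norm_add_le _ _
      _ < 1 / 2 * (1 / 2 ^ k) + l * (ρ * (1 / 2 ^ k)) := by
        rw [norm_smul, Real.norm_natCast]
        exact add_lt_add_of_lt_of_le hz2 (by gcongr)
      _ = (1 + 2 * l * ρ) / 2 * (1 / 2 ^ k) := by ring
      _ ≤ c / 2 * (1 / 2 ^ k) := by gcongr

theorem scale_bestApprox_le_sum_delta_univ (n l : ℕ) (hl : 1 ≤ l) (r : ℝ≥0∞) (hr : 0 < r) {κ : ℝ}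
    (hκ : 0 < κ) {N : ℕ} (hN : κ / 2 + 1 / 2 ≤ N) :
    ∃ C : ℝ≥0∞, C ≠ ∞ ∧ ∀ φ : (Fin n → ℝ) → ℝ, AEStronglyMeasurable φ volume →
      ∀ (k : ℕ) (m : Fin n → ℤ), scale n k r * bestApprox l r φ ((dyadicCube k m).dilate κ) ≤
        C * ∑ e ∈ shifts n N, delta l r (dyadicCube k (m + e)) Set.univ φ := by
  obtain ⟨C, hC, H⟩ := scale_bestApprox_le_sum_eLpNorm n l hl r hr hκ one_pos hN
  exact ⟨C, hC, fun φ hφ k m => (H φ hφ k m).trans (mul_le_mul' le_rfl (Finset.sum_le_sum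
    fun e _ => sq_scale_mul_eLpNorm_le_delta_univ l r φ le_rfl k (m + e)))⟩

theorem scale_bestApprox_le_sum_delta_self (n l : ℕ) (hl : 1 ≤ l) (r : ℝ≥0∞) (hr : 0 < r) {c κ : ℝ}
    (hc : 1 < c) (hκ : 0 < κ) {N : ℕ} (hN : κ / 2 + 1 / 2 ≤ N) :
    ∃ C : ℝ≥0∞, C ≠ ∞ ∧ ∀ φ : (Fin n → ℝ) → ℝ, AEStronglyMeasurable φ volume →
      ∀ (k : ℕ) (m : Fin n → ℤ), scale n k r * bestApprox l r φ ((dyadicCube k m).dilate κ) ≤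
        C * ∑ e ∈ shifts n N, delta l r ((dyadicCube k (m + e)).dilate c)
          ((dyadicCube k (m + e)).dilate c).toSet φ := by
  have hl0 : (0 : ℝ) < l := by exact_mod_cast hl
  obtain ⟨ρ, hρ, hρ1, hρc⟩ : ∃ ρ : ℝ, 0 < ρ ∧ ρ ≤ 1 ∧ 1 + 2 * l * ρ ≤ c := by
    refine ⟨min 1 ((c - 1) / (2 * l)), lt_min one_pos (div_pos (by linarith) (by positivity)),
      min_le_left _ _, ?_⟩
    have h1 : 2 * l * min 1 ((c - 1) / (2 * l)) ≤ 2 * l * ((c - 1) / (2 * l)) := by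
      gcongr; exact min_le_right _ _
    rw [mul_div_cancel₀ _ (by positivity)] at h1
    linarith
  obtain ⟨C, hC, H⟩ := scale_bestApprox_le_sum_eLpNorm n l hl r hr hκ hρ hN
  obtain ⟨C', hC', H'⟩ := sq_scale_mul_eLpNorm_le_delta_self n l r hc hρ1 hρc
  refine ⟨C * C', ENNReal.mul_ne_top hC hC', fun φ hφ k m => (H φ hφ k m).trans ?_⟩
  rw [mul_assoc, Finset.mul_sum (a := C') ..]
  exact mul_le_mul' le_rfl (Finset.sum_le_sum fun e _ => H' φ k (m + e))

theorem delta_self_le_scale_modulus (n l : ℕ) (hl : 1 ≤ l) (r : ℝ≥0∞) (hr : 0 < r) {c : ℝ}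
    (hc : 0 < c) :
    ∃ C : ℝ≥0∞, C ≠ ∞ ∧ ∀ φ : (Fin n → ℝ) → ℝ, AEStronglyMeasurable φ volume →
      ∀ (k : ℕ) (m : Fin n → ℤ),
        delta l r ((dyadicCube k m).dilate c) ((dyadicCube k m).dilate c).toSet φ ≤
          C * (scale n k r * modulus l r φ ((dyadicCube k m).dilate c)) := by
  refine ⟨(ENNReal.ofReal c ^ (2 * n)) ^ (-(1 / r.toReal)) *
    (ENNReal.ofReal (2 * c) ^ n) ^ (1 / r.toReal), ENNReal.mul_ne_top
      (ofReal_pow_rpow_ne_top _ hc _) (ofReal_pow_rpow_ne_top _ (by positivity) _),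
    fun φ hφ k m => ?_⟩
  have e1 : ((dyadicCube k m).dilate c).side = c * (1 / 2 ^ k) := rfl
  have h1 := eLpNorm_fdiff_stepSet_le_modulus hl r hr hφ ((dyadicCube k m).dilate c)
    (c * (1 / 2 ^ k))
  rw [volume_ball_pi 0 (by positivity), ENNReal.ofReal_pow (by positivity), ← mul_assoc] at h1
  rw [delta_self l r _ (dilate_side_pos hc), e1, ofReal_mul_side_two_neg_rpow n k r hc]
  refine (mul_le_mul' le_rfl h1).trans (le_of_eq ?_)
  rw [← scale_mul_rpow n k r (by positivity : 0 < 2 * c)]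
  ring

/-- The box x + 2^{-k}Iⁿ has side 2 · 2^{-k}, so nodes lie within (1 + 1/2 + 2l) 2^{-k} of the
centre of Q_{k,m}; this is the half-side of (4l + 3) Q_{k,m}. -/
theorem delta_boxAt_le_scale_bestApprox (n l : ℕ) (r : ℝ≥0∞) {κ : ℝ} (hκ : 4 * l + 3 ≤ κ) :
    ∃ C : ℝ≥0∞, C ≠ ∞ ∧ ∀ φ : (Fin n → ℝ) → ℝ, AEStronglyMeasurable φ volume →
      ∀ (k : ℕ) (m : Fin n → ℤ), ∀ x ∈ (dyadicCube k m).toSet,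
        delta l r (boxAt x (1 / 2 ^ k)) Set.univ φ ≤
          C * (scale n k r * bestApprox l r φ ((dyadicCube k m).dilate κ)) := by
  obtain ⟨C, hC, H⟩ := eLpNorm_fdiff_restrict_le_bestApprox n l r
  have hκ0 : 0 < κ := lt_of_lt_of_le (by positivity) hκ
  refine ⟨(ENNReal.ofReal 2 ^ (2 * n)) ^ (-(1 / r.toReal)) * C *
    (ENNReal.ofReal 2 ^ n) ^ (1 / r.toReal), ENNReal.mul_ne_top (ENNReal.mul_ne_top
      (ofReal_pow_rpow_ne_top _ two_pos _) hC) (ofReal_pow_rpow_ne_top _ two_pos _),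
    fun φ hφ k m x hx => ?_⟩
  have e1 : (boxAt x (1 / 2 ^ k)).side = 2 * (1 / 2 ^ k) := rfl
  have hk : (0 : ℝ) < 1 / 2 ^ k := by positivity
  rw [delta_univ l r _ (by rw [e1]; positivity), e1, ofReal_mul_side_two_neg_rpow n k r two_pos]
  rw [mem_dyadicCube] at hx
  have h1 := H φ hφ (Metric.ball 0 (2 * (1 / 2 ^ k)) ×ˢ (boxAt x (1 / 2 ^ k)).toSet)
    (2 * (1 / 2 ^ k)) ((dyadicCube k m).dilate κ) (by positivity) (fun z hz => hz.1)
    (fun j hj z hz => ?_)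
  · refine (mul_le_mul' le_rfl h1).trans (le_of_eq ?_)
    rw [← scale_mul_rpow n k r two_pos]
    ring
  · obtain ⟨hz1, hz2⟩ := hz
    rw [mem_ball_zero_iff] at hz1
    rw [boxAt_toSet_eq_ball _ hk, mem_ball_iff_norm] at hz2
    rw [mem_dilate_dyadicCube hκ0]
    have hj' : (j : ℝ) ≤ l := by exact_mod_cast hj
    calc ‖z.2 + (j : ℝ) • z.1 - (dyadicCube k m).center‖
        = ‖(z.2 - x) + (x - (dyadicCube k m).center) + (j : ℝ) • z.1‖ := by congr 1; abel
      _ ≤ ‖z.2 - x‖ + ‖x - (dyadicCube k m).center‖ + ‖(j : ℝ) • z.1‖ := norm_add₃_le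
      _ < 1 / 2 ^ k + 1 / 2 * (1 / 2 ^ k) + l * (2 * (1 / 2 ^ k)) := by
        rw [norm_smul, Real.norm_natCast]
        exact add_lt_add_of_lt_of_le (add_lt_add hz2 hx) (by gcongr)
      _ = (4 * l + 3) / 2 * (1 / 2 ^ k) := by ring
      _ ≤ κ / 2 * (1 / 2 ^ k) := by gcongr

theorem delta_dyadicCube_le_delta_boxAt (n l : ℕ) (r : ℝ≥0∞) :
    ∃ C : ℝ≥0∞, C ≠ ∞ ∧ ∀ (φ : (Fin n → ℝ) → ℝ) (k : ℕ) (m : Fin n → ℤ),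
      ∀ x ∈ (dyadicCube k m).toSet, delta l r (dyadicCube k m) Set.univ φ ≤
        C * delta l r (boxAt x (1 / 2 ^ k)) Set.univ φ := by
  refine ⟨((ENNReal.ofReal 2 ^ (2 * n)) ^ (-(1 / r.toReal)))⁻¹,
    ENNReal.inv_ne_top.2 (ofReal_pow_rpow_ne_zero _ two_pos _), fun φ k m x hx => ?_⟩
  have hk : (0 : ℝ) < 1 / 2 ^ k := by positivity
  have e1 : (dyadicCube k m).side = 1 * (1 / 2 ^ k) := by simp [dyadicCube]
  have e2 : (boxAt x (1 / 2 ^ k)).side = 2 * (1 / 2 ^ k) := rfl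
  rw [delta_univ l r _ (by rw [e1]; positivity), delta_univ l r _ (by rw [e2]; positivity), e1, e2,
    ofReal_mul_side_two_neg_rpow n k r two_pos, ofReal_mul_side_two_neg_rpow n k r one_pos,
    mul_assoc ((ENNReal.ofReal 2 ^ (2 * n)) ^ (-(1 / r.toReal))), ← mul_assoc _⁻¹,
    ENNReal.inv_mul_cancel (ofReal_pow_rpow_ne_zero _ two_pos _)
      (ofReal_pow_rpow_ne_top _ two_pos _), one_mul]
  simp only [ENNReal.ofReal_one, one_pow, ENNReal.one_rpow, one_mul]
  refine mul_le_mul' le_rfl (eLpNorm_mono_measure _ (Measure.restrict_mono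
    (Set.prod_mono (Metric.ball_subset_ball (by linarith)) fun y hy => ?_) le_rfl))
  rw [mem_dyadicCube] at hx hy
  rw [boxAt_toSet_eq_ball _ hk, mem_ball_iff_norm]
  calc ‖y - x‖ = ‖(y - (dyadicCube k m).center) - (x - (dyadicCube k m).center)‖ := by
        congr 1; abel
    _ ≤ _ := norm_sub_le _ _
    _ < 1 / 2 * (1 / 2 ^ k) + 1 / 2 * (1 / 2 ^ k) := add_lt_add hy hx
    _ = 1 / 2 ^ k := by ring

theorem eLpNorm_dilate_le_sum {n : ℕ} (r : ℝ≥0∞) (hr : 0 < r) {κ : ℝ} (hκ : 0 < κ) {N : ℕ}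
    (hN : κ / 2 + 1 / 2 ≤ N) (φ : (Fin n → ℝ) → ℝ) (k : ℕ) (m : Fin n → ℤ) :
    eLpNorm φ r (volume.restrict ((dyadicCube k m).dilate κ).toSet) ≤
      ((shifts n N).card : ℝ≥0∞) ^ (1 / r.toReal) *
        ∑ e ∈ shifts n N, eLpNorm φ r (volume.restrict (dyadicCube k (m + e)).toSet) := by
  refine eLpNorm_le_sum_of_cover r hr volume φ _ _ _ ?_
  filter_upwards [ae_exists_mem_dyadicCube n k] with x hx hxT
  obtain ⟨m', hm'⟩ := hx
  refine ⟨m' - m, sub_mem_shifts hκ hN hxT hm', ?_⟩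
  rwa [add_sub_cancel]

/-- Best approximation is at most the norm of φ itself (P = 0). This handles the level k = 0, which
the Besov sum does not contain. -/
theorem delta_unitCube_le_sum_eLpNorm (n l : ℕ) (hl : 1 ≤ l) (r : ℝ≥0∞) (hr : 0 < r) {κ : ℝ}
    (hκ : 4 * l + 3 ≤ κ) {N : ℕ} (hN : κ / 2 + 1 / 2 ≤ N) :
    ∃ C : ℝ≥0∞, C ≠ ∞ ∧ ∀ φ : (Fin n → ℝ) → ℝ, AEStronglyMeasurable φ volume →
      ∀ m : Fin n → ℤ, delta l r (dyadicCube 0 m) Set.univ φ ≤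
        C * ∑ e ∈ shifts n N, eLpNorm φ r (volume.restrict (dyadicCube 0 (m + e)).toSet) := by
  have hκ0 : 0 < κ := lt_of_lt_of_le (by positivity) hκ
  obtain ⟨C₁, hC₁, H₁⟩ := delta_dyadicCube_le_delta_boxAt n l r
  obtain ⟨C₂, hC₂, H₂⟩ := delta_boxAt_le_scale_bestApprox n l r hκ
  refine ⟨C₁ * C₂ * scale n 0 r * ((shifts n N).card : ℝ≥0∞) ^ (1 / r.toReal),
    ENNReal.mul_ne_top (ENNReal.mul_ne_top (ENNReal.mul_ne_top hC₁ hC₂) (scale_ne_top _ _ _))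
      (ENNReal.rpow_ne_top_of_nonneg (by positivity) (by simp)), fun φ hφ m => ?_⟩
  have hx : (dyadicCube 0 m).center ∈ (dyadicCube 0 m).toSet := by
    rw [mem_dyadicCube]; simp
  calc delta l r (dyadicCube 0 m) Set.univ φ
      ≤ C₁ * (C₂ * (scale n 0 r * _)) :=
        (H₁ φ 0 m _ hx).trans (mul_le_mul' le_rfl (H₂ φ hφ 0 m _ hx))
    _ ≤ C₁ * (C₂ * (scale n 0 r * _)) := mul_le_mul' le_rfl (mul_le_mul' le_rfl (mul_le_mul' le_rfl
        ((bestApprox_le_eLpNorm hl r φ _).trans (eLpNorm_dilate_le_sum r hr hκ0 hN φ 0 m))))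
    _ = _ := by ring

theorem eLpNorm_boxAt_le_dilate {n : ℕ} (r : ℝ≥0∞) (φ : (Fin n → ℝ) → ℝ) (m : Fin n → ℤ)
    {x : Fin n → ℝ} (hx : x ∈ (dyadicCube 0 m).toSet) :
    eLpNorm φ r (volume.restrict (boxAt x 1).toSet) ≤
      eLpNorm φ r (volume.restrict ((dyadicCube 0 m).dilate 3).toSet) := by
  refine eLpNorm_mono_measure _ (Measure.restrict_mono (fun y hy => ?_) le_rfl)
  rw [boxAt_toSet_eq_ball _ one_pos, mem_ball_iff_norm] at hy
  rw [mem_dyadicCube] at hx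
  rw [mem_dilate_dyadicCube three_pos]
  have h := norm_sub_le_norm_sub_add_norm_sub y x (dyadicCube 0 m).center
  norm_num at hx ⊢
  linarith

theorem eLpNorm_dyadicCube_le_boxAt {n : ℕ} (r : ℝ≥0∞) (φ : (Fin n → ℝ) → ℝ) (m : Fin n → ℤ)
    {x : Fin n → ℝ} (hx : x ∈ (dyadicCube 0 m).toSet) :
    eLpNorm φ r (volume.restrict (dyadicCube 0 m).toSet) ≤
      eLpNorm φ r (volume.restrict (boxAt x 1).toSet) := by
  refine eLpNorm_mono_measure _ (Measure.restrict_mono (fun y hy => ?_) le_rfl)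
  rw [boxAt_toSet_eq_ball _ one_pos, mem_ball_iff_norm]
  rw [mem_dyadicCube] at hx hy
  have h := norm_sub_le_norm_sub_add_norm_sub y (dyadicCube 0 m).center x
  rw [norm_sub_rev (dyadicCube 0 m).center x] at h
  norm_num at hx hy
  linarith

/-! The `ℓ_q` quasi-norm -/

theorem seqNorm_top {ι : Type} (a : ι → ℝ≥0∞) : seqNorm ∞ a = ⨆ i, a i := if_pos rfl

theorem seqNorm_of_ne_top {ι : Type} {q : ℝ≥0∞} (hq : q ≠ ∞) (a : ι → ℝ≥0∞) :
    seqNorm q a = (∑' i, a i ^ q.toReal) ^ (1 / q.toReal) := if_neg hq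

theorem seqNorm_mono {ι : Type} (q : ℝ≥0∞) {a b : ι → ℝ≥0∞} (h : ∀ i, a i ≤ b i) :
    seqNorm q a ≤ seqNorm q b := by
  rcases eq_or_ne q ∞ with rfl | hqt
  · simpa only [seqNorm_top] using iSup_mono h
  · rw [seqNorm_of_ne_top hqt, seqNorm_of_ne_top hqt]
    exact ENNReal.rpow_le_rpow (ENNReal.tsum_le_tsum fun i =>
      ENNReal.rpow_le_rpow (h i) ENNReal.toReal_nonneg) (by positivity)

theorem seqNorm_const_mul {ι : Type} {q : ℝ≥0∞} (hq : 0 < q) (C : ℝ≥0∞) (a : ι → ℝ≥0∞) :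
    seqNorm q (fun i => C * a i) = C * seqNorm q a := by
  rcases eq_or_ne q ∞ with rfl | hqt
  · simp only [seqNorm_top, ENNReal.mul_iSup]
  · have hs : 0 < q.toReal := ENNReal.toReal_pos hq.ne' hqt
    rw [seqNorm_of_ne_top hqt, seqNorm_of_ne_top hqt]
    simp only [ENNReal.mul_rpow_of_nonneg _ _ hs.le]
    rw [ENNReal.tsum_mul_left, ENNReal.mul_rpow_of_nonneg _ _ (by positivity), ← ENNReal.rpow_mul,
      mul_one_div_cancel hs.ne', ENNReal.rpow_one]

theorem seqNorm_comp_equiv {ι κ : Type} (q : ℝ≥0∞) (e : ι ≃ κ) (a : κ → ℝ≥0∞) :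
    seqNorm q (fun i => a (e i)) = seqNorm q a := by
  rcases eq_or_ne q ∞ with rfl | hqt
  · simpa only [seqNorm_top] using e.iSup_comp
  · rw [seqNorm_of_ne_top hqt, seqNorm_of_ne_top hqt, e.tsum_eq fun i => a i ^ q.toReal]

theorem seqNorm_comp_le_of_injective {ι κ : Type} (q : ℝ≥0∞) {f : ι → κ}
    (hf : Function.Injective f) (a : κ → ℝ≥0∞) : seqNorm q (fun i => a (f i)) ≤ seqNorm q a := by
  rcases eq_or_ne q ∞ with rfl | hqt
  · simpa only [seqNorm_top] using iSup_comp_le a f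
  · rw [seqNorm_of_ne_top hqt, seqNorm_of_ne_top hqt]
    exact ENNReal.rpow_le_rpow (ENNReal.tsum_comp_le_tsum_of_injective hf fun i => a i ^ q.toReal)
      (by positivity)

theorem seqNorm_sum_le {ι κ : Type} {q : ℝ≥0∞} (hq : 0 < q) (s : Finset κ) (a : κ → ι → ℝ≥0∞) :
    seqNorm q (fun i => ∑ e ∈ s, a e i) ≤
      (s.card + 1) * (s.card : ℝ≥0∞) ^ (1 / q.toReal) * ∑ e ∈ s, seqNorm q (a e) := by
  rcases eq_or_ne q ∞ with rfl | hqt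
  · simp only [seqNorm_top, ENNReal.toReal_top, div_zero, ENNReal.rpow_zero, mul_one]
    refine le_trans (iSup_le fun i => Finset.sum_le_sum fun e _ => le_iSup (a e) i) ?_
    exact le_mul_of_one_le_left zero_le le_add_self
  · have hs : 0 < q.toReal := ENNReal.toReal_pos hq.ne' hqt
    simp only [seqNorm_of_ne_top hqt]
    have h1 : ∑' i, (∑ e ∈ s, a e i) ^ q.toReal ≤
        (s.card : ℝ≥0∞) ^ q.toReal * ∑ e ∈ s, ∑' i, a e i ^ q.toReal := by
      rw [← Summable.tsum_finsetSum fun _ _ => ENNReal.summable, ← ENNReal.tsum_mul_left]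
      exact ENNReal.tsum_le_tsum fun i => ENNReal_sum_rpow_le s (fun e => a e i) hs
    refine (ENNReal.rpow_le_rpow h1 (by positivity)).trans ?_
    rw [ENNReal.mul_rpow_of_nonneg _ _ (by positivity), ← ENNReal.rpow_mul,
      mul_one_div_cancel hs.ne', ENNReal.rpow_one, mul_assoc]
    exact mul_le_mul' le_self_add (ENNReal_sum_rpow_le s _ (by positivity))

theorem seqNorm_nat_le {q : ℝ≥0∞} (hq : 0 < q) (a : ℕ → ℝ≥0∞) :
    seqNorm q a ≤ 2 ^ (1 / q.toReal) * (a 0 + seqNorm q fun k => a (k + 1)) := by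
  rcases eq_or_ne q ∞ with rfl | hqt
  · simp only [seqNorm_top, ENNReal.toReal_top, div_zero, ENNReal.rpow_zero, one_mul]
    refine iSup_le fun k => ?_
    cases k with
    | zero => exact le_self_add
    | succ k => exact (le_iSup (fun k => a (k + 1)) k).trans le_add_self
  · have hs : 0 < q.toReal := ENNReal.toReal_pos hq.ne' hqt
    rw [seqNorm_of_ne_top hqt, seqNorm_of_ne_top hqt,
      tsum_eq_zero_add' (f := fun i => a i ^ q.toReal) ENNReal.summable]
    refine (ENNReal_add_rpow_le _ _ (by positivity)).trans (le_of_eq ?_)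
    rw [← ENNReal.rpow_mul (a 0), mul_one_div_cancel hs.ne', ENNReal.rpow_one]

/-- Move the weight to the neighbour at the cost D; each shift e is then a reindexing of the same
sum. -/
theorem exists_seqNorm_mul_sum_le {n : ℕ} {p : ℝ≥0∞} (hp : 0 < p) (N : ℕ) {D : ℝ≥0∞} (hD : D ≠ ∞) :
    ∃ C : ℝ≥0∞, C ≠ ∞ ∧ ∀ T B : (Fin n → ℤ) → ℝ≥0∞,
      (∀ m, ∀ e ∈ shifts n N, T m ≤ D * T (m + e)) →
      seqNorm p (fun m => T m * ∑ e ∈ shifts n N, B (m + e)) ≤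
        C * seqNorm p fun m => T m * B m := by
  refine ⟨D * (((shifts n N).card + 1) * ((shifts n N).card : ℝ≥0∞) ^ (1 / p.toReal)) *
    (shifts n N).card, ENNReal.mul_ne_top (ENNReal.mul_ne_top hD (ENNReal.mul_ne_top (by simp)
      (ENNReal.rpow_ne_top_of_nonneg (by positivity) (by simp)))) (by simp), fun T B hT => ?_⟩
  have h1 : ∀ m, T m * ∑ e ∈ shifts n N, B (m + e) ≤
      D * ∑ e ∈ shifts n N, T (m + e) * B (m + e) := fun m => by
    rw [Finset.mul_sum, Finset.mul_sum]
    refine Finset.sum_le_sum fun e he => ?_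
    rw [← mul_assoc]
    exact mul_le_mul' (hT m e he) le_rfl
  refine (seqNorm_mono p h1).trans ?_
  rw [seqNorm_const_mul hp, mul_assoc, mul_assoc]
  refine mul_le_mul' le_rfl ((seqNorm_sum_le hp _ _).trans (le_of_eq ?_))
  have h2 : ∀ e ∈ shifts n N, seqNorm p (fun m => T (m + e) * B (m + e)) =
      seqNorm p fun m => T m * B m := fun e _ =>
    seqNorm_comp_equiv p (Equiv.addRight e) fun m => T m * B m
  rw [Finset.sum_congr rfl h2, Finset.sum_const, nsmul_eq_mul]

/-! Weighted norms over the dyadic cubes of one level -/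

theorem volume_eq_sum_restrict_dyadicCube (n k : ℕ) :
    (volume : Measure (Fin n → ℝ)) =
      Measure.sum fun m : Fin n → ℤ => volume.restrict (dyadicCube k m).toSet := by
  rw [← Measure.restrict_iUnion (fun _ _ h => disjoint_dyadicCube h)
    fun m => (dyadicCube k m).isOpen_toSet.measurableSet]
  refine (Measure.restrict_eq_self_of_ae_mem ?_).symm
  filter_upwards [ae_exists_mem_dyadicCube n k] with x hx
  exact Set.mem_iUnion.2 hx

/-- The open cubes of one level partition the space up to a null set. -/
theorem eLpNorm_eq_seqNorm_dyadicCube {n : ℕ} (k : ℕ) {p : ℝ≥0∞} (hp : 0 < p)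
    (f : (Fin n → ℝ) → ℝ≥0∞) :
    eLpNorm f p volume =
      seqNorm p fun m : Fin n → ℤ => eLpNorm f p (volume.restrict (dyadicCube k m).toSet) := by
  rcases eq_or_ne p ∞ with rfl | hpt
  · rw [seqNorm_top]
    refine le_antisymm ?_ (iSup_le fun m => eLpNorm_mono_measure _ Measure.restrict_le_self)
    rw [eLpNorm_exponent_top]
    refine eLpNormEssSup_le_of_ae_enorm_bound ?_
    rw [volume_eq_sum_restrict_dyadicCube n k, Measure.ae_sum_iff]
    intro m
    filter_upwards [enorm_ae_le_eLpNormEssSup f (volume.restrict (dyadicCube k m).toSet)] with x hx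
    refine hx.trans ?_
    rw [← eLpNorm_exponent_top, ← volume_eq_sum_restrict_dyadicCube n k]
    exact le_iSup (fun m : Fin n → ℤ => eLpNorm f ∞ (volume.restrict (dyadicCube k m).toSet)) m
  · have hs : 0 < p.toReal := ENNReal.toReal_pos hp.ne' hpt
    rw [seqNorm_of_ne_top hpt, eLpNorm_eq_lintegral_rpow_enorm_toReal hp.ne' hpt]
    congr 1
    have h : ∀ m : Fin n → ℤ,
        eLpNorm f p (volume.restrict (dyadicCube k m).toSet) ^ p.toReal =
          ∫⁻ x in (dyadicCube k m).toSet, ‖f x‖ₑ ^ p.toReal := fun m => by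
      rw [eLpNorm_eq_lintegral_rpow_enorm_toReal hp.ne' hpt, ← ENNReal.rpow_mul,
        one_div_mul_cancel hs.ne', ENNReal.rpow_one]
    simp only [h]
    rw [← lintegral_sum_measure, ← volume_eq_sum_restrict_dyadicCube]

theorem eLpNorm_ofReal_mul_const {X : Type*} [MeasurableSpace X] {μ : Measure X} {p : ℝ≥0∞}
    (hp : 0 < p) {w : X → ℝ} (hw : AEMeasurable w μ) (hw0 : ∀ x, 0 < w x) (c : ℝ≥0∞) :
    eLpNorm (fun x => ENNReal.ofReal (w x) * c) p μ = eLpNorm w p μ * c := by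
  have h : ∀ x, ‖w x‖ₑ = ENNReal.ofReal (w x) := fun x => Real.enorm_of_nonneg (hw0 x).le
  rcases eq_or_ne p ∞ with rfl | hpt
  · rw [eLpNorm_exponent_top, eLpNorm_exponent_top, eLpNormEssSup_eq_essSup_enorm,
      eLpNormEssSup_eq_essSup_enorm]
    simp only [enorm_eq_self, h, mul_comm _ c]
    exact ENNReal.essSup_const_mul
  · have hs : 0 < p.toReal := ENNReal.toReal_pos hp.ne' hpt
    rw [eLpNorm_eq_lintegral_rpow_enorm_toReal hp.ne' hpt,
      eLpNorm_eq_lintegral_rpow_enorm_toReal hp.ne' hpt]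
    simp only [enorm_eq_self, h, ENNReal.mul_rpow_of_nonneg _ _ hs.le]
    rw [lintegral_mul_const'' _ (hw.ennreal_ofReal.pow_const _),
      ENNReal.mul_rpow_of_nonneg _ _ (by positivity), ← ENNReal.rpow_mul c,
      mul_one_div_cancel hs.ne', ENNReal.rpow_one]

theorem eLpNorm_ofReal_mul_le_seqNorm {n : ℕ} (k : ℕ) {p : ℝ≥0∞} (hp : 0 < p)
    {w : (Fin n → ℝ) → ℝ} (hw : IsWeight w) {G : (Fin n → ℝ) → ℝ≥0∞} {c : (Fin n → ℤ) → ℝ≥0∞}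
    (h : ∀ m, ∀ x ∈ (dyadicCube k m).toSet, G x ≤ c m) :
    eLpNorm (fun x => ENNReal.ofReal (w x) * G x) p volume ≤
      seqNorm p fun m => eLpNorm w p (volume.restrict (dyadicCube k m).toSet) * c m := by
  rw [eLpNorm_eq_seqNorm_dyadicCube k hp]
  refine seqNorm_mono p fun m => ?_
  rw [← eLpNorm_ofReal_mul_const hp hw.1.restrict hw.2]
  refine eLpNorm_mono_enorm_ae ?_
  filter_upwards [ae_restrict_mem (dyadicCube k m).isOpen_toSet.measurableSet] with x hx
  simp only [enorm_eq_self]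
  exact mul_le_mul' le_rfl (h m x hx)

theorem seqNorm_le_eLpNorm_ofReal_mul {n : ℕ} (k : ℕ) {p : ℝ≥0∞} (hp : 0 < p)
    {w : (Fin n → ℝ) → ℝ} (hw : IsWeight w) {G : (Fin n → ℝ) → ℝ≥0∞} {c : (Fin n → ℤ) → ℝ≥0∞}
    (h : ∀ m, ∀ x ∈ (dyadicCube k m).toSet, c m ≤ G x) :
    (seqNorm p fun m => eLpNorm w p (volume.restrict (dyadicCube k m).toSet) * c m) ≤
      eLpNorm (fun x => ENNReal.ofReal (w x) * G x) p volume := by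
  rw [eLpNorm_eq_seqNorm_dyadicCube k hp]
  refine seqNorm_mono p fun m => ?_
  rw [← eLpNorm_ofReal_mul_const hp hw.1.restrict hw.2]
  refine eLpNorm_mono_enorm_ae ?_
  filter_upwards [ae_restrict_mem (dyadicCube k m).isOpen_toSet.measurableSet] with x hx
  simp only [enorm_eq_self]
  exact mul_le_mul' le_rfl (h m x hx)

/-! Neighbouring weights -/

/-- The doubling condition covers shifts by at most 1 per coordinate. Moving by the sign vector of e
shortens every nonzero coordinate by one, so N moves suffice. -/
theorem InClassX.assoc_le_of_mem_shifts {n : ℕ} {α₁ α₂ α₃ : ℝ} {σ₁ σ₂ p : ℝ≥0∞}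
    {t : ℕ → (Fin n → ℝ) → ℝ} (ht : InClassX α₁ α₂ α₃ σ₁ σ₂ p t) (k N : ℕ) (m : Fin n → ℤ)
    {e : Fin n → ℤ} (he : e ∈ shifts n N) :
    assoc p t k m ≤ ENNReal.ofReal ((2 : ℝ) ^ α₃) ^ N * assoc p t k (m + e) := by
  induction N generalizing m e with
  | zero =>
    rw [mem_shifts] at he
    obtain rfl : e = 0 := by
      funext i
      have := he i
      simpa using this
    simp
  | succ N ih =>
    rw [mem_shifts] at he
    have h1 : (fun i => e i - (e i).sign) ∈ shifts n N := by
      rw [mem_shifts]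
      intro i
      have := he i
      rcases lt_trichotomy (e i) 0 with h | h | h
      · rw [Int.sign_eq_neg_one_of_neg h]; rw [abs_of_neg h] at this
        rw [abs_of_nonpos (by omega)]; push_cast at this; omega
      · simp [h]
      · rw [Int.sign_eq_one_of_pos h]; rw [abs_of_pos h] at this
        rw [abs_of_nonneg (by omega)]; push_cast at this; omega
    have h2 := (ht.doubling k m (m + fun i => (e i).sign) fun i => by
      rcases lt_trichotomy (e i) 0 with h | h | h
      · simp [Int.sign_eq_neg_one_of_neg h]
      · simp [h]
      · simp [Int.sign_eq_one_of_pos h]).2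
    have h3 := ih (m + fun i => (e i).sign) h1
    have e1 : m + (fun i => (e i).sign) + (fun i => e i - (e i).sign) = m + e := by
      funext i
      simp
    rw [e1] at h3
    calc _ ≤ _ := h2
      _ ≤ _ := mul_le_mul' le_rfl h3
      _ = _ := by ring

theorem eLpNorm_ennreal_const_mul {X : Type*} [MeasurableSpace X] {μ : Measure X} {p C : ℝ≥0∞}
    (hp : 0 < p) (hC : C ≠ ∞) (f : X → ℝ≥0∞) :
    eLpNorm (fun x => C * f x) p μ = C * eLpNorm f p μ := by
  rcases eq_or_ne p ∞ with rfl | hpt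
  · rw [eLpNorm_exponent_top, eLpNorm_exponent_top, eLpNormEssSup_eq_essSup_enorm,
      eLpNormEssSup_eq_essSup_enorm]
    simp only [enorm_eq_self]
    exact ENNReal.essSup_const_mul
  · have hs : 0 < p.toReal := ENNReal.toReal_pos hp.ne' hpt
    rw [eLpNorm_eq_lintegral_rpow_enorm_toReal hp.ne' hpt,
      eLpNorm_eq_lintegral_rpow_enorm_toReal hp.ne' hpt]
    simp only [enorm_eq_self, ENNReal.mul_rpow_of_nonneg _ _ hs.le]
    rw [lintegral_const_mul' _ _ (ENNReal.rpow_ne_top_of_nonneg hs.le hC),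
      ENNReal.mul_rpow_of_nonneg _ _ (by positivity), ← ENNReal.rpow_mul C,
      mul_one_div_cancel hs.ne', ENNReal.rpow_one]

theorem LocMemLp.aestronglyMeasurable {n : ℕ} {f : (Fin n → ℝ) → ℝ} {r : ℝ≥0∞}
    (hf : LocMemLp f r) : AEStronglyMeasurable f volume := by
  have h : AEStronglyMeasurable f (volume.restrict (⋃ i, compactCovering (Fin n → ℝ) i)) :=
    aestronglyMeasurable_iUnion_iff.2 fun i => (hf _ (isCompact_compactCovering _ i)).1
  rwa [iUnion_compactCovering, Measure.restrict_univ] at h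

theorem EquivToBesovNorm.of_le {n l : ℕ} {p q r : ℝ≥0∞} {t : ℕ → (Fin n → ℝ) → ℝ}
    {N' : ((Fin n → ℝ) → ℝ) → ℝ≥0∞} {C C' : ℝ≥0∞} (hC : C ≠ ∞) (hC' : C' ≠ ∞)
    (h : ∀ φ, AEStronglyMeasurable φ volume → N' φ ≤ C * besovNorm l p q r t φ)
    (h' : ∀ φ, AEStronglyMeasurable φ volume → besovNorm l p q r t φ ≤ C' * N' φ) :
    EquivToBesovNorm l p q r t N' := by
  refine ⟨fun φ hφ => ⟨fun H => ?_, fun H => ⟨hφ, ?_⟩⟩, (max C C').toNNReal, fun φ hφ => ?_⟩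
  · exact (h φ hφ.aestronglyMeasurable).trans_lt (ENNReal.mul_lt_top hC.lt_top H.2)
  · exact (h' φ hφ.aestronglyMeasurable).trans_lt (ENNReal.mul_lt_top hC'.lt_top H)
  · have hm : max C C' ≠ ∞ := by simp [hC, hC']
    rw [ENNReal.coe_toNNReal hm]
    exact ⟨(h φ hφ.1.aestronglyMeasurable).trans (mul_le_mul' (le_max_left _ _) le_rfl),
      (h' φ hφ.1.aestronglyMeasurable).trans (mul_le_mul' (le_max_right _ _) le_rfl)⟩

/-! ### Comparison of the global quasi-norms -/

section

variable {n : ℕ} {α₁ α₂ α₃ : ℝ} {σ₁ σ₂ p q r : ℝ≥0∞} {t : ℕ → (Fin n → ℝ) → ℝ}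

theorem InClassX.exists_seqNorm_assoc_mul_sum_le (ht : InClassX α₁ α₂ α₃ σ₁ σ₂ p t) (hp : 0 < p)
    (N : ℕ) : ∃ C : ℝ≥0∞, C ≠ ∞ ∧ ∀ (k : ℕ) (B : (Fin n → ℤ) → ℝ≥0∞),
      seqNorm p (fun m => assoc p t k m * ∑ e ∈ shifts n N, B (m + e)) ≤
        C * seqNorm p fun m => assoc p t k m * B m := by
  obtain ⟨C, hC, H⟩ := exists_seqNorm_mul_sum_le (n := n) hp N
    (D := ENNReal.ofReal ((2 : ℝ) ^ α₃) ^ N) (by finiteness)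
  exact ⟨C, hC, fun k B => H _ B fun m e he => ht.assoc_le_of_mem_shifts k N m he⟩

/-- Comparison of the discrete quasi-norms of two families of local quantities one of which is
controlled by the other one at neighbouring cubes. -/
theorem InClassX.discreteNorm_le_of_le_sum (ht : InClassX α₁ α₂ α₃ σ₁ σ₂ p t) (hp : 0 < p)
    (hq : 0 < q) (N k₀ : ℕ) {C : ℝ≥0∞} (hC : C ≠ ∞) : ∃ C' : ℝ≥0∞, C' ≠ ∞ ∧
      ∀ (φ : (Fin n → ℝ) → ℝ) (A B : ℕ → (Fin n → ℤ) → ℝ≥0∞),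
      (∀ k m, A k m ≤ C * ∑ e ∈ shifts n N, B k (m + e)) →
      discreteNorm k₀ p q r t φ A ≤ C' * discreteNorm k₀ p q r t φ B := by
  obtain ⟨D, hD, H⟩ := ht.exists_seqNorm_assoc_mul_sum_le hp N
  refine ⟨C * D + 1, ENNReal.add_ne_top.2 ⟨ENNReal.mul_ne_top hC hD, by simp⟩,
    fun φ A B hAB => ?_⟩
  rw [discreteNorm, discreteNorm, mul_add]
  refine add_le_add ?_ (le_mul_of_one_le_left zero_le le_add_self)
  rw [← seqNorm_const_mul hq]
  refine seqNorm_mono q fun k => ?_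
  refine le_trans ?_ (mul_le_mul' (le_self_add (b := (1 : ℝ≥0∞))) le_rfl)
  rw [mul_assoc]
  refine le_trans ?_ (mul_le_mul' le_rfl (H (k₀ + k) (B (k₀ + k))))
  rw [← seqNorm_const_mul hp]
  refine seqNorm_mono p fun m => ?_
  rw [mul_left_comm]
  exact mul_le_mul' le_rfl (hAB _ m)

theorem discreteNorm_le_of_le (hp : 0 < p) (hq : 0 < q) (k₀ : ℕ) {C : ℝ≥0∞}
    (φ : (Fin n → ℝ) → ℝ) {A B : ℕ → (Fin n → ℤ) → ℝ≥0∞} (hAB : ∀ k m, A k m ≤ C * B k m) :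
    discreteNorm k₀ p q r t φ A ≤ (C + 1) * discreteNorm k₀ p q r t φ B := by
  rw [discreteNorm, discreteNorm, mul_add]
  refine add_le_add ?_ (le_mul_of_one_le_left zero_le le_add_self)
  rw [← seqNorm_const_mul hq]
  refine seqNorm_mono q fun k => ?_
  rw [← seqNorm_const_mul hp]
  refine seqNorm_mono p fun m => ?_
  rw [mul_left_comm]
  exact mul_le_mul' le_rfl ((hAB _ m).trans (mul_le_mul' le_self_add le_rfl))

/-- The Besov quasi-norm is controlled by best approximations on strongly dilated cubes. -/
theorem InClassX.besovNorm_le_norm3 (ht : InClassX α₁ α₂ α₃ σ₁ σ₂ p t) (hp : 0 < p) (hq : 0 < q)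
    (hr : 0 < r) (l k₀ : ℕ) (hk₀ : k₀ ≤ 1) {κ : ℝ} (hκ : 4 * l + 3 ≤ κ) :
    ∃ C : ℝ≥0∞, C ≠ ∞ ∧ ∀ φ : (Fin n → ℝ) → ℝ, AEStronglyMeasurable φ volume →
      besovNorm l p q r t φ ≤ C * norm3 k₀ l p q r t κ φ := by
  obtain ⟨C₁, hC₁, H₁⟩ := delta_boxAt_le_scale_bestApprox n l r hκ
  obtain ⟨C₂, hC₂, H₂⟩ := ht.exists_seqNorm_assoc_mul_sum_le hp 2
  set c := ((shifts n 2).card : ℝ≥0∞) ^ (1 / r.toReal) with hc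
  have hct : c ≠ ∞ := ENNReal.rpow_ne_top_of_nonneg (by positivity) (by simp)
  refine ⟨C₁ + c * C₂, ENNReal.add_ne_top.2 ⟨hC₁, ENNReal.mul_ne_top hct hC₂⟩, fun φ hφ => ?_⟩
  rw [besovNorm, norm3, discreteNorm, mul_add]
  refine add_le_add ?_ ?_
  · refine le_trans ?_ (mul_le_mul' le_self_add le_rfl)
    have h1 : ∀ k : ℕ, eLpNorm (fun x => ENNReal.ofReal (t (k + 1) x) *
        delta l r (boxAt x (1 / 2 ^ (k + 1))) Set.univ φ) p volume ≤
        C₁ * seqNorm p fun m => assoc p t (k + 1) m *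
          (scale n (k + 1) r * bestApprox l r φ ((dyadicCube (k + 1) m).dilate κ)) := fun k => by
      refine (eLpNorm_ofReal_mul_le_seqNorm (k + 1) hp (ht.admissible (k + 1)).1
        fun m x hx => H₁ φ hφ (k + 1) m x hx).trans (le_of_eq ?_)
      rw [← seqNorm_const_mul hp]
      congr 1
      funext m
      rw [mul_left_comm]
      rfl
    refine (seqNorm_mono q h1).trans ?_
    rw [seqNorm_const_mul hq]
    refine mul_le_mul' le_rfl ?_
    -- The Besov sum starts at level 1 and the discrete one at k₀ ≤ 1; the shift 1 - k₀ aligns them.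
    have h2 := seqNorm_comp_le_of_injective q (f := fun k : ℕ => k + (1 - k₀))
      (fun a b hab => by simpa using hab) fun k : ℕ => seqNorm p fun m => assoc p t (k₀ + k) m *
        (scale n (k₀ + k) r * bestApprox l r φ ((dyadicCube (k₀ + k) m).dilate κ))
    refine le_trans (le_of_eq ?_) h2
    congr 1
    funext k
    rw [show k₀ + (k + (1 - k₀)) = k + 1 by omega]
  · refine le_trans ?_ (mul_le_mul' le_add_self le_rfl)
    rw [mul_assoc]
    refine le_trans ?_ (mul_le_mul' le_rfl (H₂ 0 _))
    rw [← seqNorm_const_mul hp]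
    have h1 : ∀ m : Fin n → ℤ, ∀ x ∈ (dyadicCube 0 m).toSet,
        eLpNorm φ r (volume.restrict (boxAt x 1).toSet) ≤ c * ∑ e ∈ shifts n 2,
          eLpNorm φ r (volume.restrict (dyadicCube 0 (m + e)).toSet) := fun m x hx =>
      (eLpNorm_boxAt_le_dilate r φ m hx).trans
        (eLpNorm_dilate_le_sum r hr three_pos (by norm_num) φ 0 m)
    refine (eLpNorm_ofReal_mul_le_seqNorm 0 hp (ht.admissible 0).1 h1).trans (le_of_eq ?_)
    congr 1
    funext m
    rw [mul_left_comm]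
    rfl

theorem InClassX.norm1_le_besovNorm (ht : InClassX α₁ α₂ α₃ σ₁ σ₂ p t) (hp : 0 < p) (hq : 0 < q)
    (hr : 0 < r) (l k₀ : ℕ) (hl : 1 ≤ l) (hk₀ : k₀ ≤ 1) :
    ∃ C : ℝ≥0∞, C ≠ ∞ ∧ ∀ φ : (Fin n → ℝ) → ℝ, AEStronglyMeasurable φ volume →
      norm1 k₀ l p q r t φ ≤ C * besovNorm l p q r t φ := by
  obtain ⟨C₁, hC₁, H₁⟩ := delta_dyadicCube_le_delta_boxAt n l r
  -- For κ = 4l + 3 the covering condition κ/2 + 1/2 ≤ N holds with equality at N = 2l + 2.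
  obtain ⟨C₂, hC₂, H₂⟩ := delta_unitCube_le_sum_eLpNorm n l hl r hr (κ := 4 * l + 3) le_rfl
    (N := 2 * l + 2) (by push_cast; linarith)
  obtain ⟨C₃, hC₃, H₃⟩ := ht.exists_seqNorm_assoc_mul_sum_le hp (2 * l + 2)
  set d : ℝ≥0∞ := 2 ^ (1 / q.toReal) with hd
  have hdt : d ≠ ∞ := ENNReal.rpow_ne_top_of_nonneg (by positivity) (by simp)
  have hd1 : 1 ≤ d := by
    simpa [hd] using ENNReal.rpow_le_rpow (one_le_two : (1 : ℝ≥0∞) ≤ 2) (by positivity : 0 ≤ 1 / q.toReal)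
  refine ⟨d * (C₁ + C₂ * C₃) + 1, ENNReal.add_ne_top.2 ⟨ENNReal.mul_ne_top hdt
    (ENNReal.add_ne_top.2 ⟨hC₁, ENNReal.mul_ne_top hC₂ hC₃⟩), by simp⟩, fun φ hφ => ?_⟩
  set X : ℕ → ℝ≥0∞ := fun k => seqNorm p fun m => assoc p t k m *
    delta l r (dyadicCube k m) Set.univ φ with hX
  set Y : ℝ≥0∞ := seqNorm q (fun k : ℕ => eLpNorm (fun x => ENNReal.ofReal (t (k + 1) x) *
      delta l r (boxAt x (1 / 2 ^ (k + 1))) Set.univ φ) p volume) with hY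
  set Z : ℝ≥0∞ := eLpNorm (fun x => ENNReal.ofReal (t 0 x) *
      eLpNorm φ r (volume.restrict (boxAt x 1).toSet)) p volume with hZ
  set W : ℝ≥0∞ := seqNorm p (fun m : Fin n → ℤ =>
      assoc p t 0 m * eLpNorm φ r (volume.restrict (dyadicCube 0 m).toSet)) with hW
  have hWZ : W ≤ Z := seqNorm_le_eLpNorm_ofReal_mul 0 hp (ht.admissible 0).1
    fun m x hx => eLpNorm_dyadicCube_le_boxAt r φ m hx
  have hXY : seqNorm q (fun k => X (k + 1)) ≤ C₁ * Y := by
    rw [hY, ← seqNorm_const_mul hq]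
    refine seqNorm_mono q fun k => ?_
    refine (seqNorm_le_eLpNorm_ofReal_mul (k + 1) hp (ht.admissible (k + 1)).1
      (G := fun x => C₁ * delta l r (boxAt x (1 / 2 ^ (k + 1))) Set.univ φ)
      fun m x hx => H₁ φ (k + 1) m x hx).trans (le_of_eq ?_)
    rw [← eLpNorm_ennreal_const_mul hp hC₁]
    congr 1
    funext x
    rw [mul_left_comm]
  have hX0 : X 0 ≤ C₂ * C₃ * W := by
    rw [mul_assoc]
    refine le_trans ?_ (mul_le_mul' le_rfl (H₃ 0 _))
    rw [← seqNorm_const_mul hp]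
    refine seqNorm_mono p fun m => ?_
    rw [mul_left_comm]
    exact mul_le_mul' le_rfl (H₂ φ hφ m)
  -- Whether or not level 0 belongs to the sum, it is bounded by splitting that level off.
  have hX' : seqNorm q (fun k => X (k₀ + k)) ≤ d * (X 0 + seqNorm q fun k => X (k + 1)) := by
    obtain rfl | rfl : k₀ = 0 ∨ k₀ = 1 := by omega
    · simpa only [zero_add] using seqNorm_nat_le hq X
    · simp only [add_comm 1]
      exact le_add_self.trans (le_mul_of_one_le_left zero_le hd1)
  calc norm1 k₀ l p q r t φ = seqNorm q (fun k => X (k₀ + k)) + W := rfl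
    _ ≤ d * (C₂ * C₃ * Z + C₁ * Y) + Z :=
      add_le_add (hX'.trans (mul_le_mul' le_rfl (add_le_add
        (hX0.trans (mul_le_mul' le_rfl hWZ)) hXY))) hWZ
    _ ≤ d * ((C₁ + C₂ * C₃) * Z + (C₁ + C₂ * C₃) * Y) + (Z + Y) := by
      gcongr
      · exact le_add_self
      · exact le_self_add
      · exact le_self_add
    _ = (d * (C₁ + C₂ * C₃) + 1) * (Y + Z) := by ring

end

end VarBesov


theorem theorem2p3 (n l k₀ : ℕ) (hn : 1 ≤ n) (hl : 1 ≤ l) (hk₀ : k₀ ≤ 1)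
    (p q r σ₁ σ₂ : ℝ≥0∞) (hp : 0 < p) (hq : 0 < q) (hr : 0 < r) (hσ₁ : 0 < σ₁) (hσ₂ : 0 < σ₂)
    (α₁ α₂ α₃ : ℝ) (hα₃ : 0 ≤ α₃)
    (t : ℕ → (Fin n → ℝ) → ℝ) (ht : VarBesov.InClassX α₁ α₂ α₃ σ₁ σ₂ p t)
    (c : ℝ) (hc : 1 < c) :
    VarBesov.EquivToBesovNorm l p q r t (VarBesov.norm1 k₀ l p q r t) ∧
    VarBesov.EquivToBesovNorm l p q r t (VarBesov.norm2 k₀ l p q r t c) ∧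
    VarBesov.EquivToBesovNorm l p q r t (VarBesov.norm3 k₀ l p q r t c) ∧
    VarBesov.EquivToBesovNorm l p q r t (VarBesov.norm4 k₀ l p q r t c) := by
  open VarBesov in
  have hc0 : 0 < c := one_pos.trans hc
  -- The bound 4l + 3 lets κQ_{k,m} contain all nodes of the Besov differences; c ≤ κ gives
  -- monotonicity from c to κ.
  obtain ⟨κ, hκ, hcκ⟩ : ∃ κ : ℝ, 4 * l + 3 ≤ κ ∧ c ≤ κ := ⟨_, le_max_left _ _, le_max_right _ _⟩
  have hκ0 : 0 < κ := hc0.trans_le hcκ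
  obtain ⟨N, hN⟩ := exists_nat_ge (κ / 2 + 1 / 2)
  obtain ⟨A₁, hA₁, B1⟩ := ht.besovNorm_le_norm3 hp hq hr l k₀ hk₀ hκ
  obtain ⟨A₂, hA₂, B2⟩ := ht.norm1_le_besovNorm hp hq hr l k₀ hl hk₀
  obtain ⟨C₃, hC₃, H₃⟩ := scale_bestApprox_le_sum_delta_univ n l hl r hr hκ0 hN
  obtain ⟨A₃, hA₃, B3⟩ := ht.discreteNorm_le_of_le_sum (r := r) hp hq N k₀ hC₃
  obtain ⟨C₄, hC₄, H₄⟩ := scale_bestApprox_le_sum_delta_self n l hl r hr hc hκ0 hN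
  obtain ⟨A₄, hA₄, B4⟩ := ht.discreteNorm_le_of_le_sum (r := r) hp hq N k₀ hC₄
  obtain ⟨C₅, hC₅, H₅⟩ := delta_self_le_scale_modulus n l hl r hr hc0
  obtain ⟨C₆, hC₆, H₆⟩ := modulus_le_bestApprox n l r
  have E31 : ∀ φ, AEStronglyMeasurable φ volume →
      norm3 k₀ l p q r t κ φ ≤ A₃ * norm1 k₀ l p q r t φ := fun φ hφ => B3 φ _ _ (H₃ φ hφ)
  have E32 : ∀ φ, AEStronglyMeasurable φ volume →
      norm3 k₀ l p q r t κ φ ≤ A₄ * norm2 k₀ l p q r t c φ := fun φ hφ => B4 φ _ _ (H₄ φ hφ)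
  have E24 : ∀ φ, AEStronglyMeasurable φ volume →
      norm2 k₀ l p q r t c φ ≤ (C₅ + 1) * norm4 k₀ l p q r t c φ := fun φ hφ =>
    discreteNorm_le_of_le hp hq k₀ φ (H₅ φ hφ)
  have E43 : ∀ φ, AEStronglyMeasurable φ volume →
      norm4 k₀ l p q r t c φ ≤ (C₆ + 1) * norm3 k₀ l p q r t c φ := fun φ hφ =>
    discreteNorm_le_of_le hp hq k₀ φ fun k m => by
      rw [mul_left_comm]
      exact mul_le_mul' le_rfl (H₆ φ hφ _ (dilate_side_pos hc0))
  have E33 : ∀ φ, norm3 k₀ l p q r t c φ ≤ (1 + 1) * norm3 k₀ l p q r t κ φ := fun φ =>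
    discreteNorm_le_of_le hp hq k₀ φ fun k m => by
      rw [one_mul]
      refine mul_le_mul' le_rfl (bestApprox_mono l r φ fun x hx => ?_)
      rw [mem_dilate_dyadicCube hc0] at hx
      rw [mem_dilate_dyadicCube hκ0]
      exact hx.trans_le (by gcongr)
  have F3κ : ∀ φ, AEStronglyMeasurable φ volume →
      norm3 k₀ l p q r t κ φ ≤ A₃ * A₂ * besovNorm l p q r t φ := fun φ hφ =>
    (E31 φ hφ).trans ((mul_le_mul' le_rfl (B2 φ hφ)).trans_eq (mul_assoc _ _ _).symm)
  have F3 : ∀ φ, AEStronglyMeasurable φ volume →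
      norm3 k₀ l p q r t c φ ≤ (1 + 1) * (A₃ * A₂) * besovNorm l p q r t φ := fun φ hφ =>
    (E33 φ).trans ((mul_le_mul' le_rfl (F3κ φ hφ)).trans_eq (mul_assoc _ _ _).symm)
  have F4 : ∀ φ, AEStronglyMeasurable φ volume → norm4 k₀ l p q r t c φ ≤
      (C₆ + 1) * ((1 + 1) * (A₃ * A₂)) * besovNorm l p q r t φ := fun φ hφ =>
    (E43 φ hφ).trans ((mul_le_mul' le_rfl (F3 φ hφ)).trans_eq (mul_assoc _ _ _).symm)
  have F2 : ∀ φ, AEStronglyMeasurable φ volume → norm2 k₀ l p q r t c φ ≤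
      (C₅ + 1) * ((C₆ + 1) * ((1 + 1) * (A₃ * A₂))) * besovNorm l p q r t φ := fun φ hφ =>
    (E24 φ hφ).trans ((mul_le_mul' le_rfl (F4 φ hφ)).trans_eq (mul_assoc _ _ _).symm)
  have G1 : ∀ φ, AEStronglyMeasurable φ volume →
      besovNorm l p q r t φ ≤ A₁ * A₃ * norm1 k₀ l p q r t φ := fun φ hφ =>
    (B1 φ hφ).trans ((mul_le_mul' le_rfl (E31 φ hφ)).trans_eq (mul_assoc _ _ _).symm)
  have G2 : ∀ φ, AEStronglyMeasurable φ volume →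
      besovNorm l p q r t φ ≤ A₁ * A₄ * norm2 k₀ l p q r t c φ := fun φ hφ =>
    (B1 φ hφ).trans ((mul_le_mul' le_rfl (E32 φ hφ)).trans_eq (mul_assoc _ _ _).symm)
  have G4 : ∀ φ, AEStronglyMeasurable φ volume →
      besovNorm l p q r t φ ≤ A₁ * A₄ * (C₅ + 1) * norm4 k₀ l p q r t c φ := fun φ hφ =>
    (G2 φ hφ).trans ((mul_le_mul' le_rfl (E24 φ hφ)).trans_eq (mul_assoc _ _ _).symm)
  have G3 : ∀ φ, AEStronglyMeasurable φ volume →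
      besovNorm l p q r t φ ≤ A₁ * A₄ * (C₅ + 1) * (C₆ + 1) * norm3 k₀ l p q r t c φ := fun φ hφ =>
    (G4 φ hφ).trans ((mul_le_mul' le_rfl (E43 φ hφ)).trans_eq (mul_assoc _ _ _).symm)
  exact ⟨.of_le hA₂ (by finiteness) B2 G1, .of_le (by finiteness) (by finiteness) F2 G2,
    .of_le (by finiteness) (by finiteness) F3 G3, .of_le (by finiteness) (by finiteness) F4 G4⟩
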